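/- Fix $q\in\mathbb{C}$ with $0<|q|<1$ and write $(a)_\infty=\prod_{i\ge 0}(1-aq^i)$, $(a)_l=\prod_{i=0}^{l-1}(1-aq^i)$ for integers $l\ge 0$, and $(a_1,\dots,a_r)_\infty=(a_1)_\infty\cdots(a_r)_\infty$. For integers $M\ge 1$, $N\geq 0$, Kajihara's very well-poised $q$-hypergeometric series is $$W^{M,N}(\{x_i\}_{1\le i\le M};a;\{u_j\}_{1\le j\le M+N};\{v_k\}_{1\le k\le N};z)=\sum_{l\in\mathbb{Z}_{\ge0}^M}z^{|l|}\frac{\Delta(xq^l)}{\Delta(x)}\prod_{i=1}^M\left(\frac{1-ax_iq^{|l|+l_i}}{1-ax_i}\cdot\frac{(ax_i)_{|l|}\prod_{j=1}^{M+N}(x_iu_j)_{l_i}}{\prod_{j=1}^M(qx_i/x_j)_{l_i}\prod_{k=1}^N(aqx_i/v_k)_{l_i}}\right)\frac{\prod_{k=1}^N(v_k)_{|l|}}{\prod_{j=1}^{M+N}(aq/u_j)_{|l|}},$$ where $|l|=l_1+\cdots+l_M$, $xq^l=\{x_iq^{l_i}\}_{1\le i\le M}$ and $\Delta(x)=\prod_{1\le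 i<j\le M}(x_i-x_j)$. Let $M\ge1$, let $a,c_1,c_2,x_1,\dots,x_M,b_1,\dots,b_{M+2}$ be nonzero complex numbers, and put $d=a^2q^2/(c_1c_2b_1b_2\cdots b_{M+2}x_1x_2\cdots x_M)$. In each part below assume that none of the denominators occurring in that part (in its prefactors and in the terms of its series) vanishes. Then in each part all the series converge absolutely, and the following hold. (1) If $|d|<1$ and $|aqx_1/(c_1c_2)|<1$, then $$W^{M,2}(\{x_i\}_{1\le i\le M};a;\{b_j\}_{1\le j\le M+2};c_1,c_2;d)=\frac{(c_1d,c_2d,aqx_1,aqx_1/(c_1c_2))_\infty}{(d,c_1c_2d,aqx_1/c_1,aqx_1/c_2)_\infty}\,W^{M,2}\left(\frac{c_1c_2d}{aq},\{x_i\}_{2\le i\le M};a;\{b_j\}_{1\le j\le M+2};c_1,c_2;\frac{aqx_1}{c_1c_2}\right).$$ (2) If $|d|<1$ and $|c_1c_2b_1d/(aq)|<1$, then $$W^{M,2}(\{x_i\}_{1\le i\le M};a;\{b_j\}_{1\le j\le M+2};c_1,c_2;d)=\frac{(c_1c_2b_1d/(aq))_\infty}{(d)_\infty}\prod_{i=1}^M\frac{(aqx_i)_\infty}{(a^2q^2x_i/(c_1c_2b_1))_\infty}\prod_{j=2}^{M+2}\frac{(a^2q^2/(c_1c_2b_1b_j))_\infty}{(aq/b_j)_\infty}$$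 $$\times W^{M,2}\left(\{x_i\}_{1\le i\le M};\frac{a^2q}{c_1c_2b_1};\frac{aq}{c_1c_2},\{b_j\}_{2\le j\le M+2};\frac{aq}{c_1b_1},\frac{aq}{c_2b_1};\frac{c_1c_2b_1d}{aq}\right).$$ (3) If $|d|<1$, $|q/c_1|<1$ and $|q/c_2|<1$, then $$W^{M,2}(\{x_i\}_{1\le i\le M};a;\{b_j\}_{1\le j\le M+2};c_1,c_2;d)=F(c_1,c_2)+F(c_2,c_1),$$ where $$F(c_1,c_2)=\frac{(c_1,q/c_1,c_2d,q/(c_2d))_\infty}{(d,q/d,c_1/c_2,qc_2/c_1)_\infty}\prod_{i=1}^M\frac{(aqx_i,aq^2x_i/(c_1c_2d))_\infty}{(aqx_i/c_2,aq^2x_i/(c_1d))_\infty}\prod_{j=1}^{M+2}\frac{(aq/(c_2b_j),aq^2/(c_1db_j))_\infty}{(aq/b_j,aq^2/(c_1c_2db_j))_\infty}$$ $$\times W^{M,2}\left(\{x_i\}_{1\le i\le M};\frac{aq}{c_1d};\{b_j\}_{1\le j\le M+2};c_2,\frac{q}{d};\frac{q}{c_1}\right).$$ -/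

import Mathlib

open scoped BigOperators

noncomputable section

/-- The infinite `q`-shifted factorial `(a)_∞ = ∏_{i ≥ 0} (1 - a q^i)`. -/
def qPochInf (q a : ℂ) : ℂ := ∏' i : ℕ, (1 - a * q ^ i)

/-- `(a₁, …, a_r)_∞ = (a₁)_∞ ⋯ (a_r)_∞`. -/
def qPochInfs (q : ℂ) (as : List ℂ) : ℂ := (as.map (qPochInf q)).prod

/-- The finite `q`-shifted factorial `(a)_l = ∏_{0 ≤ i < l} (1 - a q^i)`, for `l ≥ 0`;
it is `(a)_∞ / (a q^l)_∞` whenever that quotient makes sense. -/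
def qPoch (q a : ℂ) (l : ℕ) : ℂ := ∏ i ∈ Finset.range l, (1 - a * q ^ i)

/-- `Δ(x) = ∏_{i < j} (x_i - x_j)`. -/
def kajiDelta {M : ℕ} (x : Fin M → ℂ) : ℂ :=
  ∏ i : Fin M, ∏ j ∈ Finset.Ioi i, (x i - x j)

/-- The term of index `l ∈ ℕ^M` of Kajihara's very well-poised series `W^{M,N}`. -/
def kajiharaTerm (q : ℂ) {M N : ℕ} (x : Fin M → ℂ) (a : ℂ) (u : Fin (M + N) → ℂ)
    (v : Fin N → ℂ) (z : ℂ) (l : Fin M → ℕ) : ℂ :=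
  z ^ (∑ i, l i) * (kajiDelta (fun i => x i * q ^ l i) / kajiDelta x) *
    (∏ i : Fin M,
      ((1 - a * x i * q ^ ((∑ m, l m) + l i)) / (1 - a * x i) *
        ((qPoch q (a * x i) (∑ m, l m) * ∏ j : Fin (M + N), qPoch q (x i * u j) (l i)) /
          ((∏ j : Fin M, qPoch q (q * x i / x j) (l i)) *
            ∏ k : Fin N, qPoch q (a * q * x i / v k) (l i))))) *
    ((∏ k : Fin N, qPoch q (v k) (∑ m, l m)) /
      ∏ j : Fin (M + N), qPoch q (a * q / u j) (∑ m, l m))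

/-- Kajihara's very well-poised `q`-hypergeometric series
`W^{M,N}({x_i}; a; {u_j}; {v_k}; z)`. -/
def kajiharaW (q : ℂ) {M N : ℕ} (x : Fin M → ℂ) (a : ℂ) (u : Fin (M + N) → ℂ)
    (v : Fin N → ℂ) (z : ℂ) : ℂ :=
  ∑' l : Fin M → ℕ, kajiharaTerm q x a u v z l

/-- None of the denominators occurring in the terms of
`W^{M,N}({x_i}; a; {u_j}; {v_k}; z)` vanishes. -/
def KajiharaRegular (q : ℂ) {M N : ℕ} (x : Fin M → ℂ) (a : ℂ) (u : Fin (M + N) → ℂ)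
    (v : Fin N → ℂ) : Prop :=
  kajiDelta x ≠ 0 ∧ (∀ i, x i ≠ 0) ∧ (∀ j, u j ≠ 0) ∧ (∀ k, v k ≠ 0) ∧
    (∀ i, 1 - a * x i ≠ 0) ∧
    (∀ (i j : Fin M) (l : ℕ), qPoch q (q * x i / x j) l ≠ 0) ∧
    (∀ (i : Fin M) (k : Fin N) (l : ℕ), qPoch q (a * q * x i / v k) l ≠ 0) ∧
    (∀ (j : Fin (M + N)) (l : ℕ), qPoch q (a * q / u j) l ≠ 0)

/-- The denominator of the coefficient `threeTermCoeff` below. -/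
def threeTermDen (q : ℂ) {M : ℕ} (x : Fin M → ℂ) (a : ℂ) (b : Fin (M + 2) → ℂ)
    (c₁ c₂ d : ℂ) : ℂ :=
  qPochInfs q [d, q / d, c₁ / c₂, q * c₂ / c₁] *
    (∏ i : Fin M, qPochInfs q [a * q * x i / c₂, a * q ^ 2 * x i / (c₁ * d)]) *
    ∏ j : Fin (M + 2), qPochInfs q [a * q / b j, a * q ^ 2 / (c₁ * c₂ * d * b j)]

/-- The coefficient of the first series in the three-term relation; the coefficient of the
second one is obtained by interchanging `c₁` and `c₂`. -/
def threeTermCoeff (q : ℂ) {M : ℕ} (x : Fin M → ℂ) (a : ℂ) (b : Fin (M + 2) → ℂ)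
    (c₁ c₂ d : ℂ) : ℂ :=
  (qPochInfs q [c₁, q / c₁, c₂ * d, q / (c₂ * d)] *
    (∏ i : Fin M, qPochInfs q [a * q * x i, a * q ^ 2 * x i / (c₁ * c₂ * d)]) *
    ∏ j : Fin (M + 2), qPochInfs q [a * q / (c₂ * b j), a * q ^ 2 / (c₁ * d * b j)]) /
  threeTermDen q x a b c₁ c₂ d

end

/-! ### Lagrange interpolation, the Vandermonde product and finite shifted factorials -/

section

open scoped BigOperators
open Finset Polynomial

/-! The engine is a duality for the symmetric sums `symSum`. For n variables x, m variables y and n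
+ m parameters B with ∏B · ∏x = ∏y, the sum over multi-indices γ of size N attached to x, with
weight ∏(1 - B_l t) / ∏(1 - y_k t), equals the sum attached to y in which each B_l is inverted and x
supplies the denominators (`symSum_duality`). It is the balanced case of an expansion valid without
balancing (`symSum_eq_sum_dual`), proved by induction on N: both sides obey the same recursion, in
which one x_i is replaced by q x_i, and each recursion involved is an instance of Lagrange
interpolation.

Now enlarge x by X₀ = q^{-N}/a, take B = (q^N a d, b_1, …, b_{M+2}) and y = (aq/c₁, aq/c₂); the
definition of d is exactly the balancing condition. Solving |γ| = N for the coordinate of X₀ turns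
the sum over γ into W truncated to |l| ≤ N, while the dual side is an ordinary sum over 0 ≤ k ≤ N
(`KGeneric.tsum_trunc`). In that sum c₁c₂d/(aq) plays the same role as each x_i, and aq/(c₁c₂) the
same role as each b_j, a symmetry invisible in W itself. Exchanging x_1 with the former gives (1),
exchanging b_1 with the latter gives (2), first in truncated form (`KGeneric.trunc_swap_x`,
`KGeneric.trunc_swap_b`) and then as N → ∞ by dominated convergence.

For (3), let N → ∞ on the dual side as well: the sum concentrates at its two ends, so W is a
combination of two one-sided series (`KGeneric.kajiharaW_eq`). The three series W in (3) involve, in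
pairs, only three one-sided series, located at aq/c₁, aq/c₂ and aq²/(c₁c₂d); eliminating the last
one is the three-term relation.

These arguments need parameters avoiding all powers of q (`KGeneric`), which is more than the
theorem assumes. Hence a, c₁, c₂ are deformed along monomials in an auxiliary s; only countably many
s are bad, and s → 1 along `genericFilter`. The limit is harmless because the terms are bounded by C
ρ^{|l|} with ρ < 1, uniformly in s and N. -/

/-- The identity behind all recursions below: Lagrange interpolation of `∏ (1 - β_l t)` at the
nodes `z_j` and `0`. -/
theorem sum_prod_one_sub_div_prod_one_sub_div {σ τ : Type*} [Fintype σ] [Fintype τ]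
    [DecidableEq σ] (z : σ → ℂ) (β : τ → ℂ) (hcard : Fintype.card τ = Fintype.card σ)
    (hz : ∀ j, z j ≠ 0) (hinj : Function.Injective z) :
    ∑ j, (∏ l, (1 - β l * z j)) / ∏ k ∈ univ.erase j, (1 - z j / z k) =
      1 - (∏ l, β l) * ∏ j, z j := by
  classical
  set P : ℂ[X] := ∏ l, (1 - C (β l) * X) with hP
  have hdeg1 : ∀ l ∈ (univ : Finset τ), (1 - C (β l) * X : ℂ[X]).natDegree ≤ 1 := by
    intro l _
    refine (natDegree_sub_le _ _).trans ?_
    simpa using (natDegree_C_mul_le (β l) X).trans natDegree_X_le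
  have heval : ∀ t, P.eval t = ∏ l, (1 - β l * t) := by
    intro t; simp [hP, eval_prod]
  have hcoeff : P.coeff (Fintype.card σ) = ∏ l, (-β l) := by
    have := coeff_prod_of_natDegree_le (s := univ) (fun l => (1 - C (β l) * X : ℂ[X])) 1 hdeg1
    rw [card_univ, mul_one, hcard] at this
    rw [hP, this]
    refine prod_congr rfl fun l _ => ?_
    simp [coeff_one]
  have hnat : P.natDegree ≤ Fintype.card σ := by
    refine (natDegree_prod_le _ _).trans ((sum_le_sum hdeg1).trans ?_)
    simp [hcard]
  -- P has degree at most |σ|, so its coefficient of that degree is a sum over |σ| + 1 nodes; the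
  -- extra node 0, where P = 1, accounts for the summand 1.
  let v : Option σ → ℂ := fun o => o.elim 0 z
  have hv : Set.InjOn v (univ : Finset (Option σ)) := by
    intro a _ b _ hab
    rcases a with _ | a <;> rcases b with _ | b
    · rfl
    · exact absurd hab.symm (hz b)
    · exact absurd hab (hz a)
    · exact congrArg some (hinj hab)
  have hlag := Lagrange.coeff_eq_sum (s := (univ : Finset (Option σ))) hv (P := P) (by
    rw [card_univ, Fintype.card_option]
    refine lt_of_le_of_lt degree_le_natDegree ?_
    exact_mod_cast Nat.lt_succ_of_le hnat)
  rw [card_univ, Fintype.card_option, Nat.add_sub_cancel, hcoeff, Fintype.sum_option] at hlag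
  have hnone : (univ : Finset (Option σ)).erase none = univ.map Function.Embedding.some := by
    ext o; rcases o with _ | o <;> simp
  have hsome : ∀ j : σ, (univ : Finset (Option σ)).erase (some j) =
      insert none ((univ.erase j).map Function.Embedding.some) := by
    intro j; ext o; rcases o with _ | o <;> simp
  have hprodz : (∏ j, z j) ≠ 0 := prod_ne_zero_iff.2 fun j _ => hz j
  have hterm : ∀ j, P.eval (v (some j)) / ∏ k ∈ univ.erase (some j), (v (some j) - v k) =
      - ((∏ l, (1 - β l * z j)) / ∏ k ∈ univ.erase j, (1 - z j / z k)) / ∏ k, (-z k) := by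
    intro j
    rw [hsome, prod_insert (by simp), prod_map, heval, ← mul_prod_erase univ _ (mem_univ j)]
    have : ∏ k ∈ univ.erase j, (1 - z j / z k) =
        (∏ k ∈ univ.erase j, (z j - z k)) / ∏ k ∈ univ.erase j, (-z k) := by
      rw [← prod_div_distrib]
      refine prod_congr rfl fun k _ => ?_
      have := hz k
      field_simp
      ring
    have h1 : ∏ k ∈ univ.erase j, (-z k) ≠ 0 :=
      prod_ne_zero_iff.2 fun k _ => neg_ne_zero.2 (hz k)
    have h2 : ∏ k ∈ univ.erase j, (z j - z k) ≠ 0 := by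
      refine prod_ne_zero_iff.2 fun k hk => sub_ne_zero.2 fun h => ?_
      exact (mem_erase.1 hk).1 (hinj h).symm
    have h3 := hz j
    rw [this]
    simp only [v, Option.elim, Function.Embedding.some_apply]
    field_simp
    simp only [mul_comm (z j)]
    ring
  rw [sum_congr rfl fun j _ => hterm j, hnone, prod_map] at hlag
  simp only [v, Option.elim, Function.Embedding.some_apply, heval, zero_sub, mul_zero, sub_zero,
    prod_const_one] at hlag
  have hneg : (∏ k, (-z k)) ≠ 0 := prod_ne_zero_iff.2 fun k _ => neg_ne_zero.2 (hz k)
  rw [← sum_div, sum_neg_distrib, ← add_div, eq_div_iff hneg] at hlag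
  have hmul : (∏ l, (-β l)) * ∏ k, (-z k) = (∏ l, β l) * ∏ j, z j := by
    rw [prod_neg, prod_neg, card_univ, card_univ, hcard]
    have : ((-1 : ℂ) ^ Fintype.card σ) * (-1) ^ Fintype.card σ = 1 := by
      rw [← mul_pow]; simp
    linear_combination ((∏ l, β l) * ∏ j, z j) * this
  rw [hmul] at hlag
  linear_combination hlag

/-- Only the factors pairing i with another index change, and the signs coming from j < i are the
same on both sides. The cross-multiplied form avoids any assumption on x. -/
theorem kajiDelta_update_mul {n : ℕ} (x : Fin n → ℂ) (i : Fin n) (z : ℂ) :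
    kajiDelta (Function.update x i z) * ∏ j ∈ univ.erase i, (x i - x j) =
      kajiDelta x * ∏ j ∈ univ.erase i, (z - x j) := by
  classical
  have key : ∀ w : Fin n → ℂ, kajiDelta w =
      (∏ p ∈ (univ : Finset (Fin n × Fin n)).filter (fun p => p.1 < p.2 ∧ p.1 ≠ i ∧ p.2 ≠ i),
        (w p.1 - w p.2)) * ((∏ j ∈ univ.filter (fun j => i < j), (w i - w j)) *
        ∏ j ∈ univ.filter (fun j => j < i), (w j - w i)) := by
    intro w
    have h0 : kajiDelta w = ∏ p ∈ (univ : Finset (Fin n × Fin n)).filter (fun p => p.1 < p.2),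
        (w p.1 - w p.2) := by
      unfold kajiDelta
      rw [prod_filter, ← univ_product_univ, prod_product]
      refine prod_congr rfl fun a _ => ?_
      rw [← prod_filter]
      refine prod_congr ?_ fun _ _ => rfl
      ext b; simp
    have h1 : ((univ : Finset (Fin n × Fin n)).filter (fun p => p.1 < p.2)) =
        ((univ : Finset (Fin n × Fin n)).filter (fun p => p.1 < p.2 ∧ p.1 ≠ i ∧ p.2 ≠ i)) ∪
        (((univ.filter (fun j => i < j)).map ⟨fun j => (i, j), fun a b h => by simpa using h⟩) ∪
        ((univ.filter (fun j => j < i)).map ⟨fun j => (j, i), fun a b h => by simpa using h⟩)) := by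
      ext ⟨a, b⟩
      simp only [mem_filter, mem_univ, true_and, mem_union, mem_map]
      constructor
      · intro h
        by_cases ha : a = i
        · subst ha; right; left; exact ⟨b, h, rfl⟩
        · by_cases hb : b = i
          · subst hb; right; right; exact ⟨a, h, rfl⟩
          · left; exact ⟨h, ha, hb⟩
      · rintro (h | ⟨j, h, e⟩ | ⟨j, h, e⟩)
        · exact h.1
        · cases e; exact h
        · cases e; exact h
    rw [h0, h1, prod_union, prod_union, prod_map, prod_map]
    · rfl
    · rw [disjoint_left]
      rintro ⟨a, b⟩ h h'
      simp only [mem_map, mem_filter, mem_univ, true_and] at h h'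
      obtain ⟨j, hj, e⟩ := h
      obtain ⟨k, hk, e'⟩ := h'
      cases e
      cases e'
      exact lt_irrefl _ hj
    · rw [disjoint_left]
      rintro ⟨a, b⟩ h h'
      simp only [mem_map, mem_filter, mem_univ, true_and, mem_union] at h h'
      rcases h' with ⟨j, hj, e⟩ | ⟨j, hj, e⟩
      · cases e; exact h.2.1 rfl
      · cases e; exact h.2.2 rfl
  have hsplit : ∀ g : Fin n → ℂ, ∏ j ∈ univ.erase i, g j =
      (∏ j ∈ univ.filter (fun j => i < j), g j) * ∏ j ∈ univ.filter (fun j => j < i), g j := by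
    intro g
    rw [← prod_union]
    · refine prod_congr ?_ fun _ _ => rfl
      ext j
      simp only [mem_erase, mem_univ, and_true, mem_union, mem_filter, true_and]
      exact ⟨fun h => (lt_or_gt_of_ne h).symm, fun h => h.elim ne_of_gt ne_of_lt⟩
    · rw [disjoint_left]
      intro j h h'
      simp only [mem_filter, mem_univ, true_and] at h h'
      exact lt_asymm h h'
  have hflip : ∀ w : ℂ, ∏ j ∈ univ.filter (fun j => j < i), (x j - w) =
      (-1) ^ #(univ.filter (fun j => j < i)) * ∏ j ∈ univ.filter (fun j => j < i), (w - x j) := by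
    intro w
    rw [← prod_neg]
    exact prod_congr rfl fun _ _ => by ring
  rw [key, key x, hsplit, hsplit]
  have e1 : ∏ p ∈ (univ : Finset (Fin n × Fin n)).filter (fun p => p.1 < p.2 ∧ p.1 ≠ i ∧ p.2 ≠ i),
        (Function.update x i z p.1 - Function.update x i z p.2) =
      ∏ p ∈ (univ : Finset (Fin n × Fin n)).filter (fun p => p.1 < p.2 ∧ p.1 ≠ i ∧ p.2 ≠ i),
        (x p.1 - x p.2) := by
    refine prod_congr rfl fun p hp => ?_
    simp only [mem_filter] at hp
    rw [Function.update_of_ne hp.2.2.1, Function.update_of_ne hp.2.2.2]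
  have e2 : ∏ j ∈ univ.filter (fun j => i < j),
      (Function.update x i z i - Function.update x i z j) =
      ∏ j ∈ univ.filter (fun j => i < j), (z - x j) := by
    refine prod_congr rfl fun j hj => ?_
    simp only [mem_filter] at hj
    rw [Function.update_self, Function.update_of_ne (ne_of_gt hj.2)]
  have e3 : ∏ j ∈ univ.filter (fun j => j < i),
      (Function.update x i z j - Function.update x i z i) =
      ∏ j ∈ univ.filter (fun j => j < i), (x j - z) := by
    refine prod_congr rfl fun j hj => ?_
    simp only [mem_filter] at hj
    rw [Function.update_self, Function.update_of_ne (ne_of_lt hj.2)]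
  rw [e1, e2, e3, hflip, hflip]
  ring

theorem kajiDelta_ne_zero {n : ℕ} {x : Fin n → ℂ} (hx : ∀ i j, i ≠ j → x i ≠ x j) :
    kajiDelta x ≠ 0 := by
  refine prod_ne_zero_iff.2 fun i _ => prod_ne_zero_iff.2 fun j hj => sub_ne_zero.2 ?_
  exact hx i j (ne_of_lt (mem_Ioi.1 hj))

theorem qPoch_zero (q a : ℂ) : qPoch q a 0 = 1 := by simp [qPoch]

theorem qPoch_succ (q a : ℂ) (l : ℕ) : qPoch q a (l + 1) = qPoch q a l * (1 - a * q ^ l) := by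
  simp [qPoch, prod_range_succ]

theorem qPoch_succ' (q a : ℂ) (l : ℕ) :
    qPoch q a (l + 1) = (1 - a) * qPoch q (q * a) l := by
  rw [qPoch, prod_range_succ', mul_comm, qPoch]
  simp only [pow_zero, mul_one, pow_succ]
  congr 1
  exact prod_congr rfl fun _ _ => by ring

theorem qPoch_ne_zero_of_forall {q a : ℂ} {l : ℕ} (h : ∀ s < l, a * q ^ s ≠ 1) :
    qPoch q a l ≠ 0 :=
  prod_ne_zero_iff.2 fun s hs => sub_ne_zero.2 (h s (mem_range.1 hs)).symm

end

/-! ### Kernel coefficients and their behaviour under unit shifts -/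

section

open scoped BigOperators
open Finset

/-- The coefficient `Δ(xq^γ)/Δ(x) ∏_{i,j} 1/(q x_i/x_j)_{γ_i}`. -/
noncomputable def kernelCoeff (q : ℂ) {n : ℕ} (x : Fin n → ℂ) (γ : Fin n → ℕ) : ℂ :=
  kajiDelta (fun i => x i * q ^ γ i) / kajiDelta x * ∏ i, ∏ j, (qPoch q (q * x i / x j) (γ i))⁻¹

/-- The value of `∏_i ∏_{s < γ_i} f (x_i q^s)`. -/
noncomputable def shiftProd (q : ℂ) {n : ℕ} (x : Fin n → ℂ) (f : ℂ → ℂ) (γ : Fin n → ℕ) : ℂ :=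
  ∏ i, ∏ s ∈ range (γ i), f (x i * q ^ s)

/-- The sum over `|γ| = N` of `kernelCoeff` times `shiftProd`. -/
noncomputable def symSum (q : ℂ) {n : ℕ} (x : Fin n → ℂ) (f : ℂ → ℂ) (N : ℕ) : ℂ :=
  ∑ γ ∈ piAntidiag univ N, kernelCoeff q x γ * shiftProd q x f γ

/-- All `x_i` are nonzero and lie on different orbits of multiplication by `q`. -/
structure QDistinct (q : ℂ) {n : ℕ} (x : Fin n → ℂ) : Prop where
  ne_zero : ∀ i, x i ≠ 0
  ne : ∀ i j, i ≠ j → ∀ a b : ℕ, x i * q ^ a ≠ x j * q ^ b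

theorem pow_ne_one_of_norm_lt_one {q : ℂ} (hq1 : ‖q‖ < 1) {n : ℕ} (hn : n ≠ 0) : q ^ n ≠ 1 := by
  intro h
  have := pow_lt_one₀ (norm_nonneg q) hq1 hn
  rw [← norm_pow, h, norm_one] at this
  exact lt_irrefl _ this

/-- The multi-index `γ + e_i`. -/
def raise {n : ℕ} (γ : Fin n → ℕ) (i : Fin n) : Fin n → ℕ := γ + Pi.single i 1

variable {q : ℂ} {n : ℕ} {x : Fin n → ℂ}

@[simp] theorem raise_self (γ : Fin n → ℕ) (i : Fin n) : raise γ i i = γ i + 1 := by simp [raise]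

theorem raise_of_ne (γ : Fin n → ℕ) {i j : Fin n} (h : j ≠ i) : raise γ i j = γ j := by
  simp [raise, h]

theorem sum_raise (γ : Fin n → ℕ) (i : Fin n) : ∑ j, raise γ i j = ∑ j, γ j + 1 := by
  simp [raise, sum_add_distrib]

theorem QDistinct.shift (h : QDistinct q x) (hq0 : q ≠ 0) (γ : Fin n → ℕ) :
    QDistinct q (fun i => x i * q ^ γ i) where
  ne_zero i := mul_ne_zero (h.ne_zero i) (pow_ne_zero _ hq0)
  ne i j hij a b := by
    have := h.ne i j hij (γ i + a) (γ j + b)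
    rwa [pow_add, pow_add, ← mul_assoc, ← mul_assoc] at this

theorem update_mul_eq (q : ℂ) (x : Fin n → ℂ) (i : Fin n) (δ : Fin n → ℕ) (j : Fin n) :
    Function.update x i (q * x i) j * q ^ δ j = x j * q ^ raise δ i j := by
  by_cases hj : j = i
  · subst hj; simp [pow_succ]; ring
  · simp [hj, raise_of_ne]

theorem QDistinct.update (h : QDistinct q x) (hq0 : q ≠ 0) (i : Fin n) :
    QDistinct q (Function.update x i (q * x i)) := by
  have := h.shift hq0 (raise 0 i)
  convert this using 2 with j
  have := update_mul_eq q x i 0 j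
  simpa using this

theorem QDistinct.kajiDelta_ne_zero (h : QDistinct q x) (γ : Fin n → ℕ) :
    kajiDelta (fun i => x i * q ^ γ i) ≠ 0 :=
  _root_.kajiDelta_ne_zero fun i j hij => h.ne i j hij _ _

theorem QDistinct.injective (h : QDistinct q x) : Function.Injective x := by
  intro i j hij
  by_contra hne
  exact h.ne i j hne 0 0 (by simpa using hij)

theorem QDistinct.qPoch_ne_zero (h : QDistinct q x) (hq1 : ‖q‖ < 1) (i j : Fin n) (l : ℕ) :
    qPoch q (q * x i / x j) l ≠ 0 := by
  refine qPoch_ne_zero_of_forall fun s _ hs => ?_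
  by_cases hij : i = j
  · subst hij
    refine pow_ne_one_of_norm_lt_one hq1 (Nat.succ_ne_zero s) ?_
    rw [mul_div_assoc, div_self (h.ne_zero i)] at hs
    rw [← hs, pow_succ]; ring
  · refine h.ne i j hij (s + 1) 0 ?_
    have := h.ne_zero j
    field_simp at hs
    rw [pow_succ, ← hs]; ring

theorem shiftProd_add_single (q : ℂ) (x : Fin n → ℂ) (f : ℂ → ℂ) (δ : Fin n → ℕ) (i : Fin n) :
    shiftProd q x f (raise δ i) = shiftProd q x f δ * f (x i * q ^ δ i) := by
  unfold shiftProd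
  rw [← mul_prod_erase univ _ (mem_univ i), ← mul_prod_erase univ _ (mem_univ i)]
  have : ∀ j ∈ univ.erase i, ∏ s ∈ range (raise δ i j), f (x j * q ^ s) =
      ∏ s ∈ range (δ j), f (x j * q ^ s) := by
    intro j hj
    have : j ≠ i := (mem_erase.1 hj).1
    simp [this, raise_of_ne]
  rw [prod_congr rfl this]
  simp only [raise_self, prod_range_succ]
  ring

theorem shiftProd_update (q : ℂ) (x : Fin n → ℂ) (f : ℂ → ℂ) (δ : Fin n → ℕ) (i : Fin n) :
    f (x i) * shiftProd q (Function.update x i (q * x i)) f δ =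
      shiftProd q x f (raise δ i) := by
  unfold shiftProd
  rw [← mul_prod_erase univ _ (mem_univ i), ← mul_prod_erase univ _ (mem_univ i)]
  have : ∀ j ∈ univ.erase i, ∏ s ∈ range (raise δ i j), f (x j * q ^ s) =
      ∏ s ∈ range (δ j), f (Function.update x i (q * x i) j * q ^ s) := by
    intro j hj
    have : j ≠ i := (mem_erase.1 hj).1
    simp [this, raise_of_ne]
  rw [prod_congr rfl this]
  simp only [raise_self, Function.update_self, prod_range_succ' _ (δ i),
    pow_zero, mul_one, ← mul_assoc]
  rw [mul_comm (f (x i))]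
  congr 2
  exact prod_congr rfl fun s _ => by rw [pow_succ]; ring_nf

/-- Since the i-th summand vanishes when γ_i = 0, only indices of the form δ + e_i with |δ| = N
contribute to it. -/
theorem sum_piAntidiag_succ (N : ℕ) (G : Fin n → (Fin n → ℕ) → ℂ)
    (hG : ∀ i γ, γ i = 0 → G i γ = 0) :
    ∑ γ ∈ piAntidiag univ (N + 1), ∑ i, G i γ =
      ∑ i, ∑ δ ∈ piAntidiag univ N, G i (raise δ i) := by
  rw [sum_comm]
  refine sum_congr rfl fun i _ => ?_
  rw [← sum_filter_of_ne (p := fun γ : Fin n → ℕ => γ i ≠ 0) fun γ _ h h0 => h (hG i γ h0)]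
  symm
  refine sum_bij (fun δ _ => raise δ i) ?_ ?_ ?_ ?_
  · intro δ hδ
    simp only [mem_piAntidiag, mem_univ, implies_true, and_true] at hδ
    simp [sum_raise, hδ]
  · intro a _ b _ h
    exact add_right_cancel h
  · intro γ hγ
    simp only [mem_filter, mem_piAntidiag, mem_univ, implies_true, and_true] at hγ
    have hle : Pi.single i 1 ≤ γ := by
      intro j
      by_cases hj : j = i
      · subst hj; simpa using Nat.one_le_iff_ne_zero.2 hγ.2
      · simp [hj]
    refine ⟨γ - Pi.single i 1, ?_, tsub_add_cancel_of_le hle⟩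
    simp only [mem_piAntidiag, mem_univ, implies_true, and_true]
    have h2 := sum_raise (γ - Pi.single i 1) i
    rw [raise, tsub_add_cancel_of_le hle, hγ.1] at h2
    exact (Nat.succ_injective h2).symm
  · intro _ _; rfl


theorem prod_prod_split {ι : Type*} [Fintype ι] [DecidableEq ι] (F : ι → ι → ℂ) (i : ι) :
    ∏ a, ∏ b, F a b = F i i * (∏ b ∈ univ.erase i, F i b) * (∏ a ∈ univ.erase i, F a i) *
      ∏ a ∈ univ.erase i, ∏ b ∈ univ.erase i, F a b := by
  rw [← mul_prod_erase univ _ (mem_univ i), ← mul_prod_erase univ (F i) (mem_univ i),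
    prod_congr rfl fun a _ => (mul_prod_erase univ (F a) (mem_univ i)).symm, prod_mul_distrib]
  ring

theorem qPoch_mul_one_sub (q a : ℂ) (l : ℕ) :
    qPoch q a l * (1 - a * q ^ l) = (1 - a) * qPoch q (q * a) l := by
  rw [← qPoch_succ, qPoch_succ']

/-- The correcting factor on the right is the i-th term of the interpolation identity with nodes
1/x_j and parameters x_l q^{γ_l}, γ = δ + e_i, so summing over i collapses it to 1 - q^{|γ|}. -/
theorem kernelCoeff_update (hq0 : q ≠ 0) (hq1 : ‖q‖ < 1) (hx : QDistinct q x) (δ : Fin n → ℕ)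
    (i : Fin n) :
    kernelCoeff q (Function.update x i (q * x i)) δ * (∏ j ∈ univ.erase i, (1 - x i / x j))⁻¹ =
      kernelCoeff q x (raise δ i) * ((∏ j, (1 - (x j * q ^ raise δ i j) * (x i)⁻¹)) /
        ∏ j ∈ univ.erase i, (1 - (x i)⁻¹ / (x j)⁻¹)) := by
  have hxi := hx.ne_zero i
  have hΔ : (kajiDelta (Function.update x i (q * x i)))⁻¹ =
      (kajiDelta x)⁻¹ * ∏ j ∈ univ.erase i, ((x i - x j) / (q * x i - x j)) := by
    have h1 := kajiDelta_update_mul x i (q * x i)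
    have h2 : kajiDelta x ≠ 0 := by simpa using hx.kajiDelta_ne_zero 0
    have h3 : kajiDelta (Function.update x i (q * x i)) ≠ 0 := by
      simpa using (hx.update hq0 i).kajiDelta_ne_zero 0
    have h4 : ∏ j ∈ univ.erase i, (q * x i - x j) ≠ 0 := by
      refine prod_ne_zero_iff.2 fun j hj => sub_ne_zero.2 ?_
      have := hx.ne i j (mem_erase.1 hj).1.symm 1 0
      simpa [mul_comm] using this
    rw [prod_div_distrib]
    field_simp
    linear_combination -h1
  have hcore : (∏ a, ∏ b, (qPoch q (q * Function.update x i (q * x i) a /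
        Function.update x i (q * x i) b) (δ a))⁻¹) *
        (∏ j ∈ univ.erase i, ((x i - x j) / (q * x i - x j))) *
        (∏ j ∈ univ.erase i, (1 - x i / x j))⁻¹ =
      (∏ a, ∏ b, (qPoch q (q * x a / x b) (raise δ i a))⁻¹) *
        ((∏ j, (1 - (x j * q ^ raise δ i j) * (x i)⁻¹)) /
        ∏ j ∈ univ.erase i, (1 - (x i)⁻¹ / (x j)⁻¹)) := by
    rw [prod_prod_split _ i, prod_prod_split _ i,
      ← mul_prod_erase univ (fun j => 1 - x j * q ^ raise δ i j * (x i)⁻¹) (mem_univ i)]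
    have e0 : ∏ a ∈ univ.erase i, ∏ b ∈ univ.erase i, (qPoch q (q * Function.update x i (q * x i) a /
        Function.update x i (q * x i) b) (δ a))⁻¹ =
        ∏ a ∈ univ.erase i, ∏ b ∈ univ.erase i, (qPoch q (q * x a / x b) (raise δ i a))⁻¹ := by
      refine prod_congr rfl fun a ha => prod_congr rfl fun b hb => ?_
      rw [Function.update_of_ne (mem_erase.1 ha).1, Function.update_of_ne (mem_erase.1 hb).1,
        raise_of_ne _ (mem_erase.1 ha).1]
    have e1 : (qPoch q (q * Function.update x i (q * x i) i /
        Function.update x i (q * x i) i) (δ i))⁻¹ =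
        (qPoch q (q * x i / x i) (raise δ i i))⁻¹ * (1 - x i * q ^ raise δ i i * (x i)⁻¹) := by
      have h1 : q * x i / x i = q := by field_simp
      have h2 : q * (q * x i) / (q * x i) = q := by field_simp
      have h3 : x i * q ^ raise δ i i * (x i)⁻¹ = q * q ^ δ i := by
        rw [raise_self, pow_succ]; field_simp
      have h4 : (1 - q * q ^ δ i) ≠ 0 := by
        rw [← pow_succ']
        exact sub_ne_zero.2 (pow_ne_one_of_norm_lt_one hq1 (Nat.succ_ne_zero _)).symm
      rw [Function.update_self, h1, h2, h3, raise_self, qPoch_succ]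
      field_simp
    -- The entries (i, j) and (j, i) do not match separately; together with the j-th factor of the
    -- Vandermonde quotient they match for each j ≠ i.
    have e2 : (∏ b ∈ univ.erase i, (qPoch q (q * Function.update x i (q * x i) i /
          Function.update x i (q * x i) b) (δ i))⁻¹) *
        (∏ a ∈ univ.erase i, (qPoch q (q * Function.update x i (q * x i) a /
          Function.update x i (q * x i) i) (δ a))⁻¹) *
        ((∏ j ∈ univ.erase i, ((x i - x j) / (q * x i - x j))) *
        (∏ j ∈ univ.erase i, (1 - x i / x j))⁻¹) =
      (∏ b ∈ univ.erase i, (qPoch q (q * x i / x b) (raise δ i i))⁻¹) *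
        (∏ a ∈ univ.erase i, (qPoch q (q * x a / x i) (raise δ i a))⁻¹) *
        ((∏ j ∈ univ.erase i, (1 - (x j * q ^ raise δ i j) * (x i)⁻¹)) /
        ∏ j ∈ univ.erase i, (1 - (x i)⁻¹ / (x j)⁻¹)) := by
      rw [← prod_inv_distrib, ← prod_mul_distrib, ← prod_mul_distrib, ← prod_mul_distrib,
        ← prod_mul_distrib, ← prod_div_distrib, ← prod_mul_distrib]
      refine prod_congr rfl fun j hj => ?_
      have hji := (mem_erase.1 hj).1
      have hxj := hx.ne_zero j
      rw [Function.update_self, Function.update_of_ne hji, raise_self, raise_of_ne _ hji,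
        qPoch_succ']
      have g1 : q * x j / (q * x i) = x j / x i := by field_simp
      have g2 : q * (q * x i) / x j = q * (q * x i / x j) := by ring
      have g3 := qPoch_mul_one_sub q (x j / x i) (δ j)
      have g4 : q * (x j / x i) = q * x j / x i := by ring
      rw [g4] at g3
      have n1 := (hx.qPoch_ne_zero hq1 j i (δ j))
      have n2 : 1 - x j / x i ≠ 0 := by
        intro h
        refine hx.ne j i hji 0 0 ?_
        field_simp at h
        linear_combination -h
      have n3 : qPoch q (x j / x i) (δ j) ≠ 0 := by
        intro h; rw [h, zero_mul] at g3
        exact mul_ne_zero n2 n1 g3.symm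
      have n4 : x i - x j ≠ 0 := sub_ne_zero.2 fun h => by
        refine hx.ne j i hji 0 0 ?_
        simp [h]
      have n5 : q * x i - x j ≠ 0 := sub_ne_zero.2 fun h => by
        refine hx.ne j i hji 0 1 ?_
        simp [← h, mul_comm]
      have n6 : 1 - q * x i / x j = -(q * x i - x j) / x j := by field_simp; ring
      have n7 : 1 - x i / x j = -(x i - x j) / x j := by field_simp; ring
      have n8 : 1 - (x i)⁻¹ / (x j)⁻¹ = 1 - x j / x i := by field_simp
      have n9 : x j * q ^ δ j * (x i)⁻¹ = x j / x i * q ^ δ j := by ring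
      rw [g1, g2, n6, n7, n8, n9]
      set A := qPoch q (q * (q * x i / x j)) (δ i)
      have : (qPoch q (x j / x i) (δ j))⁻¹ =
          (qPoch q (q * x j / x i) (δ j))⁻¹ * (1 - x j / x i * q ^ δ j) / (1 - x j / x i) := by
        rw [eq_div_iff n2, inv_mul_eq_div, inv_mul_eq_div, div_eq_div_iff n3 n1]
        linear_combination -g3
      rw [this]
      generalize 1 - x j / x i = u at *
      generalize 1 - x j / x i * q ^ δ j = w at *
      generalize (qPoch q (q * x j / x i) (δ j))⁻¹ = v at *
      generalize q * x i - x j = r at *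
      generalize x i - x j = s at *
      rw [mul_inv, inv_div]
      field_simp
    rw [e0, e1]
    linear_combination ((qPoch q (q * x i / x i) (raise δ i i))⁻¹ *
      (1 - x i * q ^ raise δ i i * (x i)⁻¹) * ∏ a ∈ univ.erase i, ∏ b ∈ univ.erase i,
        (qPoch q (q * x a / x b) (raise δ i a))⁻¹) * e2
  unfold kernelCoeff
  rw [show (fun j => Function.update x i (q * x i) j * q ^ δ j) = fun j => x j * q ^ raise δ i j
    from funext (update_mul_eq q x i δ), div_eq_mul_inv, div_eq_mul_inv, hΔ]
  linear_combination (kajiDelta (fun j => x j * q ^ raise δ i j) * (kajiDelta x)⁻¹) * hcore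

/-- Companion identity with the base point fixed: the factor on the left is now an interpolation
term with nodes x_j q^{γ_j} and parameters 1/x_l, γ = δ + e_i. -/
theorem kernelCoeff_raise (hq0 : q ≠ 0) (hq1 : ‖q‖ < 1) (hx : QDistinct q x)
    (δ : Fin n → ℕ) (i : Fin n) :
    kernelCoeff q x (raise δ i) *
      ((∏ j, (1 - (x j)⁻¹ * (x i * q ^ raise δ i i))) /
        ∏ j ∈ univ.erase i, (1 - (x i * q ^ raise δ i i) / (x j * q ^ raise δ i j))) =
      kernelCoeff q x δ * (∏ j ∈ univ.erase i, (1 - (x i * q ^ δ i) / (x j * q ^ δ j)))⁻¹ := by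
  have hX := hx.shift hq0 δ
  have hXr := hx.shift hq0 (raise δ i)
  set X : Fin n → ℂ := fun j => x j * q ^ δ j with hXdef
  have hXe : (fun j => x j * q ^ raise δ i j) = Function.update X i (q * X i) := by
    funext j
    by_cases hj : j = i
    · subst hj; simp [hXdef, pow_succ]; ring
    · simp [hXdef, hj, raise_of_ne]
  have hΔ : kajiDelta (fun j => x j * q ^ raise δ i j) = kajiDelta X *
      ∏ j ∈ univ.erase i, ((q * X i - X j) / (X i - X j)) := by
    have h1 := kajiDelta_update_mul X i (q * X i)
    have h4 : ∏ j ∈ univ.erase i, (X i - X j) ≠ 0 := by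
      refine prod_ne_zero_iff.2 fun j hj => sub_ne_zero.2 ?_
      simpa using hX.ne i j (mem_erase.1 hj).1.symm 0 0
    rw [hXe, prod_div_distrib, ← mul_div_assoc, eq_div_iff h4, h1]
  have hP : (∏ a, ∏ b, (qPoch q (q * x a / x b) (raise δ i a))⁻¹) *
      (∏ j, (1 - (x j)⁻¹ * (x i * q ^ raise δ i i))) =
      ∏ a, ∏ b, (qPoch q (q * x a / x b) (δ a))⁻¹ := by
    rw [← mul_prod_erase univ _ (mem_univ i), ← mul_prod_erase univ (fun a => ∏ b,
      (qPoch q (q * x a / x b) (δ a))⁻¹) (mem_univ i)]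
    have e1 : ∀ a ∈ univ.erase i, ∏ b, (qPoch q (q * x a / x b) (raise δ i a))⁻¹ =
        ∏ b, (qPoch q (q * x a / x b) (δ a))⁻¹ := fun a ha => by
      rw [raise_of_ne _ (mem_erase.1 ha).1]
    rw [prod_congr rfl e1, mul_right_comm, ← prod_mul_distrib]
    congr 1
    refine prod_congr rfl fun b _ => ?_
    have h1 := hx.qPoch_ne_zero hq1 i b (δ i + 1)
    rw [qPoch_succ] at h1
    rw [raise_self, qPoch_succ, show (x b)⁻¹ * (x i * q ^ (δ i + 1)) = q * x i / x b * q ^ δ i by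
      rw [pow_succ]; ring]
    rw [mul_inv, mul_assoc, inv_mul_cancel₀ (right_ne_zero_of_mul h1), mul_one]
  have hR : (∏ j ∈ univ.erase i, ((q * X i - X j) / (X i - X j))) /
      (∏ j ∈ univ.erase i, (1 - (x i * q ^ raise δ i i) / (x j * q ^ raise δ i j))) =
      (∏ j ∈ univ.erase i, (1 - X i / X j))⁻¹ := by
    rw [← prod_inv_distrib, ← prod_div_distrib]
    refine prod_congr rfl fun j hj => ?_
    have hji := (mem_erase.1 hj).1
    have g1 : x i * q ^ raise δ i i = q * X i := by rw [raise_self, pow_succ, hXdef]; ring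
    have g2 : x j * q ^ raise δ i j = X j := by rw [raise_of_ne _ hji]
    rw [g1, g2]
    have n1 := hX.ne_zero j
    have n4 : X i - X j ≠ 0 := sub_ne_zero.2 (by simpa using hX.ne i j hji.symm 0 0)
    have n5 : q * X i - X j ≠ 0 := sub_ne_zero.2 (by
      simpa [mul_comm] using hX.ne i j hji.symm 1 0)
    have n6 : 1 - q * X i / X j = -(q * X i - X j) / X j := by
      rw [eq_div_iff n1, sub_mul, div_mul_cancel₀ _ n1]; ring
    have n7 : 1 - X i / X j = -(X i - X j) / X j := by
      rw [eq_div_iff n1, sub_mul, div_mul_cancel₀ _ n1]; ring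
    rw [n6, n7]
    field_simp
  unfold kernelCoeff
  rw [hΔ, ← hR, ← hP]
  ring

end

/-! ### Recursions for the symmetric sums and the duality transformation -/

section

open scoped BigOperators
open Finset

section
variable {q : ℂ} {n : ℕ} {x : Fin n → ℂ}

/-- Multiply each term by 1 - q^{N+1}, written as an interpolation sum over i; the i-th piece is
then a term of size N based at x with x_i replaced by q x_i. -/
theorem symSum_succ_eq_sum_update (hq0 : q ≠ 0) (hq1 : ‖q‖ < 1) (hx : QDistinct q x) (f : ℂ → ℂ)
    (N : ℕ) :
    (1 - q ^ (N + 1)) * symSum q x f (N + 1) =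
      ∑ i, (∏ j ∈ univ.erase i, (1 - x i / x j))⁻¹ * f (x i) *
        symSum q (Function.update x i (q * x i)) f N := by
  set G : Fin n → (Fin n → ℕ) → ℂ := fun i γ => kernelCoeff q x γ * shiftProd q x f γ *
    ((∏ j, (1 - (x j * q ^ γ j) * (x i)⁻¹)) / ∏ j ∈ univ.erase i, (1 - (x i)⁻¹ / (x j)⁻¹))
    with hGdef
  have hG : ∀ i γ, γ i = 0 → G i γ = 0 := by
    intro i γ h
    have : ∏ j, (1 - (x j * q ^ γ j) * (x i)⁻¹) = 0 :=
      -- The factor j = i is 1 - q^{γ_i}, which vanishes at γ_i = 0.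
      prod_eq_zero (mem_univ i) (by simp [h, hx.ne_zero i])
    simp [hGdef, this]
  have hsum := sum_piAntidiag_succ N G hG
  have hinj : Function.Injective fun i => (x i)⁻¹ := inv_injective.comp hx.injective
  have hl : ∀ γ ∈ piAntidiag (univ : Finset (Fin n)) (N + 1), ∑ i, G i γ =
      (1 - q ^ (N + 1)) * (kernelCoeff q x γ * shiftProd q x f γ) := by
    intro γ hγ
    have hγ' : ∑ j, γ j = N + 1 := by simpa using hγ
    have hpf := sum_prod_one_sub_div_prod_one_sub_div (fun i => (x i)⁻¹) (fun l => x l * q ^ γ l)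
      rfl (fun j => inv_ne_zero (hx.ne_zero j)) hinj
    have hprod : (∏ l, x l * q ^ γ l) * ∏ j, (x j)⁻¹ = q ^ (N + 1) := by
      rw [prod_mul_distrib, prod_pow_eq_pow_sum, hγ', prod_inv_distrib]
      have : ∏ l, x l ≠ 0 := prod_ne_zero_iff.2 fun l _ => hx.ne_zero l
      field_simp
    rw [hprod] at hpf
    rw [hGdef, ← mul_sum, hpf, mul_comm]
  rw [sum_congr rfl hl, ← mul_sum] at hsum
  rw [symSum, hsum]
  refine sum_congr rfl fun i _ => ?_
  rw [symSum, mul_sum]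
  refine sum_congr rfl fun δ _ => ?_
  have h1 := kernelCoeff_update hq0 hq1 hx δ i
  have h2 := shiftProd_update q x f δ i
  simp only [hGdef]
  rw [← h2]
  linear_combination (-(f (x i) * shiftProd q (Function.update x i (q * x i)) f δ)) * h1

/-- The same mechanism with nodes and parameters interchanged, so that x stays fixed and the sum is
built by raising one coordinate. It is applied to the dual variables y. -/
theorem symSum_succ_eq_sum_raise (hq0 : q ≠ 0) (hq1 : ‖q‖ < 1) (hx : QDistinct q x) (f : ℂ → ℂ)
    (N : ℕ) :
    (1 - q ^ (N + 1)) * symSum q x f (N + 1) =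
      ∑ δ ∈ piAntidiag univ N, kernelCoeff q x δ * shiftProd q x f δ *
        ∑ i, f (x i * q ^ δ i) *
          (∏ j ∈ univ.erase i, (1 - (x i * q ^ δ i) / (x j * q ^ δ j)))⁻¹ := by
  set G : Fin n → (Fin n → ℕ) → ℂ := fun i γ => kernelCoeff q x γ * shiftProd q x f γ *
    ((∏ j, (1 - (x j)⁻¹ * (x i * q ^ γ i))) /
      ∏ j ∈ univ.erase i, (1 - (x i * q ^ γ i) / (x j * q ^ γ j)))
    with hGdef
  have hG : ∀ i γ, γ i = 0 → G i γ = 0 := by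
    intro i γ h
    have : ∏ j, (1 - (x j)⁻¹ * (x i * q ^ γ i)) = 0 :=
      prod_eq_zero (mem_univ i) (by simp [h, hx.ne_zero i])
    simp [hGdef, this]
  have hsum := sum_piAntidiag_succ N G hG
  have hl : ∀ γ ∈ piAntidiag (univ : Finset (Fin n)) (N + 1), ∑ i, G i γ =
      (1 - q ^ (N + 1)) * (kernelCoeff q x γ * shiftProd q x f γ) := by
    intro γ hγ
    have hγ' : ∑ j, γ j = N + 1 := by simpa using hγ
    have hpf := sum_prod_one_sub_div_prod_one_sub_div (fun i => x i * q ^ γ i) (fun l => (x l)⁻¹)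
      rfl (hx.shift hq0 γ).ne_zero (hx.shift hq0 γ).injective
    have hprod : (∏ j, (x j)⁻¹) * (∏ l, x l * q ^ γ l) = q ^ (N + 1) := by
      rw [prod_mul_distrib, prod_pow_eq_pow_sum, hγ', prod_inv_distrib]
      have : ∏ l, x l ≠ 0 := prod_ne_zero_iff.2 fun l _ => hx.ne_zero l
      field_simp
    rw [hprod] at hpf
    rw [hGdef, ← mul_sum, hpf, mul_comm]
  rw [sum_congr rfl hl, ← mul_sum] at hsum
  rw [symSum, hsum, sum_comm]
  refine sum_congr rfl fun δ _ => ?_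
  rw [mul_sum]
  refine sum_congr rfl fun i _ => ?_
  have h1 := kernelCoeff_raise hq0 hq1 hx δ i
  have h2 := shiftProd_add_single q x f δ i
  simp only [hGdef]
  rw [h2]
  linear_combination (f (x i * q ^ δ i) * shiftProd q x f δ) * h1

end

/-- The rational function `∏_l (1 - β_l t) / ∏_k (1 - y_k t)`. -/
noncomputable def ratWeight {τ : Type*} [Fintype τ] {m : ℕ} (β : τ → ℂ) (y : Fin m → ℂ) (t : ℂ) :
    ℂ :=
  (∏ l, (1 - β l * t)) / ∏ k, (1 - y k * t)

section
variable {q : ℂ} {n m : ℕ} {τ : Type*} [Fintype τ] {x : Fin n → ℂ} {y : Fin m → ℂ} {B : τ → ℂ}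

/-- Replacing x_i by q x_i moves s to s + 1 in the denominators 1 - x_i y_k q^s, so the ratio of the
two products telescopes. -/
theorem shiftProd_ratWeight_update
    (hxy : ∀ i k, ∀ s : ℕ, x i * y k * q ^ s ≠ 1) (β : τ → ℂ) (i : Fin n) (δ : Fin m → ℕ) :
    shiftProd q y (ratWeight β (Function.update x i (q * x i))) δ =
      shiftProd q y (ratWeight β x) δ *
        ∏ k, ((1 - x i * y k) / (1 - x i * (y k * q ^ δ k))) := by
  have hne : ∀ k (s : ℕ), 1 - x i * (y k * q ^ s) ≠ 0 := fun k s =>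
    sub_ne_zero.2 (by rw [← mul_assoc]; exact (hxy i k s).symm)
  unfold shiftProd
  rw [← prod_mul_distrib]
  refine prod_congr rfl fun k _ => ?_
  generalize δ k = d
  induction d with
  | zero => have := hne k 0; simp at this; simp [this]
  | succ d ih =>
    rw [prod_range_succ, prod_range_succ, ih]
    have h0 := hne k d
    have h1 := hne k (d + 1)
    have hw : ratWeight β (Function.update x i (q * x i)) (y k * q ^ d) *
        (1 - x i * (y k * q ^ (d + 1))) =
        ratWeight β x (y k * q ^ d) * (1 - x i * (y k * q ^ d)) := by
      unfold ratWeight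
      rw [← mul_prod_erase univ (fun j => 1 - x j * (y k * q ^ d)) (mem_univ i),
        ← mul_prod_erase univ (fun j => 1 - Function.update x i (q * x i) j * (y k * q ^ d))
          (mem_univ i), Function.update_self]
      have : ∀ j ∈ univ.erase i, 1 - Function.update x i (q * x i) j * (y k * q ^ d) =
          1 - x j * (y k * q ^ d) := fun j hj => by
        rw [Function.update_of_ne (mem_erase.1 hj).1]
      rw [prod_congr rfl this, show q * x i * (y k * q ^ d) = x i * (y k * q ^ (d + 1)) by
        rw [pow_succ]; ring]
      rw [div_mul_eq_mul_div, div_mul_eq_mul_div, mul_comm (1 - x i * (y k * q ^ (d + 1))),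
        mul_comm (1 - x i * (y k * q ^ d)), mul_div_mul_right _ _ h1, mul_div_mul_right _ _ h0]
    generalize ratWeight β (Function.update x i (q * x i)) (y k * q ^ d) = w' at *
    generalize ratWeight β x (y k * q ^ d) = w at *
    generalize 1 - x i * (y k * q ^ d) = u at *
    generalize 1 - x i * (y k * q ^ (d + 1)) = u' at *
    field_simp
    linear_combination ((∏ s ∈ range d, ratWeight β x (y k * q ^ s)) * (1 - x i * y k)) * hw

/-- Partial fractions with nodes `x_i` and `1/Y_k`. -/
theorem sum_dual_nodes (hcard : Fintype.card τ = n + m) (hB : ∀ l, B l ≠ 0)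
    (hx0 : ∀ i, x i ≠ 0) (hxi : Function.Injective x) (Y : Fin m → ℂ) (hY0 : ∀ k, Y k ≠ 0)
    (hYi : Function.Injective Y) (hxY : ∀ i k, x i * Y k ≠ 1) :
    ∑ i, (∏ j ∈ univ.erase i, (1 - x i / x j))⁻¹ *
        ((∏ l, (1 - B l * x i)) / ∏ k, (1 - x i * Y k)) =
      1 - (∏ l, B l) * (∏ i, x i) / (∏ k, Y k) +
        (∏ l, B l) * (∏ i, x i) / (∏ k, Y k) *
        ∑ k, ratWeight (fun l => (B l)⁻¹) x (Y k) *
          (∏ j ∈ univ.erase k, (1 - Y k / Y j))⁻¹ := by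
  classical
  have hne : ∀ i k, 1 - x i * Y k ≠ 0 := fun i k => sub_ne_zero.2 (hxY i k).symm
  -- Interpolation at the n + m nodes x_i and 1/Y_k; this is where the number of parameters B must
  -- be n + m.
  have hpf := sum_prod_one_sub_div_prod_one_sub_div (σ := Fin n ⊕ Fin m)
    (Sum.elim x fun k => (Y k)⁻¹) B (by simp [hcard])
    (by rintro (i | k); exacts [hx0 i, inv_ne_zero (hY0 k)])
    (by
      rintro (i | k) (j | l) h
      · exact congrArg _ (hxi h)
      · exact absurd (by
          simp only [Sum.elim_inl, Sum.elim_inr] at h; rw [h, inv_mul_cancel₀ (hY0 l)]) (hxY i l)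
      · exact absurd (by
          simp only [Sum.elim_inl, Sum.elim_inr] at h
          rw [← h, inv_mul_cancel₀ (hY0 k)]) (hxY j k)
      · exact congrArg _ (hYi (inv_injective h)))
  rw [Fintype.sum_sum_type, Fintype.prod_sum_type] at hpf
  have hl : ∀ i : Fin n, (univ : Finset (Fin n ⊕ Fin m)).erase (Sum.inl i) =
      (univ.erase i).disjSum univ := by
    intro i; ext (j | k) <;> simp
  have hr : ∀ k : Fin m, (univ : Finset (Fin n ⊕ Fin m)).erase (Sum.inr k) =
      univ.disjSum (univ.erase k) := by
    intro i; ext (j | k) <;> simp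
  simp only [hl, hr, prod_disjSum, Sum.elim_inl, Sum.elim_inr, prod_inv_distrib] at hpf
  have hterm : ∀ k, (∏ l, (1 - B l * (Y k)⁻¹)) /
      ((∏ i, (1 - (Y k)⁻¹ / x i)) * ∏ j ∈ univ.erase k, (1 - (Y k)⁻¹ / (Y j)⁻¹)) =
      -((∏ l, B l) * (∏ i, x i) / (∏ k, Y k)) * (ratWeight (fun l => (B l)⁻¹) x (Y k) *
          (∏ j ∈ univ.erase k, (1 - Y k / Y j))⁻¹) := by
    intro k
    have hk := hY0 k
    -- Each factor is reflected by 1 - 1/w = -(1/w)(1 - w). The n + m reflections above and n + (m -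
    -- 1) below leave one sign and one factor 1/Y_k, which completes ∏ 1/Y_j.
    have e1 : ∏ l, (1 - B l * (Y k)⁻¹) =
        (-1) ^ (n + m) * (∏ l, B l) * ((Y k) ^ (n + m))⁻¹ * ∏ l, (1 - (B l)⁻¹ * Y k) := by
      rw [← hcard, ← card_univ, ← prod_const, ← prod_const, ← prod_inv_distrib,
        ← prod_mul_distrib, ← prod_mul_distrib, ← prod_mul_distrib]
      refine prod_congr rfl fun l _ => ?_
      have := hB l
      field_simp
      ring
    have e2 : ∏ i, (1 - (Y k)⁻¹ / x i) =
        (-1) ^ n * (∏ i, (x i)⁻¹) * ((Y k) ^ n)⁻¹ * ∏ i, (1 - x i * Y k) := by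
      have hc : ∀ c : ℂ, c ^ n = ∏ _i : Fin n, c := by simp
      rw [hc, hc, ← prod_inv_distrib,
        ← prod_mul_distrib, ← prod_mul_distrib, ← prod_mul_distrib]
      refine prod_congr rfl fun i _ => ?_
      have := hx0 i
      field_simp
      ring
    have hm : #((univ : Finset (Fin m)).erase k) = m - 1 := by simp
    have hm1 : 1 ≤ m := Nat.one_le_of_lt k.isLt
    have e3 : ∏ j ∈ univ.erase k, (1 - (Y k)⁻¹ / (Y j)⁻¹) =
        (-1) ^ (m - 1) * (∏ j ∈ univ.erase k, Y j) * ((Y k) ^ (m - 1))⁻¹ *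
          ∏ j ∈ univ.erase k, (1 - Y k / Y j) := by
      rw [← hm, ← prod_const, ← prod_const, ← prod_inv_distrib,
        ← prod_mul_distrib, ← prod_mul_distrib, ← prod_mul_distrib]
      refine prod_congr rfl fun j _ => ?_
      have := hY0 j
      field_simp
      ring
    have n1 : ∏ i, (1 - x i * Y k) ≠ 0 := prod_ne_zero_iff.2 fun i _ => hne i k
    have n2 : ∏ j ∈ univ.erase k, (1 - Y k / Y j) ≠ 0 := prod_ne_zero_iff.2 fun j hj => by
      refine sub_ne_zero.2 fun h => (mem_erase.1 hj).1 (hYi ?_)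
      have := hY0 j
      field_simp at h
      exact h
    have n3 : ∏ i, x i ≠ 0 := prod_ne_zero_iff.2 fun i _ => hx0 i
    have n4 : ∏ j ∈ univ.erase k, Y j ≠ 0 := prod_ne_zero_iff.2 fun j _ => hY0 j
    have e4 : ∏ k, Y k = Y k * ∏ j ∈ univ.erase k, Y j := (mul_prod_erase univ _ (mem_univ k)).symm
    rw [e1, e2, e3, e4, ratWeight, prod_inv_distrib]
    obtain ⟨m', rfl⟩ := Nat.exists_eq_add_of_le' hm1
    rw [Nat.add_sub_cancel]
    generalize ∏ i, (1 - x i * Y k) = a1 at *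
    generalize ∏ j ∈ univ.erase k, (1 - Y k / Y j) = a2 at *
    generalize ∏ i, x i = a3 at *
    generalize ∏ j ∈ univ.erase k, Y j = a4 at *
    generalize ∏ l, (1 - (B l)⁻¹ * Y k) = a5
    generalize ∏ l, B l = a6
    generalize Y k = u at *
    have hs : ((-1 : ℂ)) ^ n ≠ 0 := pow_ne_zero _ (by norm_num)
    have hs' : ((-1 : ℂ)) ^ m' ≠ 0 := pow_ne_zero _ (by norm_num)
    rw [show (-1 : ℂ) ^ (n + (m' + 1)) = -((-1) ^ n * (-1) ^ m') by ring,
      show u ^ (n + (m' + 1)) = u ^ n * u ^ m' * u by ring]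
    field_simp
  rw [sum_congr rfl fun k _ => hterm k, ← mul_sum, ← div_eq_mul_inv] at hpf
  have : ∑ i, (∏ j ∈ univ.erase i, (1 - x i / x j))⁻¹ *
        ((∏ l, (1 - B l * x i)) / ∏ k, (1 - x i * Y k)) =
      ∑ i, (∏ l, (1 - B l * x i)) /
        ((∏ j ∈ univ.erase i, (1 - x i / x j)) * ∏ k, (1 - x i / (Y k)⁻¹)) := by
    refine sum_congr rfl fun i _ => ?_
    simp only [div_inv_eq_mul]
    rw [div_mul_eq_div_div, inv_mul_eq_div, div_right_comm]
  rw [this]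
  linear_combination hpf

/-- How the dual sum behaves under the difference operator defining `symSum`. -/
theorem sum_symSum_dual_update (hq0 : q ≠ 0) (hq1 : ‖q‖ < 1) (hcard : Fintype.card τ = n + m)
    (hB : ∀ l, B l ≠ 0) (hx : QDistinct q x) (hy : QDistinct q y)
    (hxy : ∀ i k, ∀ s : ℕ, x i * y k * q ^ s ≠ 1) (K : ℕ) :
    ∑ i, (∏ j ∈ univ.erase i, (1 - x i / x j))⁻¹ * ratWeight B y (x i) *
        symSum q y (ratWeight (fun l => (B l)⁻¹) (Function.update x i (q * x i))) K =
      (1 - (∏ l, B l) * (∏ i, x i) / (∏ k, y k) * (q ^ K)⁻¹) *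
        symSum q y (ratWeight (fun l => (B l)⁻¹) x) K +
      (∏ l, B l) * (∏ i, x i) / (∏ k, y k) * (q ^ K)⁻¹ *
        ((1 - q ^ (K + 1)) * symSum q y (ratWeight (fun l => (B l)⁻¹) x) (K + 1)) := by
  rw [symSum_succ_eq_sum_raise hq0 hq1 hy]
  simp only [symSum, mul_sum]
  rw [sum_comm, ← sum_add_distrib]
  refine sum_congr rfl fun δ hδ => ?_
  have hδ' : ∑ j, δ j = K := by simpa using hδ
  have hY := hy.shift hq0 δ
  -- Used at Y = y q^δ with |δ| = K, so ∏Y = q^K ∏y; this is the source of the factor q^{-K}.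
  have hd := sum_dual_nodes hcard hB hx.ne_zero hx.injective (fun k => y k * q ^ δ k) hY.ne_zero
    hY.injective (fun i k => by rw [← mul_assoc]; exact hxy i k _)
  rw [prod_mul_distrib, prod_pow_eq_pow_sum, hδ', div_mul_eq_div_div, div_eq_mul_inv _ (q ^ K)]
    at hd
  have hl : ∀ i ∈ (univ : Finset (Fin n)),
      (∏ j ∈ univ.erase i, (1 - x i / x j))⁻¹ * ratWeight B y (x i) *
        (kernelCoeff q y δ * shiftProd q y
          (ratWeight (fun l => (B l)⁻¹) (Function.update x i (q * x i))) δ) =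
      kernelCoeff q y δ * shiftProd q y (ratWeight (fun l => (B l)⁻¹) x) δ *
      ((∏ j ∈ univ.erase i, (1 - x i / x j))⁻¹ *
        ((∏ l, (1 - B l * x i)) / ∏ k, (1 - x i * (y k * q ^ δ k)))) := by
    intro i _
    rw [shiftProd_ratWeight_update hxy, ratWeight, prod_div_distrib]
    have : ∏ k, (1 - x i * y k) ≠ 0 := prod_ne_zero_iff.2 fun k _ => sub_ne_zero.2 (by
      simpa using (hxy i k 0).symm)
    have e : ∏ k, (1 - y k * x i) = ∏ k, (1 - x i * y k) :=
      prod_congr rfl fun k _ => by rw [mul_comm]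
    rw [e]
    field_simp
  rw [sum_congr rfl hl, ← mul_sum, hd, ← mul_sum, ← mul_sum]
  ring

/-- S_K receives contributions from the indices K and K - 1; they combine through (q^K - b)(1 -
q^{e+1}) + (1 - b q^{e+1})(1 - q^K) = (1 - b)(1 - q^{e+1+K}) with e = N - K. -/
theorem pow_succ_sum_aux (hq0 : q ≠ 0) (hq1 : ‖q‖ < 1) (b : ℂ) (S : ℕ → ℂ) (N : ℕ) :
    ∑ K ∈ range (N + 1), qPoch q (q * b) (N - K) / qPoch q q (N - K) * (q * b) ^ K *
        ((1 - b * (q ^ K)⁻¹) * S K + b * (q ^ K)⁻¹ * ((1 - q ^ (K + 1)) * S (K + 1))) =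
      (1 - q ^ (N + 1)) * ∑ K ∈ range (N + 2),
        qPoch q b (N + 1 - K) / qPoch q q (N + 1 - K) * b ^ K * S K := by
  have hqq : ∀ l, qPoch q q l ≠ 0 := fun l => qPoch_ne_zero_of_forall fun s _ => by
    rw [← pow_succ']; exact pow_ne_one_of_norm_lt_one hq1 (Nat.succ_ne_zero _)
  have hq' : ∀ l : ℕ, 1 - q * q ^ l ≠ 0 := fun l => by
    rw [← pow_succ']
    exact sub_ne_zero.2 (pow_ne_one_of_norm_lt_one hq1 (Nat.succ_ne_zero _)).symm
  set u : ℕ → ℂ := fun K => qPoch q (q * b) (N - K) / qPoch q q (N - K) * b ^ K * (q ^ K - b) * S K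
    with hu
  set v : ℕ → ℂ := fun K => qPoch q (q * b) (N - K) / qPoch q q (N - K) * b ^ (K + 1) *
    (1 - q ^ (K + 1)) * S (K + 1) with hv
  set r : ℕ → ℂ := fun K => (1 - q ^ (N + 1)) *
    (qPoch q b (N + 1 - K) / qPoch q q (N + 1 - K) * b ^ K * S K) with hr
  have hl : ∀ K ∈ range (N + 1), qPoch q (q * b) (N - K) / qPoch q q (N - K) * (q * b) ^ K *
        ((1 - b * (q ^ K)⁻¹) * S K + b * (q ^ K)⁻¹ * ((1 - q ^ (K + 1)) * S (K + 1))) =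
      u K + v K := by
    intro K _
    have := pow_ne_zero K hq0
    simp only [hu, hv, mul_pow]
    field_simp
    ring
  rw [sum_congr rfl hl, sum_add_distrib, mul_sum]
  change _ = ∑ K ∈ range (N + 2), r K
  rw [sum_range_succ r (N + 1), sum_range_succ' r N, sum_range_succ' u N, sum_range_succ v N]
  have h0 : u 0 = r 0 := by
    have h1 := hqq N
    have h2 := hq' N
    simp only [hu, hr, Nat.sub_zero, qPoch_succ' q b, qPoch_succ q q]
    rw [pow_succ' q N]
    field_simp
  have h1 : v N = r (N + 1) := by
    simp [hv, hr, qPoch_zero]; ring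
  have h2 : ∀ K ∈ range N, u (K + 1) + v K = r (K + 1) := by
    intro K hK
    obtain ⟨e, rfl⟩ := Nat.exists_eq_add_of_lt (mem_range.1 hK)
    have h1 := hqq e
    have h2 := hq' e
    have e1 : K + e + 1 - (K + 1) = e := by omega
    have e2 : K + e + 1 - K = e + 1 := by omega
    have e3 : K + e + 1 + 1 - (K + 1) = e + 1 := by omega
    simp only [hu, hv, hr, e1, e2, e3, qPoch_succ' q b, qPoch_succ q q, qPoch_succ q (q * b)]
    field_simp
    ring
  rw [← sum_congr rfl h2, sum_add_distrib, h0, h1]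
  ring

theorem symSum_zero (q : ℂ) {x : Fin n → ℂ} (hx : QDistinct q x) (f : ℂ → ℂ) :
    symSum q x f 0 = 1 := by
  have h : kajiDelta x ≠ 0 := by simpa using hx.kajiDelta_ne_zero 0
  simp [symSum, kernelCoeff, shiftProd, qPoch_zero, h]

/-- Induction on N. The vector x is quantified inside because the recursion shifts one x_i, which
replaces b = ∏B ∏x / ∏y by qb and leaves y and B alone. -/
theorem symSum_eq_sum_dual (hq0 : q ≠ 0) (hq1 : ‖q‖ < 1) (hcard : Fintype.card τ = n + m)
    (hB : ∀ l, B l ≠ 0) (hy : QDistinct q y) (N : ℕ) :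
    ∀ x : Fin n → ℂ, QDistinct q x → (∀ i k, ∀ s : ℕ, x i * y k * q ^ s ≠ 1) →
    symSum q x (ratWeight B y) N = ∑ K ∈ range (N + 1),
      qPoch q ((∏ l, B l) * (∏ i, x i) / (∏ k, y k)) (N - K) / qPoch q q (N - K) *
        ((∏ l, B l) * (∏ i, x i) / (∏ k, y k)) ^ K *
        symSum q y (ratWeight (fun l => (B l)⁻¹) x) K := by
  induction N with
  | zero => intro x hx _; simp [symSum_zero q hx, symSum_zero q hy, qPoch_zero]
  | succ N ih =>
    intro x hx hxy
    have hqN : 1 - q ^ (N + 1) ≠ 0 :=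
      sub_ne_zero.2 (pow_ne_one_of_norm_lt_one hq1 (Nat.succ_ne_zero _)).symm
    refine mul_left_cancel₀ hqN ?_
    rw [symSum_succ_eq_sum_update hq0 hq1 hx, ← pow_succ_sum_aux hq0 hq1]
    have hih : ∀ i, symSum q (Function.update x i (q * x i)) (ratWeight B y) N = _ := fun i =>
      ih (Function.update x i (q * x i)) (hx.update hq0 i) (by
        intro j k s
        have := hxy j k (raise 0 i j + s)
        rw [pow_add] at this
        have e := update_mul_eq q x i 0 j
        simp only [Pi.zero_apply, pow_zero, mul_one] at e
        rw [e]
        intro h; apply this; rw [← h]; ring)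
    have hb : ∀ i, (∏ l, B l) * (∏ j, Function.update x i (q * x i) j) / (∏ k, y k) =
        q * ((∏ l, B l) * (∏ i, x i) / (∏ k, y k)) := by
      intro i
      rw [prod_update_of_mem (mem_univ i), ← mul_prod_erase univ x (mem_univ i), sdiff_singleton_eq_erase]
      ring
    simp only [hih, hb, mul_sum]
    rw [sum_comm]
    refine sum_congr rfl fun K _ => ?_
    rw [← sum_symSum_dual_update hq0 hq1 hcard hB hx hy hxy, mul_sum]
    exact sum_congr rfl fun i _ => by ring

/-- The balanced duality transformation. -/
theorem symSum_duality (hq0 : q ≠ 0) (hq1 : ‖q‖ < 1) (hcard : Fintype.card τ = n + m)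
    (hB : ∀ l, B l ≠ 0) (hx : QDistinct q x) (hy : QDistinct q y)
    (hxy : ∀ i k, ∀ s : ℕ, x i * y k * q ^ s ≠ 1)
    (hbal : (∏ l, B l) * (∏ i, x i) = ∏ k, y k) (N : ℕ) :
    symSum q x (ratWeight B y) N = symSum q y (ratWeight (fun l => (B l)⁻¹) x) N := by
  have hy0 : ∏ k, y k ≠ 0 := prod_ne_zero_iff.2 fun k _ => hy.ne_zero k
  -- Balancing makes b = 1, and (1)_{N-K} vanishes unless K = N.
  rw [symSum_eq_sum_dual hq0 hq1 hcard hB hy N x hx hxy, hbal, div_self hy0, sum_range_succ,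
    sum_eq_zero]
  · simp [qPoch_zero]
  · intro K hK
    obtain ⟨e, rfl⟩ := Nat.exists_eq_add_of_lt (mem_range.1 hK)
    rw [show K + e + 1 - K = e + 1 by omega, qPoch_succ']
    simp

end

end

/-! ### General position, and the enlarged vector with X₀ = q^{-N}/a -/

section

open scoped BigOperators
open Finset

/-- `z` is not an integral power of `q`. -/
def OffPowers (q z : ℂ) : Prop := ∀ n : ℤ, z ≠ q ^ n

theorem OffPowers.mul_zpow {q z : ℂ} (h : OffPowers q z) (hq0 : q ≠ 0) (m : ℤ) :
    OffPowers q (z * q ^ m) := by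
  intro n hn
  refine h (n - m) ?_
  rw [zpow_sub₀ hq0, eq_div_iff (zpow_ne_zero _ hq0), hn]

theorem OffPowers.inv {q z : ℂ} (h : OffPowers q z) : OffPowers q z⁻¹ := by
  intro n hn
  refine h (-n) ?_
  rw [zpow_neg, ← hn, inv_inv]

theorem OffPowers.mul_q {q z : ℂ} (h : OffPowers q z) (hq0 : q ≠ 0) : OffPowers q (q * z) := by
  simpa [mul_comm] using h.mul_zpow hq0 1

theorem OffPowers.ne_one {q z : ℂ} (h : OffPowers q z) : z ≠ 1 := by simpa using h 0

theorem OffPowers.qPoch_ne_zero {q z : ℂ} (h : OffPowers q z) (hq0 : q ≠ 0) (l : ℕ) :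
    qPoch q z l ≠ 0 := by
  refine qPoch_ne_zero_of_forall fun s _ hs => ?_
  exact (h.mul_zpow hq0 s).ne_one (by simpa using hs)

/-- The sign and power of `q` produced by reversing a shifted factorial. -/
noncomputable def revFactor (q : ℂ) (n r : ℕ) : ℂ := (-1) ^ r * (∏ m ∈ range r, q ^ (n + 1 + m))⁻¹

theorem revFactor_ne_zero {q : ℂ} (hq0 : q ≠ 0) (n r : ℕ) : revFactor q n r ≠ 0 :=
  mul_ne_zero (pow_ne_zero _ (by norm_num))
    (inv_ne_zero (prod_ne_zero_iff.2 fun _ _ => pow_ne_zero _ hq0))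

/-- Read backwards, each factor 1 - u q^{-t} equals -u q^{-t}(1 - v q^{t-1}) because uv = q; the
factors so produced extend (v)_n to (v)_{n+r}. -/
theorem qPoch_reverse {q u v : ℂ} (hq0 : q ≠ 0) (huv : u * v = q) (n r : ℕ) :
    qPoch q (u / q ^ (n + r)) r * qPoch q v n = qPoch q v (n + r) * u ^ r * revFactor q n r := by
  induction r with
  | zero => simp [qPoch_zero, revFactor]
  | succ r ih =>
    have hu : u ≠ 0 := by rintro rfl; simp at huv; exact hq0 huv.symm
    have h1 : q * (u / q ^ (n + (r + 1))) = u / q ^ (n + r) := by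
      rw [← add_assoc, pow_succ]; field_simp
    have h2 : revFactor q n (r + 1) = -revFactor q n r * (q ^ (n + 1 + r))⁻¹ := by
      simp only [revFactor, prod_range_succ, pow_succ, mul_inv]; ring
    have h3 : 1 - u / q ^ (n + (r + 1)) = -(u * (1 - v * q ^ (n + r))) * (q ^ (n + 1 + r))⁻¹ := by
      have : n + (r + 1) = n + 1 + r := by ring
      rw [this]
      have h4 : q ^ (n + 1 + r) ≠ 0 := pow_ne_zero _ hq0
      have h5 : u * v * q ^ (n + r) = q ^ (n + 1 + r) := by rw [huv]; ring
      field_simp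
      linear_combination -h5
    rw [qPoch_succ', h1, h2, ← add_assoc, qPoch_succ q v, add_assoc, h3]
    linear_combination (-(u * (1 - v * q ^ (n + r))) * (q ^ (n + 1 + r))⁻¹) * ih

theorem prod_ratWeight_shift {τ : Type*} [Fintype τ] {m : ℕ} (q : ℂ) (β : τ → ℂ) (y : Fin m → ℂ)
    (t : ℂ) (g : ℕ) :
    ∏ s ∈ range g, ratWeight β y (t * q ^ s) =
      (∏ l, qPoch q (β l * t) g) / ∏ k, qPoch q (y k * t) g := by
  simp only [ratWeight, qPoch, prod_div_distrib]
  rw [prod_comm, prod_comm (s := range g)]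
  simp only [mul_assoc]

theorem kajiDelta_cons {M : ℕ} (x₀ : ℂ) (x : Fin M → ℂ) :
    kajiDelta (Fin.cons x₀ x : Fin (M + 1) → ℂ) = (∏ i, (x₀ - x i)) * kajiDelta x := by
  simp [kajiDelta, Fin.prod_univ_succ, Fin.prod_Ioi_succ]

/-- The factor by which the terms of a terminating sum differ from those of `kajiharaW`. -/
noncomputable def truncFactor (q : ℂ) {M : ℕ} (x : Fin M → ℂ) (a d : ℂ) (N : ℕ) (l : Fin M → ℕ) :
    ℂ :=
  if ∑ i, l i ≤ N then
    qPoch q d (N - ∑ i, l i) * qPoch q q N / (qPoch q d N * qPoch q q (N - ∑ i, l i)) *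
      ∏ i, (qPoch q (x i * (a * d * q ^ N)) (l i) / qPoch q (x i * (a * q * q ^ N)) (l i))
  else 0

/-- Dropping the coordinate of X₀ identifies multi-indices of size N in M + 1 variables with those
of size at most N in M variables. -/
theorem tsum_eq_sum_tail {M : ℕ} (N : ℕ) (F : (Fin M → ℕ) → ℂ)
    (hF : ∀ l, N < ∑ i, l i → F l = 0) :
    ∑' l, F l = ∑ γ ∈ piAntidiag (univ : Finset (Fin (M + 1))) N, F (Fin.tail γ) := by
  classical
  have hinj : Set.InjOn (Fin.tail : (Fin (M + 1) → ℕ) → Fin M → ℕ)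
      (piAntidiag (univ : Finset (Fin (M + 1))) N) := by
    intro γ hγ γ' hγ' h
    simp only [mem_coe, mem_piAntidiag, mem_univ, implies_true, and_true, Fin.sum_univ_succ]
      at hγ hγ'
    have h' : ∀ i, γ (Fin.succ i) = γ' (Fin.succ i) := fun i => congrFun h i
    simp only [h'] at hγ
    funext i
    refine Fin.cases ?_ (fun i => h' i) i
    omega
  rw [← sum_image (f := F) hinj]
  refine tsum_eq_sum fun l hl => hF l ?_
  by_contra hle
  refine hl (mem_image.2 ⟨Fin.cons (N - ∑ i, l i) l, ?_, Fin.tail_cons _ _⟩)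
  simp only [mem_piAntidiag, mem_univ, implies_true, and_true, Fin.sum_univ_succ, Fin.cons_zero,
    Fin.cons_succ]
  omega

/-- Parameters avoiding all coincidences modulo powers of `q`. -/
structure KGeneric (q : ℂ) {M : ℕ} (x : Fin M → ℂ) (a : ℂ) (b : Fin (M + 2) → ℂ) (c₁ c₂ d : ℂ) :
    Prop where
  dist : QDistinct q x
  a_ne : a ≠ 0
  b_ne : ∀ j, b j ≠ 0
  c₁_ne : c₁ ≠ 0
  c₂_ne : c₂ ≠ 0
  d_ne : d ≠ 0
  bal : d * (c₁ * c₂ * (∏ j, b j) * ∏ i, x i) = a ^ 2 * q ^ 2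
  ax : ∀ i, OffPowers q (a * x i)
  ab : ∀ j, OffPowers q (a / b j)
  c₁_off : OffPowers q c₁
  c₂_off : OffPowers q c₂
  c₁₂ : OffPowers q (c₁ / c₂)
  axc₁ : ∀ i, OffPowers q (a * x i / c₁)
  axc₂ : ∀ i, OffPowers q (a * x i / c₂)
  d_off : OffPowers q d
  c₁d : OffPowers q (c₁ * d)
  c₂d : OffPowers q (c₂ * d)

section
variable {q : ℂ} {M : ℕ} {x : Fin M → ℂ} {a : ℂ} {b : Fin (M + 2) → ℂ} {c₁ c₂ d : ℂ}

theorem KGeneric.symm (h : KGeneric q x a b c₁ c₂ d) : KGeneric q x a b c₂ c₁ d where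
  dist := h.dist
  a_ne := h.a_ne
  b_ne := h.b_ne
  c₁_ne := h.c₂_ne
  c₂_ne := h.c₁_ne
  d_ne := h.d_ne
  bal := by rw [← h.bal]; ring
  ax := h.ax
  ab := h.ab
  c₁_off := h.c₂_off
  c₂_off := h.c₁_off
  c₁₂ := by simpa using h.c₁₂.inv
  axc₁ := h.axc₂
  axc₂ := h.axc₁
  d_off := h.d_off
  c₁d := h.c₂d
  c₂d := h.c₁d

theorem KGeneric.qDistinct_cons (h : KGeneric q x a b c₁ c₂ d) (hq0 : q ≠ 0) (N : ℕ) :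
    QDistinct q (Fin.cons (1 / (q ^ N * a)) x : Fin (M + 1) → ℂ) where
  ne_zero i := by
    refine Fin.cases ?_ (fun i => ?_) i
    · have := h.a_ne; simp [this, hq0]
    · simpa using h.dist.ne_zero i
  ne i j := by
    have key : ∀ (i : Fin M) (s t : ℕ), 1 / (q ^ N * a) * q ^ s ≠ x i * q ^ t := by
      intro i s t he
      refine h.ax i ((s : ℤ) - t - N) ?_
      have := h.a_ne
      rw [zpow_sub₀ hq0, zpow_sub₀ hq0, zpow_natCast, zpow_natCast, zpow_natCast]
      field_simp at he ⊢
      linear_combination -he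
    refine Fin.cases ?_ (fun i => ?_) i <;> refine Fin.cases ?_ (fun j => ?_) j
    · intro h; exact absurd rfl h
    · intro _ s t; simpa using key j s t
    · intro _ s t; simpa using (key i t s).symm
    · intro hij s t
      simpa using h.dist.ne i j (fun e => hij (by rw [e])) s t

theorem KGeneric.qDistinct_pair (h : KGeneric q x a b c₁ c₂ d) (hq0 : q ≠ 0) :
    QDistinct q ![a * q / c₁, a * q / c₂] where
  ne_zero i := by
    have := h.a_ne
    have := h.c₁_ne
    have := h.c₂_ne
    fin_cases i <;> simp_all
  ne i j := by
    have h1 := h.a_ne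
    have h2 := h.c₁_ne
    have h3 := h.c₂_ne
    have key : ∀ (s t : ℕ), a * q / c₁ * q ^ s ≠ a * q / c₂ * q ^ t := by
      intro s t he
      refine h.c₁₂ ((s : ℤ) - t) ?_
      rw [zpow_sub₀ hq0, zpow_natCast, zpow_natCast]
      field_simp at he ⊢
      linear_combination -he
    fin_cases i <;> fin_cases j
    · simp
    · intro _ s t; simpa using key s t
    · intro _ s t; simpa using (key t s).symm
    · simp

theorem KGeneric.mul_ne_one (h : KGeneric q x a b c₁ c₂ d) (hq0 : q ≠ 0) (N : ℕ)
    (i : Fin (M + 1)) (k : Fin 2) (s : ℕ) :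
    (Fin.cons (1 / (q ^ N * a)) x : Fin (M + 1) → ℂ) i *
      (![a * q / c₁, a * q / c₂] : Fin 2 → ℂ) k * q ^ s ≠ 1 := by
  have h1 := h.a_ne
  have key : ∀ c : ℂ, c ≠ 0 → OffPowers q c → (∀ i, OffPowers q (a * x i / c)) →
      (Fin.cons (1 / (q ^ N * a)) x : Fin (M + 1) → ℂ) i * (a * q / c) * q ^ s ≠ 1 := by
    intro c h2 hc hxc
    refine Fin.cases ?_ (fun i => ?_) i
    · intro he
      refine hc ((s : ℤ) + 1 - N) ?_
      rw [zpow_sub₀ hq0, zpow_add₀ hq0, zpow_natCast, zpow_natCast, zpow_one]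
      rw [Fin.cons_zero] at he
      field_simp at he ⊢
      linear_combination -he
    · intro he
      refine hxc i (-((s : ℤ) + 1)) ?_
      rw [zpow_neg, zpow_add₀ hq0, zpow_natCast, zpow_one]
      rw [Fin.cons_succ] at he
      refine eq_inv_of_mul_eq_one_left ?_
      rw [← he]
      field_simp
  fin_cases k
  · simpa using key c₁ h.c₁_ne h.c₁_off h.axc₁
  · simpa using key c₂ h.c₂_ne h.c₂_off h.axc₂

end

end

/-! ### The truncated series as a one-dimensional sum -/

section

open scoped BigOperators
open Finset

section
variable {q : ℂ} {M : ℕ} {x : Fin M → ℂ} {a : ℂ} {b : Fin (M + 2) → ℂ} {c₁ c₂ d : ℂ}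

theorem kernelCoeff_cons (q x₀ : ℂ) (hx₀ : x₀ ≠ 0) (x : Fin M → ℂ) (r : ℕ) (l : Fin M → ℕ) :
    kernelCoeff q (Fin.cons x₀ x : Fin (M + 1) → ℂ) (Fin.cons r l) =
      kajiDelta (fun i => x i * q ^ l i) / kajiDelta x *
      (∏ i, ((x₀ * q ^ r - x i * q ^ l i) / (x₀ - x i) * (qPoch q (q * x₀ / x i) r)⁻¹)) *
      (qPoch q q r)⁻¹ * (∏ i, (qPoch q (q * x i / x₀) (l i))⁻¹) *
      (∏ i, ∏ j, (qPoch q (q * x i / x j) (l i))⁻¹) := by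
  have e : (fun i : Fin (M + 1) => (Fin.cons x₀ x : Fin (M + 1) → ℂ) i *
      q ^ (Fin.cons r l : Fin (M + 1) → ℕ) i) =
      (Fin.cons (x₀ * q ^ r) fun i => x i * q ^ l i : Fin (M + 1) → ℂ) := by
    funext i; refine Fin.cases ?_ (fun i => ?_) i <;> simp
  unfold kernelCoeff
  rw [e, kajiDelta_cons, kajiDelta_cons]
  simp only [Fin.prod_univ_succ, Fin.cons_zero, Fin.cons_succ, prod_mul_distrib, prod_div_distrib,
    mul_div_cancel_right₀ _ hx₀]
  rw [mul_div_mul_comm]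
  ring

theorem kajiharaTerm_two (q : ℂ) (x : Fin M → ℂ) (a : ℂ) (b : Fin (M + 2) → ℂ) (c₁ c₂ d : ℂ)
    (l : Fin M → ℕ) :
    kajiharaTerm q x a b ![c₁, c₂] d l =
      d ^ (∑ i, l i) * (kajiDelta (fun i => x i * q ^ l i) / kajiDelta x) *
      (∏ i, ((1 - a * x i * q ^ ((∑ m, l m) + l i)) / (1 - a * x i) *
        qPoch q (a * x i) (∑ m, l m))) *
      (∏ i, ∏ j, qPoch q (b j * x i) (l i)) *
      (∏ i, ∏ j, (qPoch q (q * x i / x j) (l i))⁻¹) *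
      (∏ i, (qPoch q (a * q / c₁ * x i) (l i))⁻¹) * (∏ i, (qPoch q (a * q / c₂ * x i) (l i))⁻¹) *
      (qPoch q c₁ (∑ m, l m) * qPoch q c₂ (∑ m, l m)) *
      (∏ j, qPoch q (a * q / b j) (∑ m, l m))⁻¹ := by
  unfold kajiharaTerm
  simp only [Fin.prod_univ_two, Matrix.cons_val_zero, Matrix.cons_val_one, prod_mul_distrib,
    div_eq_mul_inv, prod_inv_distrib, mul_inv, mul_comm (b _),
    mul_right_comm _ _ (x _)]
  ring

/-- Moving the distinguished coordinate `X₀ = q^{-N}/a`: one factor of the term identity. -/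
theorem KGeneric.cons_factor (h : KGeneric q x a b c₁ c₂ d) (hq0 : q ≠ 0) (n r e : ℕ) (i : Fin M) :
    (1 / (q ^ (n + r) * a) * q ^ r - x i * q ^ e) / (1 / (q ^ (n + r) * a) - x i) *
      (qPoch q (q * (1 / (q ^ (n + r) * a)) / x i) r)⁻¹ =
    (1 - a * x i * q ^ (n + e)) / (1 - a * x i) * qPoch q (a * x i) n *
      (qPoch q (q * (a * x i)) (n + r))⁻¹ * ((a * x i) ^ r * (revFactor q n r)⁻¹) := by
  have ha := h.a_ne
  have hx := h.dist.ne_zero i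
  have hax := h.ax i
  set w := a * x i with hw
  have hw0 : w ≠ 0 := mul_ne_zero ha hx
  have hQ : q ^ (n + r) ≠ 0 := pow_ne_zero _ hq0
  set X := 1 / (q ^ (n + r) * a) with hX
  have hXw : X / x i = 1 / w / q ^ (n + r) := by rw [hX, hw]; field_simp
  have hoff : OffPowers q (X / x i) := by
    rw [hXw, div_eq_mul_inv, one_div, ← zpow_natCast, ← zpow_neg]
    exact hax.inv.mul_zpow hq0 _
  -- Reversal with u = 1/w and v = qw, where w = a x_i: this converts a symbol of length r = N - |l|
  -- into symbols of lengths N and |l|.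
  have hrev := qPoch_reverse hq0 (show 1 / w * (q * w) = q by field_simp) n r
  rw [← hXw] at hrev
  have s1 := qPoch_mul_one_sub q (X / x i) r
  have s2 := qPoch_mul_one_sub q w n
  have n1 : 1 - X / x i ≠ 0 := sub_ne_zero.2 hoff.ne_one.symm
  have n2 := (hoff.mul_q hq0).qPoch_ne_zero hq0 r
  have n3 : 1 - w ≠ 0 := sub_ne_zero.2 hax.ne_one.symm
  have n4 := (hax.mul_q hq0).qPoch_ne_zero hq0 (n + r)
  have n5 := (hax.mul_q hq0).qPoch_ne_zero hq0 n
  have n6 := revFactor_ne_zero hq0 n r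
  have hXr : X * q ^ r = 1 / (q ^ n * a) := by rw [hX, pow_add]; field_simp
  have e1 : X / x i * q ^ r = 1 / (w * q ^ n) := by
    rw [div_mul_eq_mul_div, hXr, hw]; field_simp
  have n7 : 1 - w * q ^ n ≠ 0 := sub_ne_zero.2 (by
    simpa using (hax.mul_zpow hq0 n).ne_one.symm)
  have hqn : q ^ n ≠ 0 := pow_ne_zero _ hq0
  have e2 : X * q ^ r - x i * q ^ e = (1 - w * q ^ (n + e)) / (q ^ n * a) := by
    rw [hXr, hw, pow_add]; field_simp
  have e3 : X - x i = x i * -(1 - X / x i) := by field_simp; ring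
  rw [e1] at s1
  have e4 : 1 - 1 / (w * q ^ n) = -(1 - w * q ^ n) / (w * q ^ n) := by field_simp; ring
  rw [e4] at s1
  have e5 : q * X / x i = q * (X / x i) := by ring
  rw [e2, e3, e5]
  generalize 1 - X / x i = u1 at *
  generalize qPoch q (q * (X / x i)) r = u2 at *
  generalize qPoch q (X / x i) r = u3 at *
  generalize qPoch q (q * w) (n + r) = u4 at *
  generalize qPoch q (q * w) n = u5 at *
  generalize qPoch q w n = u6 at *
  generalize revFactor q n r = u7 at *
  generalize 1 - w * q ^ n = u8 at *
  generalize 1 - w = u9 at *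
  generalize 1 - w * q ^ (n + e) = u10 at *
  generalize q ^ n = Q at *
  have hu3 : u3 = u4 * (1 / w) ^ r * u7 / u5 := by rw [eq_div_iff n5]; exact hrev
  have hu6 : u6 = u9 * u5 / u8 := by rw [eq_div_iff n7]; exact s2
  have hu12 : u1 * u2 = u3 * (-u8 / (w * Q)) := s1.symm
  have : u10 / (Q * a) / (x i * -u1) * u2⁻¹ = -(u10 / (Q * w)) / (u1 * u2) := by
    have : u1 ≠ 0 := n1
    rw [hw]; field_simp
  rw [this, hu12, hu3, hu6, one_div, inv_pow]
  have : w ^ r ≠ 0 := pow_ne_zero _ hw0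
  field_simp

/-- Every symbol of length r = N - |l| attached to X₀, except (d)_r and (q)_r, is reversed into
symbols of lengths N and |l|. The former form the prefactor, the latter the very well-poised term;
(d)_r and (q)_r remain in `truncFactor`. -/
theorem KGeneric.term_eq (h : KGeneric q x a b c₁ c₂ d) (hq0 : q ≠ 0) (hq1 : ‖q‖ < 1) (r : ℕ)
    (l : Fin M → ℕ) (N : ℕ) (hN : ∑ i, l i + r = N) :
    kernelCoeff q (Fin.cons (1 / (q ^ N * a)) x : Fin (M + 1) → ℂ) (Fin.cons r l) *
      shiftProd q (Fin.cons (1 / (q ^ N * a)) x : Fin (M + 1) → ℂ)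
        (ratWeight (Fin.cons (q ^ N * a * d) b : Fin (M + 3) → ℂ) ![a * q / c₁, a * q / c₂])
        (Fin.cons r l) =
    qPoch q d N * (∏ j, qPoch q (a * q / b j) N) *
      (d ^ N * qPoch q q N * (∏ i, qPoch q (q * (a * x i)) N) * (qPoch q c₁ N * qPoch q c₂ N))⁻¹ *
      (kajiharaTerm q x a b ![c₁, c₂] d l * truncFactor q x a d N l) := by
  have ha := h.a_ne
  have hc₁ := h.c₁_ne
  have hc₂ := h.c₂_ne
  have hd := h.d_ne
  set n := ∑ i, l i with hn
  subst hN
  have hQ : q ^ (n + r) ≠ 0 := pow_ne_zero _ hq0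
  have hρ := revFactor_ne_zero hq0 n r
  set ρ := revFactor q n r with hρdef
  set X₀ := 1 / (q ^ (n + r) * a) with hX₀
  have hX₀0 : X₀ ≠ 0 := by rw [hX₀]; simp [ha, hq0]
  have hb : ∀ j, qPoch q (b j * X₀) r =
      qPoch q (a * q / b j) (n + r) * (qPoch q (a * q / b j) n)⁻¹ * ((b j / a) ^ r * ρ) := by
    intro j
    have hbj := h.b_ne j
    have h1 := qPoch_reverse hq0 (show b j / a * (a * q / b j) = q by field_simp) n r
    have h2 : b j / a / q ^ (n + r) = b j * X₀ := by rw [hX₀]; field_simp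
    have h3 : qPoch q (a * q / b j) n ≠ 0 := by
      have := ((h.ab j).mul_q hq0).qPoch_ne_zero hq0 n
      rwa [show q * (a / b j) = a * q / b j by ring] at this
    rw [h2] at h1
    rw [mul_right_comm, ← div_eq_mul_inv, eq_div_iff h3, h1]
    ring
  have hc : ∀ c, c ≠ 0 → OffPowers q c → (qPoch q (a * q / c * X₀) r)⁻¹ =
      (qPoch q c (n + r))⁻¹ * qPoch q c n * (((q / c) ^ r)⁻¹ * ρ⁻¹) := by
    intro c hc hoff
    have h1 := qPoch_reverse hq0 (show q / c * c = q by field_simp) n r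
    have h2 : q / c / q ^ (n + r) = a * q / c * X₀ := by rw [hX₀]; field_simp
    have h3 := hoff.qPoch_ne_zero hq0 n
    have h4 := hoff.qPoch_ne_zero hq0 (n + r)
    have h5 : (q / c) ^ r ≠ 0 := pow_ne_zero _ (div_ne_zero hq0 hc)
    rw [h2] at h1
    have h6 : qPoch q (a * q / c * X₀) r =
        qPoch q c (n + r) * (q / c) ^ r * ρ / qPoch q c n := by rw [eq_div_iff h3, h1]
    rw [h6]
    field_simp
  have hd0 : q ^ (n + r) * a * d * X₀ = d := by rw [hX₀]; field_simp
  have hx : ∀ i, (qPoch q (q * x i / X₀) (l i))⁻¹ =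
      (qPoch q (x i * (a * q * q ^ (n + r))) (l i))⁻¹ := by
    intro i; rw [hX₀]; congr 2; field_simp
  have hx' : ∀ i, qPoch q (q ^ (n + r) * a * d * x i) (l i) =
      qPoch q (x i * (a * d * q ^ (n + r))) (l i) := by
    intro i; congr 1; ring
  rw [kernelCoeff_cons q X₀ hX₀0]
  have hsp : shiftProd q (Fin.cons X₀ x : Fin (M + 1) → ℂ)
        (ratWeight (Fin.cons (q ^ (n + r) * a * d) b : Fin (M + 3) → ℂ) ![a * q / c₁, a * q / c₂])
        (Fin.cons r l) =
      (qPoch q d r * ∏ j, qPoch q (b j * X₀) r) *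
        ((qPoch q (a * q / c₁ * X₀) r)⁻¹ * (qPoch q (a * q / c₂ * X₀) r)⁻¹) *
      ((∏ i, qPoch q (x i * (a * d * q ^ (n + r))) (l i)) * (∏ i, ∏ j, qPoch q (b j * x i) (l i)) *
        ((∏ i, (qPoch q (a * q / c₁ * x i) (l i))⁻¹) *
          ∏ i, (qPoch q (a * q / c₂ * x i) (l i))⁻¹)) := by
    unfold shiftProd
    rw [Fin.prod_univ_succ]
    simp only [Fin.cons_zero, Fin.cons_succ, prod_ratWeight_shift]
    simp only [Fin.prod_univ_succ (n := M + 2), Fin.cons_zero, Fin.cons_succ, Fin.prod_univ_two,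
      Matrix.cons_val_zero, Matrix.cons_val_one, hd0, hx', prod_mul_distrib,
      prod_inv_distrib, div_eq_mul_inv, mul_inv]
  have htr : truncFactor q x a d (n + r) l =
      qPoch q d r * qPoch q q (n + r) * (qPoch q d (n + r))⁻¹ * (qPoch q q r)⁻¹ *
      ((∏ i, qPoch q (x i * (a * d * q ^ (n + r))) (l i)) *
        ∏ i, (qPoch q (x i * (a * q * q ^ (n + r))) (l i))⁻¹) := by
    unfold truncFactor
    rw [if_pos (by omega), ← hn, show n + r - n = r by omega, prod_div_distrib, prod_inv_distrib,
      div_eq_mul_inv, div_eq_mul_inv, mul_inv]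
    ring
  rw [hsp, htr, kajiharaTerm_two, hc c₁ hc₁ h.c₁_off, hc c₂ hc₂ h.c₂_off,
    prod_congr rfl fun j _ => hb j, prod_congr rfl fun i _ => hx i,
    prod_congr rfl fun i _ => h.cons_factor hq0 n r (l i) i, ← hn]
  simp only [prod_mul_distrib, prod_const, card_univ, Fintype.card_fin, prod_pow,
    prod_inv_distrib, ← hρdef, prod_div_distrib]
  -- The monomials produced by the reversals multiply to d^{-r}, by the balancing condition.
  have hbx : ((∏ j, b j) / a ^ (M + 2)) ^ r * (a ^ M * ∏ i, x i) ^ r * ((q / c₁) ^ r)⁻¹ *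
      ((q / c₂) ^ r)⁻¹ * d ^ (n + r) = d ^ n := by
    have : (∏ j, b j) / a ^ (M + 2) * (a ^ M * ∏ i, x i) * (q / c₁)⁻¹ * (q / c₂)⁻¹ * d = 1 := by
      have := h.bal
      field_simp
      rw [pow_add]
      linear_combination a ^ M * this
    rw [pow_add d n r, ← inv_pow, ← inv_pow, ← mul_pow, ← mul_pow, ← mul_pow, mul_comm (d ^ n),
      ← mul_assoc, ← mul_pow, this, one_pow, one_mul]
  have hbx' : ((∏ j, b j) / a ^ (M + 2)) ^ r * (a ^ M * ∏ i, x i) ^ r * ((q / c₁) ^ r)⁻¹ *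
      ((q / c₂) ^ r)⁻¹ = d ^ n * (d ^ (n + r))⁻¹ := by
    rw [← hbx]
    have := pow_ne_zero (n + r) hd
    field_simp
  -- The signs and powers of q cancel: M + 2 factors come from the b_j, and M + 2 inverse ones from
  -- the x_i and c₁, c₂.
  have hρ' : ρ ^ (M + 2) * (ρ⁻¹) ^ M * ρ⁻¹ * ρ⁻¹ = 1 := by
    rw [pow_add, inv_pow]; field_simp
  have hD : qPoch q d (n + r) * (qPoch q d (n + r))⁻¹ = 1 :=
    mul_inv_cancel₀ (h.d_off.qPoch_ne_zero hq0 _)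
  have hqq : qPoch q q (n + r) * (qPoch q q (n + r))⁻¹ = 1 :=
    mul_inv_cancel₀ (qPoch_ne_zero_of_forall fun s _ => by
      rw [← pow_succ']; exact pow_ne_one_of_norm_lt_one hq1 (Nat.succ_ne_zero _))
  clear hsp htr hx hx' hb hc hbx
  simp only [mul_inv]
  generalize ((∏ j, b j) / a ^ (M + 2)) ^ r = p1 at *
  generalize (a ^ M * ∏ i, x i) ^ r = p2 at *
  generalize ((q / c₁) ^ r)⁻¹ = p3 at *
  generalize ((q / c₂) ^ r)⁻¹ = p4 at *
  generalize d ^ n = p5 at *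
  generalize (d ^ (n + r))⁻¹ = p6 at *
  generalize ρ ^ (M + 2) = r1 at *
  generalize ρ⁻¹ ^ M = r2 at *
  generalize ρ⁻¹ = r3 at *
  generalize qPoch q d (n + r) = D at *
  generalize D⁻¹ = D' at *
  generalize qPoch q q (n + r) = E at *
  generalize E⁻¹ = E' at *
  generalize (kajiDelta fun i => x i * q ^ l i) / kajiDelta x = z1
  generalize (∏ i, (1 - a * x i * q ^ (n + l i))) / ∏ i, (1 - a * x i) = z2
  generalize ∏ i, qPoch q (a * x i) n = z3
  generalize (∏ i, qPoch q (q * (a * x i)) (n + r))⁻¹ = z4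
  generalize (qPoch q q r)⁻¹ = z5
  generalize (∏ i, qPoch q (x i * (a * q * q ^ (n + r))) (l i))⁻¹ = z6
  generalize (∏ i, ∏ j, qPoch q (q * x i / x j) (l i))⁻¹ = z7
  generalize qPoch q d r = z8
  generalize ∏ j, qPoch q (a * q / b j) (n + r) = z9
  generalize (∏ j, qPoch q (a * q / b j) n)⁻¹ = z10
  generalize (qPoch q c₁ (n + r))⁻¹ = z11
  generalize (qPoch q c₂ (n + r))⁻¹ = z12
  generalize qPoch q c₁ n = z13
  generalize qPoch q c₂ n = z14
  generalize ∏ i, qPoch q (x i * (a * d * q ^ (n + r))) (l i) = z15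
  generalize ∏ i, ∏ j, qPoch q (b j * x i) (l i) = z16
  generalize (∏ i, qPoch q (a * q / c₁ * x i) (l i))⁻¹ = z17
  generalize (∏ i, qPoch q (a * q / c₂ * x i) (l i))⁻¹ = z18
  calc _ = z1 * z2 * z3 * z4 * z5 * z6 * z7 * z8 * z9 * z10 * z11 * z12 * z13 * z14 * z15 * z16 *
        z17 * z18 * (r1 * r2 * r3 * r3) * (p1 * p2 * p3 * p4) := by ring
    _ = z1 * z2 * z3 * z4 * z5 * z6 * z7 * z8 * z9 * z10 * z11 * z12 * z13 * z14 * z15 * z16 *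
        z17 * z18 * 1 * (p5 * p6) * (D * D') * (E * E') := by rw [hρ', hbx', hD, hqq]; ring
    _ = _ := by ring

theorem KGeneric.symSum_cons (h : KGeneric q x a b c₁ c₂ d) (hq0 : q ≠ 0) (hq1 : ‖q‖ < 1) (N : ℕ) :
    symSum q (Fin.cons (1 / (q ^ N * a)) x : Fin (M + 1) → ℂ)
        (ratWeight (Fin.cons (q ^ N * a * d) b : Fin (M + 3) → ℂ) ![a * q / c₁, a * q / c₂]) N =
    qPoch q d N * (∏ j, qPoch q (a * q / b j) N) *
      (d ^ N * qPoch q q N * (∏ i, qPoch q (q * (a * x i)) N) * (qPoch q c₁ N * qPoch q c₂ N))⁻¹ *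
      ∑' l, kajiharaTerm q x a b ![c₁, c₂] d l * truncFactor q x a d N l := by
  rw [tsum_eq_sum_tail N _ fun l hl => by rw [truncFactor, if_neg (by omega), mul_zero], symSum,
    mul_sum]
  refine sum_congr rfl fun γ hγ => ?_
  have hγ' : ∑ i, γ i = N := by simpa using hγ
  rw [Fin.sum_univ_succ] at hγ'
  have := h.term_eq hq0 hq1 (γ 0) (Fin.tail γ) N (by rw [← hγ', add_comm]; rfl)
  rwa [Fin.cons_self_tail] at this

/-- The weight of the `k`-th point of the lattice `y q^ℕ` in the one-dimensional sums below. -/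
noncomputable def endWeight (q : ℂ) {m : ℕ} (y y' β₀ : ℂ) (β : Fin m → ℂ) (x₀ : ℂ) (x : Fin M → ℂ)
    (k : ℕ) : ℂ :=
  qPoch q (y / β₀) k * (∏ j, qPoch q (y / β j) k) *
    (qPoch q q k * qPoch q (q * y / y') k * (qPoch q (x₀ * y) k * ∏ i, qPoch q (x i * y) k))⁻¹

/-- The terminating one-dimensional very well-poised sum dual to the multiple series. -/
noncomputable def twoEndSum (q : ℂ) {m : ℕ} (y y' β₀ : ℂ) (β : Fin m → ℂ) (x₀ : ℂ) (x : Fin M → ℂ)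
    (N : ℕ) : ℂ :=
  ∑ k ∈ range (N + 1), (y * q ^ k - y' * q ^ (N - k)) / (y - y') *
    (endWeight q y y' β₀ β x₀ x k * endWeight q y' y β₀ β x₀ x (N - k))

theorem sum_piAntidiag_two (N : ℕ) (F : (Fin 2 → ℕ) → ℂ) :
    ∑ γ ∈ piAntidiag (univ : Finset (Fin 2)) N, F γ = ∑ k ∈ range (N + 1), F ![k, N - k] := by
  symm
  refine sum_bij (fun k _ => ![k, N - k]) ?_ ?_ ?_ ?_
  · intro k hk
    have := mem_range.1 hk
    simp only [mem_piAntidiag, mem_univ, implies_true, and_true, Fin.sum_univ_two,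
      Matrix.cons_val_zero, Matrix.cons_val_one]
    omega
  · intro k _ k' _ h
    exact congrFun h 0
  · intro γ hγ
    simp only [mem_piAntidiag, mem_univ, implies_true, and_true, Fin.sum_univ_two] at hγ
    refine ⟨γ 0, mem_range.2 (by omega), ?_⟩
    funext i
    fin_cases i
    · rfl
    · simp; omega
  · intro _ _; rfl

theorem kernelCoeff_pair {y y' : ℂ} (hy : y ≠ 0) (hy' : y' ≠ 0) (k k' : ℕ) :
    kernelCoeff q ![y, y'] ![k, k'] = (y * q ^ k - y' * q ^ k') / (y - y') *
      ((qPoch q q k)⁻¹ * (qPoch q (q * y / y') k)⁻¹ *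
        ((qPoch q (q * y' / y) k')⁻¹ * (qPoch q q k')⁻¹)) := by
  have h : ∀ w : Fin 2 → ℂ, kajiDelta w = w 0 - w 1 := by
    intro w
    have : Ioi (1 : Fin 2) = ∅ := by decide
    have h' : Ioi (0 : Fin 2) = {1} := by decide
    simp [kajiDelta, Fin.prod_univ_two, this, h']
  unfold kernelCoeff
  rw [h, h]
  simp only [Fin.prod_univ_two, Matrix.cons_val_zero, Matrix.cons_val_one,
    mul_div_cancel_right₀ _ hy, mul_div_cancel_right₀ _ hy']

/-- The contribution of the pair `X₀ = q^{-N}/a`, `b₀ = q^N a d` to the dual sum. -/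
theorem KGeneric.pair_factor (h : KGeneric q x a b c₁ c₂ d) (hq0 : q ≠ 0) (k n : ℕ) :
    qPoch q ((q ^ (n + k) * a * d)⁻¹ * (a * q / c₁)) k *
        (qPoch q (1 / (q ^ (n + k) * a) * (a * q / c₁)) k)⁻¹ =
      (d ^ k)⁻¹ * (qPoch q (c₁ * d) (n + k) * (qPoch q c₁ (n + k))⁻¹) *
        (qPoch q c₁ n * (qPoch q (c₁ * d) n)⁻¹) := by
  have ha := h.a_ne
  have hc₁ := h.c₁_ne
  have hd := h.d_ne
  have hQ : q ^ (n + k) ≠ 0 := pow_ne_zero _ hq0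
  have h1 := qPoch_reverse hq0 (show q / (c₁ * d) * (c₁ * d) = q by field_simp) n k
  have h2 := qPoch_reverse hq0 (show q / c₁ * c₁ = q by field_simp) n k
  rw [show (q ^ (n + k) * a * d)⁻¹ * (a * q / c₁) = q / (c₁ * d) / q ^ (n + k) by field_simp,
    show 1 / (q ^ (n + k) * a) * (a * q / c₁) = q / c₁ / q ^ (n + k) by field_simp]
  have n1 := h.c₁d.qPoch_ne_zero hq0 n
  have n2 := h.c₁_off.qPoch_ne_zero hq0 n
  have n3 := h.c₁_off.qPoch_ne_zero hq0 (n + k)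
  have n4 := revFactor_ne_zero hq0 n k
  rw [← eq_div_iff n1] at h1
  rw [← eq_div_iff n2] at h2
  rw [h1, h2]
  rw [div_pow, div_pow, mul_pow]
  have := pow_ne_zero k hd
  have := pow_ne_zero k hc₁
  have := pow_ne_zero k hq0
  field_simp

/-- After reversal, X₀ and q^N a d contribute a k-independent prefactor and the ratios
(c₂)_k/(c₂d)_k and (c₁)_{N-k}/(c₁d)_{N-k}. These have the shape of one more b and one more x, namely
aq/(c₁c₂) and c₁c₂d/(aq), and are absorbed in `endWeight`. -/
theorem KGeneric.dual_symSum (h : KGeneric q x a b c₁ c₂ d) (hq0 : q ≠ 0) (N : ℕ) :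
    symSum q ![a * q / c₁, a * q / c₂]
      (ratWeight (fun l => ((Fin.cons (q ^ N * a * d) b : Fin (M + 3) → ℂ) l)⁻¹)
        (Fin.cons (1 / (q ^ N * a)) x : Fin (M + 1) → ℂ)) N =
    (d ^ N)⁻¹ * (qPoch q (c₁ * d) N * (qPoch q c₁ N)⁻¹) *
      (qPoch q (c₂ * d) N * (qPoch q c₂ N)⁻¹) *
      twoEndSum q (a * q / c₁) (a * q / c₂) (a * q / (c₁ * c₂)) b (c₁ * c₂ * d / (a * q)) x N := by
  have ha := h.a_ne
  have hc₁ := h.c₁_ne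
  have hc₂ := h.c₂_ne
  rw [symSum, sum_piAntidiag_two, twoEndSum, mul_sum]
  refine sum_congr rfl fun k hk => ?_
  obtain ⟨n, rfl⟩ := Nat.exists_eq_add_of_le' (Nat.lt_succ_iff.1 (mem_range.1 hk))
  rw [Nat.add_sub_cancel]
  have f1 := h.pair_factor hq0 k n
  have f2 := h.symm.pair_factor hq0 n k
  rw [add_comm k n] at f2
  rw [kernelCoeff_pair (div_ne_zero (mul_ne_zero ha hq0) hc₁)
    (div_ne_zero (mul_ne_zero ha hq0) hc₂), shiftProd, Fin.prod_univ_two]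
  simp only [Matrix.cons_val_zero, Matrix.cons_val_one, prod_ratWeight_shift]
  simp only [Fin.prod_univ_succ (n := M + 2), Fin.prod_univ_succ (n := M), Fin.cons_zero,
    Fin.cons_succ]
  have g1 : a * q / c₁ / (a * q / (c₁ * c₂)) = c₂ := by field_simp
  have g2 : a * q / c₂ / (a * q / (c₁ * c₂)) = c₁ := by field_simp
  have g3 : c₁ * c₂ * d / (a * q) * (a * q / c₁) = c₂ * d := by field_simp
  have g4 : c₁ * c₂ * d / (a * q) * (a * q / c₂) = c₁ * d := by field_simp
  simp only [endWeight, g1, g2, g3, g4, div_eq_inv_mul _ (b _)]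
  generalize qPoch q ((q ^ (n + k) * a * d)⁻¹ * (a * q / c₁)) k = t1 at *
  generalize qPoch q ((q ^ (n + k) * a * d)⁻¹ * (a * q / c₂)) n = t2 at *
  generalize qPoch q (1 / (q ^ (n + k) * a) * (a * q / c₁)) k = t3 at *
  generalize qPoch q (1 / (q ^ (n + k) * a) * (a * q / c₂)) n = t4 at *
  generalize ∏ i, qPoch q (x i * (a * q / c₁)) k = t5
  generalize ∏ i, qPoch q (x i * (a * q / c₂)) n = t6
  generalize ∏ j, qPoch q ((b j)⁻¹ * (a * q / c₁)) k = t7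
  generalize ∏ j, qPoch q ((b j)⁻¹ * (a * q / c₂)) n = t8
  generalize qPoch q (q * (a * q / c₁) / (a * q / c₂)) k = t9
  generalize qPoch q (q * (a * q / c₂) / (a * q / c₁)) n = t10
  generalize (a * q / c₁ * q ^ k - a * q / c₂ * q ^ n) / (a * q / c₁ - a * q / c₂) = t11
  generalize (qPoch q (c₁ * d) (n + k) * (qPoch q c₁ (n + k))⁻¹) = t12 at *
  generalize (qPoch q (c₂ * d) (n + k) * (qPoch q c₂ (n + k))⁻¹) = t13 at *
  simp only [div_eq_mul_inv, mul_inv, pow_add]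
  calc _ = t11 * ((qPoch q q k)⁻¹ * t9⁻¹ * (t10⁻¹ * (qPoch q q n)⁻¹)) * (t7 * t8) *
        (t5⁻¹ * t6⁻¹) * (t1 * t3⁻¹) * (t2 * t4⁻¹) := by ring
    _ = _ := by rw [f1, f2]; ring

/-- The multiple series, truncated, as a one-dimensional sum. -/
theorem KGeneric.tsum_trunc (h : KGeneric q x a b c₁ c₂ d) (hq0 : q ≠ 0) (hq1 : ‖q‖ < 1) (N : ℕ) :
    (∑' l, kajiharaTerm q x a b ![c₁, c₂] d l * truncFactor q x a d N l) *
        (qPoch q d N * ∏ j, qPoch q (a * q / b j) N) =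
      qPoch q (c₁ * d) N * qPoch q (c₂ * d) N * qPoch q q N * (∏ i, qPoch q (a * q * x i) N) *
      twoEndSum q (a * q / c₁) (a * q / c₂) (a * q / (c₁ * c₂)) b (c₁ * c₂ * d / (a * q)) x N := by
  have ha := h.a_ne
  have hc₁ := h.c₁_ne
  have hc₂ := h.c₂_ne
  have hd := h.d_ne
  have hdual := symSum_duality (τ := Fin (M + 3)) hq0 hq1 (by simp)
    (B := (Fin.cons (q ^ N * a * d) b : Fin (M + 3) → ℂ))
    (by
      intro i
      refine Fin.cases ?_ (fun i => ?_) i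
      · simp [ha, hd, hq0]
      · simpa using h.b_ne i)
    (h.qDistinct_cons hq0 N) (h.qDistinct_pair hq0) (h.mul_ne_one hq0 N)
    (by
      rw [Fin.prod_univ_succ (n := M + 2), Fin.prod_univ_succ (n := M), Fin.prod_univ_two]
      simp only [Fin.cons_zero, Fin.cons_succ, Matrix.cons_val_zero, Matrix.cons_val_one]
      have := h.bal
      have hQ : q ^ N ≠ 0 := pow_ne_zero _ hq0
      field_simp
      linear_combination this) N
  rw [h.symSum_cons hq0 hq1, h.dual_symSum hq0] at hdual
  have n1 := h.c₁_off.qPoch_ne_zero hq0 N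
  have n2 := h.c₂_off.qPoch_ne_zero hq0 N
  have n3 : qPoch q q N ≠ 0 := qPoch_ne_zero_of_forall fun s _ => by
      rw [← pow_succ']; exact pow_ne_one_of_norm_lt_one hq1 (Nat.succ_ne_zero _)
  have n4 : ∏ i, qPoch q (q * (a * x i)) N ≠ 0 := prod_ne_zero_iff.2 fun i _ =>
    ((h.ax i).mul_q hq0).qPoch_ne_zero hq0 N
  have n5 := pow_ne_zero N hd
  have e : ∏ i, qPoch q (a * q * x i) N = ∏ i, qPoch q (q * (a * x i)) N :=
    prod_congr rfl fun i _ => by congr 1; ring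
  rw [e]
  generalize ∏ i, qPoch q (q * (a * x i)) N = t1 at *
  generalize twoEndSum q (a * q / c₁) (a * q / c₂) (a * q / (c₁ * c₂)) b (c₁ * c₂ * d / (a * q)) x N
    = t2 at *
  generalize ∑' l, kajiharaTerm q x a b ![c₁, c₂] d l * truncFactor q x a d N l = t3 at *
  generalize ∏ j, qPoch q (a * q / b j) N = t4 at *
  generalize qPoch q (c₁ * d) N = t5 at *
  generalize qPoch q (c₂ * d) N = t6 at *
  field_simp at hdual
  linear_combination hdual

end

end

/-! ### Limits and uniform bounds for shifted factorials -/

section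

open scoped BigOperators Topology
open Finset Filter

section
variable {q : ℂ}

theorem summable_norm_mul_pow (hq1 : ‖q‖ < 1) (R : ℝ) : Summable fun i : ℕ => R * ‖q‖ ^ i :=
  (summable_geometric_of_lt_one (norm_nonneg _) hq1).mul_left _

theorem qPochInf_eq (q a : ℂ) : qPochInf q a = ∏' i : ℕ, (1 + -(a * q ^ i)) := by
  simp only [qPochInf, sub_eq_add_neg]

theorem tendsto_qPochInf {T : Type*} {𝓕 : Filter T} (hq1 : ‖q‖ < 1) {f : T → ℂ} {a : ℂ}
    (hf : Tendsto f 𝓕 (𝓝 a)) : Tendsto (fun t => qPochInf q (f t)) 𝓕 (𝓝 (qPochInf q a)) := by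
  simp only [qPochInf_eq]
  refine tendsto_tprod_one_add_of_dominated_convergence (summable_norm_mul_pow hq1 (‖a‖ + 1))
    (fun k => (hf.mul_const _).neg) ?_
  have : ∀ᶠ t in 𝓕, ‖f t‖ < ‖a‖ + 1 := hf.norm.eventually_lt_const (by linarith)
  filter_upwards [this] with t ht k
  rw [norm_neg, norm_mul, norm_pow]
  gcongr

/-- Argument and length vary together, as needed when the deformation and N → ∞ are taken in one
limit. The finite product is an infinite one with its late factors set to 1, dominated by a
geometric series. -/
theorem tendsto_qPoch_atTop {T : Type*} {𝓕 : Filter T} (hq1 : ‖q‖ < 1) {f : T → ℂ} {a : ℂ}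
    (hf : Tendsto f 𝓕 (𝓝 a)) {n : T → ℕ} (hn : Tendsto n 𝓕 atTop) :
    Tendsto (fun t => qPoch q (f t) (n t)) 𝓕 (𝓝 (qPochInf q a)) := by
  have h : ∀ t, qPoch q (f t) (n t) =
      ∏' i : ℕ, (1 + if i < n t then -(f t * q ^ i) else 0) := by
    intro t
    rw [tprod_eq_prod (s := range (n t))]
    · exact prod_congr rfl fun i hi => by rw [if_pos (mem_range.1 hi), sub_eq_add_neg]
    · intro i hi
      rw [if_neg (by simpa using hi), add_zero]
  simp only [h, qPochInf_eq]
  refine tendsto_tprod_one_add_of_dominated_convergence (summable_norm_mul_pow hq1 (‖a‖ + 1))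
    (fun k => ?_) ?_
  · refine ((hf.mul_const (q ^ k)).neg).congr' ?_
    filter_upwards [hn.eventually_gt_atTop k] with t ht
    rw [if_pos ht]
  · have : ∀ᶠ t in 𝓕, ‖f t‖ < ‖a‖ + 1 := hf.norm.eventually_lt_const (by linarith)
    filter_upwards [this] with t ht k
    split_ifs
    · rw [norm_neg, norm_mul, norm_pow]
      gcongr
    · rw [norm_zero]; positivity

theorem norm_qPoch_le (hq1 : ‖q‖ < 1) {a : ℂ} {R : ℝ} (ha : ‖a‖ ≤ R) (l : ℕ) :
    ‖qPoch q a l‖ ≤ Real.exp (R / (1 - ‖q‖)) := by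
  have hR : 0 ≤ R := (norm_nonneg a).trans ha
  rw [qPoch, norm_prod]
  calc ∏ i ∈ range l, ‖1 - a * q ^ i‖ ≤ ∏ i ∈ range l, Real.exp (R * ‖q‖ ^ i) := by
        refine prod_le_prod (fun _ _ => norm_nonneg _) fun i _ => ?_
        refine (norm_sub_le _ _).trans ?_
        rw [norm_one, norm_mul, norm_pow, add_comm]
        refine le_trans ?_ (Real.add_one_le_exp _)
        gcongr
    _ = Real.exp (∑ i ∈ range l, R * ‖q‖ ^ i) := (Real.exp_sum _ _).symm
    _ ≤ _ := by
        refine Real.exp_le_exp.2 ?_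
        rw [div_eq_mul_inv, ← tsum_geometric_of_lt_one (norm_nonneg q) hq1, ← tsum_mul_left]
        exact (summable_norm_mul_pow hq1 R).sum_le_tsum _ fun i _ => by positivity

theorem norm_qPochInf_le (hq1 : ‖q‖ < 1) {a : ℂ} {R : ℝ} (ha : ‖a‖ ≤ R) :
    ‖qPochInf q a‖ ≤ Real.exp (R / (1 - ‖q‖)) :=
  le_of_tendsto (tendsto_qPoch_atTop hq1 tendsto_const_nhds tendsto_id).norm
    (Eventually.of_forall fun l => norm_qPoch_le hq1 ha l)

theorem qPochInf_split (hq1 : ‖q‖ < 1) (a : ℂ) (l : ℕ) :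
    qPochInf q a = qPoch q a l * qPochInf q (a * q ^ l) := by
  have h1 := tendsto_qPoch_atTop hq1 (tendsto_const_nhds (x := a) (f := (atTop : Filter ℕ)))
    (tendsto_add_atTop_nat l)
  have h2 := (tendsto_qPoch_atTop hq1
    (tendsto_const_nhds (x := a * q ^ l) (f := (atTop : Filter ℕ))) tendsto_id).const_mul
      (qPoch q a l)
  refine tendsto_nhds_unique h1 (h2.congr fun n => ?_)
  simp only [id, qPoch]
  rw [add_comm n l, prod_range_add]
  congr 1
  exact prod_congr rfl fun i _ => by rw [pow_add]; ring

theorem qPochInf_ne_zero (hq1 : ‖q‖ < 1) {a : ℂ} (h : ∀ l, qPoch q a l ≠ 0) : qPochInf q a ≠ 0 := by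
  rw [qPochInf_eq]
  refine tprod_one_add_ne_zero_of_summable (fun i => ?_) ?_
  · have := h (i + 1)
    rw [qPoch_succ] at this
    simpa [sub_eq_add_neg] using right_ne_zero_of_mul this
  · simpa [norm_mul, norm_pow] using summable_norm_mul_pow hq1 ‖a‖

/-- `f t l` is eventually bounded in `t`, uniformly in `l`. -/
def EvBdd {T L : Type*} (𝓕 : Filter T) (f : T → L → ℂ) : Prop :=
  ∃ C : ℝ, ∀ᶠ t in 𝓕, ∀ l, ‖f t l‖ ≤ C

section
variable {T L : Type*} {𝓕 : Filter T} {f g : T → L → ℂ}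

theorem EvBdd.mul (hf : EvBdd 𝓕 f) (hg : EvBdd 𝓕 g) : EvBdd 𝓕 fun t l => f t l * g t l := by
  obtain ⟨C, hC⟩ := hf
  obtain ⟨D, hD⟩ := hg
  refine ⟨C * D, ?_⟩
  filter_upwards [hC, hD] with t h1 h2 l
  rw [norm_mul]
  exact mul_le_mul (h1 l) (h2 l) (norm_nonneg _) ((norm_nonneg _).trans (h1 l))

theorem EvBdd.sub (hf : EvBdd 𝓕 f) (hg : EvBdd 𝓕 g) : EvBdd 𝓕 fun t l => f t l - g t l := by
  obtain ⟨C, hC⟩ := hf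
  obtain ⟨D, hD⟩ := hg
  refine ⟨C + D, ?_⟩
  filter_upwards [hC, hD] with t h1 h2 l
  exact (norm_sub_le _ _).trans (add_le_add (h1 l) (h2 l))

theorem evBdd_of_tendsto {f : T → ℂ} {a : ℂ} (hf : Tendsto f 𝓕 (𝓝 a)) :
    EvBdd 𝓕 fun t (_ : L) => f t := by
  refine ⟨‖a‖ + 1, ?_⟩
  filter_upwards [hf.norm.eventually_lt_const (show ‖a‖ < ‖a‖ + 1 by linarith)] with t ht _
  exact ht.le

theorem evBdd_const (c : ℂ) : EvBdd 𝓕 fun (_ : T) (_ : L) => c :=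
  evBdd_of_tendsto tendsto_const_nhds

theorem EvBdd.prod {ι : Type*} (s : Finset ι) {f : ι → T → L → ℂ} (h : ∀ i ∈ s, EvBdd 𝓕 (f i)) :
    EvBdd 𝓕 fun t l => ∏ i ∈ s, f i t l := by
  classical
  induction s using Finset.induction_on with
  | empty => simpa using evBdd_const 1
  | insert i s hi ih =>
    simp only [prod_insert hi]
    exact (h i (mem_insert_self _ _)).mul (ih fun j hj => h j (mem_insert_of_mem hj))

theorem evBdd_pow (hq1 : ‖q‖ < 1) (n : T → L → ℕ) : EvBdd 𝓕 fun t l => q ^ n t l := by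
  refine ⟨1, Eventually.of_forall fun t l => ?_⟩
  rw [norm_pow]
  exact pow_le_one₀ (norm_nonneg _) hq1.le

theorem evBdd_qPoch (hq1 : ‖q‖ < 1) (f : T → ℂ) (n : T → L → ℕ) {a : ℂ}
    (hf : Tendsto f 𝓕 (𝓝 a)) : EvBdd 𝓕 fun t l => qPoch q (f t) (n t l) := by
  refine ⟨Real.exp ((‖a‖ + 1) / (1 - ‖q‖)), ?_⟩
  filter_upwards [hf.norm.eventually_lt_const (show ‖a‖ < ‖a‖ + 1 by linarith)] with t ht l
  exact norm_qPoch_le hq1 ht.le _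

/-- From (f)_∞ = (f)_l (f q^l)_∞: the left side stays away from 0 near a, and the tail is bounded
above, so (f)_l is bounded below uniformly in l. -/
theorem evBdd_qPoch_inv (hq1 : ‖q‖ < 1) (f : T → ℂ) (n : T → L → ℕ) {a : ℂ}
    (hf : Tendsto f 𝓕 (𝓝 a)) (ha : ∀ l, qPoch q a l ≠ 0) :
    EvBdd 𝓕 fun t l => (qPoch q (f t) (n t l))⁻¹ := by
  have hne := qPochInf_ne_zero hq1 ha
  have hpos : 0 < ‖qPochInf q a‖ := norm_pos_iff.2 hne
  have hlim := (tendsto_qPochInf hq1 hf).norm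
  set E := Real.exp ((‖a‖ + 1) / (1 - ‖q‖)) with hE
  refine ⟨E * (‖qPochInf q a‖ / 2)⁻¹, ?_⟩
  filter_upwards [hf.norm.eventually_lt_const (show ‖a‖ < ‖a‖ + 1 by linarith),
    hlim.eventually_const_lt (show ‖qPochInf q a‖ / 2 < ‖qPochInf q a‖ by linarith)] with t h1 h2 l
  have hs := qPochInf_split hq1 (f t) (n t l)
  have h3 : ‖qPochInf q (f t * q ^ n t l)‖ ≤ E := by
    refine norm_qPochInf_le hq1 ?_
    rw [norm_mul, norm_pow]
    exact (mul_le_of_le_one_right (norm_nonneg _) (pow_le_one₀ (norm_nonneg _) hq1.le)).trans h1.le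
  have h4 : ‖qPochInf q a‖ / 2 < ‖qPoch q (f t) (n t l)‖ * E := by
    refine h2.trans_le ?_
    rw [hs, norm_mul]
    gcongr
  have hE0 : 0 < E := Real.exp_pos _
  have h5 : 0 < ‖qPoch q (f t) (n t l)‖ := by
    by_contra h
    have : ‖qPoch q (f t) (n t l)‖ = 0 := le_antisymm (not_lt.1 h) (norm_nonneg _)
    rw [this, zero_mul] at h4
    linarith
  rw [norm_inv, ← div_eq_mul_inv, inv_le_iff_one_le_mul₀ h5, div_mul_eq_mul_div,
    le_div_iff₀ (by positivity)]
  linarith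

theorem summable_pow_sum {M : ℕ} {ρ : ℝ} (h0 : 0 ≤ ρ) (h1 : ρ < 1) :
    Summable fun l : Fin M → ℕ => ρ ^ ∑ i, l i := by
  refine summable_of_sum_le (c := ∏ _i : Fin M, (1 - ρ)⁻¹) (fun l => pow_nonneg h0 _) fun u => ?_
  obtain ⟨K, hK⟩ : ∃ K, u ⊆ Fintype.piFinset fun _ : Fin M => range K := by
    refine ⟨(u.sup fun l => ∑ i, l i) + 1, fun l hl => Fintype.mem_piFinset.2 fun i => ?_⟩
    have h1 : l i ≤ ∑ i, l i := single_le_sum (fun _ _ => Nat.zero_le _) (mem_univ i)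
    have h2 : ∑ i, l i ≤ u.sup fun l => ∑ i, l i := le_sup (f := fun l : Fin M → ℕ => ∑ i, l i) hl
    exact mem_range.2 (by omega)
  calc ∑ l ∈ u, ρ ^ ∑ i, l i ≤ ∑ l ∈ Fintype.piFinset fun _ : Fin M => range K, ρ ^ ∑ i, l i :=
        sum_le_sum_of_subset_of_nonneg hK fun _ _ _ => pow_nonneg h0 _
    _ = ∏ _i : Fin M, ∑ k ∈ range K, ρ ^ k := by
        rw [prod_univ_sum]
        exact sum_congr rfl fun l _ => (prod_pow_eq_pow_sum _ _ _).symm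
    _ ≤ _ := by
        refine prod_le_prod (fun _ _ => sum_nonneg fun _ _ => pow_nonneg h0 _) fun _ _ => ?_
        rw [← tsum_geometric_of_lt_one h0 h1]
        exact (summable_geometric_of_lt_one h0 h1).sum_le_tsum _ fun _ _ => pow_nonneg h0 _

end
end

end

/-! ### Convergence of Kajihara's series and continuity in the parameters -/

section

open scoped BigOperators Topology
open Finset Filter

section
variable {q : ℂ} {T : Type*} {𝓕 : Filter T} {M N : ℕ}

theorem tendsto_qPoch {f : T → ℂ} {a : ℂ} (hf : Tendsto f 𝓕 (𝓝 a)) (l : ℕ) :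
    Tendsto (fun t => qPoch q (f t) l) 𝓕 (𝓝 (qPoch q a l)) :=
  tendsto_finsetProd _ fun _ _ => tendsto_const_nhds.sub (hf.mul_const _)

theorem tendsto_kajiDelta {x : T → Fin M → ℂ} {x' : Fin M → ℂ}
    (hx : ∀ i, Tendsto (fun t => x t i) 𝓕 (𝓝 (x' i))) :
    Tendsto (fun t => kajiDelta (x t)) 𝓕 (𝓝 (kajiDelta x')) :=
  tendsto_finsetProd _ fun i _ => tendsto_finsetProd _ fun j _ => (hx i).sub (hx j)

theorem kajiharaTerm_eq_pow_mul (q : ℂ) (x : Fin M → ℂ) (a : ℂ) (u : Fin (M + N) → ℂ)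
    (v : Fin N → ℂ) (z : ℂ) (l : Fin M → ℕ) :
    kajiharaTerm q x a u v z l = z ^ (∑ i, l i) * kajiharaTerm q x a u v 1 l := by
  simp only [kajiharaTerm, one_pow]; ring

variable {x : T → Fin M → ℂ} {a : T → ℂ} {u : T → Fin (M + N) → ℂ} {v : T → Fin N → ℂ} {z : T → ℂ}
  {x' : Fin M → ℂ} {a' : ℂ} {u' : Fin (M + N) → ℂ} {v' : Fin N → ℂ} {z' : ℂ}

theorem tendsto_kajiharaTerm (hreg : KajiharaRegular q x' a' u' v')
    (hx : ∀ i, Tendsto (fun t => x t i) 𝓕 (𝓝 (x' i))) (ha : Tendsto a 𝓕 (𝓝 a'))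
    (hu : ∀ i, Tendsto (fun t => u t i) 𝓕 (𝓝 (u' i)))
    (hv : ∀ i, Tendsto (fun t => v t i) 𝓕 (𝓝 (v' i))) (hz : Tendsto z 𝓕 (𝓝 z'))
    (l : Fin M → ℕ) :
    Tendsto (fun t => kajiharaTerm q (x t) (a t) (u t) (v t) (z t) l) 𝓕
      (𝓝 (kajiharaTerm q x' a' u' v' z' l)) := by
  obtain ⟨hΔ, hx0, hu0, hv0, hax, hxx, hav, hau⟩ := hreg
  unfold kajiharaTerm
  refine (((hz.pow _).mul ((tendsto_kajiDelta fun i => (hx i).mul_const _).div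
    (tendsto_kajiDelta hx) hΔ)).mul (tendsto_finsetProd _ fun i _ => ?_)).mul ?_
  · refine ((tendsto_const_nhds.sub ((ha.mul (hx i)).mul_const _)).div
      (tendsto_const_nhds.sub (ha.mul (hx i))) (hax i)).mul (Tendsto.div ?_ ?_ ?_)
    · exact (tendsto_qPoch (ha.mul (hx i)) _).mul (tendsto_finsetProd _ fun j _ =>
        tendsto_qPoch ((hx i).mul (hu j)) _)
    · exact (tendsto_finsetProd _ fun j _ =>
        tendsto_qPoch (((hx i).const_mul q).div (hx j) (hx0 j)) _).mul
        (tendsto_finsetProd _ fun k _ =>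
          tendsto_qPoch (((ha.mul_const q).mul (hx i)).div (hv k) (hv0 k)) _)
    · exact mul_ne_zero (prod_ne_zero_iff.2 fun j _ => hxx i j _)
        (prod_ne_zero_iff.2 fun k _ => hav i k _)
  · refine Tendsto.div (tendsto_finsetProd _ fun k _ => tendsto_qPoch (hv k) _)
      (tendsto_finsetProd _ fun j _ => tendsto_qPoch ((ha.mul_const q).div (hu j) (hu0 j)) _)
      (prod_ne_zero_iff.2 fun j _ => hau j _)

/-- With the power of z removed, every remaining factor is bounded uniformly in l near the limit
parameters. The full term is thus dominated by C ρ^{|l|} for any ρ strictly above the limiting |z|.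
-/
theorem evBdd_kajiharaTerm (hq1 : ‖q‖ < 1) (hreg : KajiharaRegular q x' a' u' v')
    (hx : ∀ i, Tendsto (fun t => x t i) 𝓕 (𝓝 (x' i))) (ha : Tendsto a 𝓕 (𝓝 a'))
    (hu : ∀ i, Tendsto (fun t => u t i) 𝓕 (𝓝 (u' i)))
    (hv : ∀ i, Tendsto (fun t => v t i) 𝓕 (𝓝 (v' i))) :
    EvBdd 𝓕 fun t l => kajiharaTerm q (x t) (a t) (u t) (v t) 1 l := by
  obtain ⟨hΔ, hx0, hu0, hv0, hax, hxx, hav, hau⟩ := hreg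
  unfold kajiharaTerm
  simp only [one_pow, one_mul, div_eq_mul_inv, mul_inv, ← prod_inv_distrib]
  have key : EvBdd 𝓕 fun t (l : Fin M → ℕ) => kajiDelta fun i => x t i * q ^ l i := by
    unfold kajiDelta
    refine EvBdd.prod _ fun i _ => EvBdd.prod _ fun j _ => EvBdd.sub ?_ ?_
    · exact EvBdd.mul (evBdd_of_tendsto (hx i)) (evBdd_pow hq1 fun _ (l : Fin M → ℕ) => l i)
    · exact EvBdd.mul (evBdd_of_tendsto (hx j)) (evBdd_pow hq1 fun _ (l : Fin M → ℕ) => l j)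
  refine EvBdd.mul (EvBdd.mul ?_ (EvBdd.prod _ fun i _ => ?_)) (EvBdd.mul ?_ ?_)
  · exact EvBdd.mul key (evBdd_of_tendsto ((tendsto_kajiDelta hx).inv₀ hΔ))
  · refine EvBdd.mul (EvBdd.mul (EvBdd.sub ?_ (EvBdd.mul ?_ ?_)) ?_)
      (EvBdd.mul (EvBdd.mul ?_ (EvBdd.prod _ fun j _ => ?_))
      (EvBdd.mul (EvBdd.prod _ fun j _ => ?_) (EvBdd.prod _ fun k _ => ?_)))
    · exact evBdd_const 1
    · exact evBdd_of_tendsto (ha.mul (hx i))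
    · exact evBdd_pow hq1 fun _ (l : Fin M → ℕ) => (∑ m, l m) + l i
    · exact evBdd_of_tendsto ((tendsto_const_nhds.sub (ha.mul (hx i))).inv₀ (hax i))
    · exact evBdd_qPoch hq1 (fun t => a t * x t i) (fun _ (l : Fin M → ℕ) => ∑ m, l m) (ha.mul (hx i))
    · exact evBdd_qPoch hq1 (fun t => x t i * u t j) (fun _ (l : Fin M → ℕ) => l i) ((hx i).mul (hu j))
    · exact evBdd_qPoch_inv hq1 (fun t => q * x t i * (x t j)⁻¹) (fun _ (l : Fin M → ℕ) => l i)
        (((hx i).const_mul q).mul ((hx j).inv₀ (hx0 j))) (hxx i j)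
    · exact evBdd_qPoch_inv hq1 (fun t => a t * q * x t i * (v t k)⁻¹) (fun _ (l : Fin M → ℕ) => l i)
        (((ha.mul_const q).mul (hx i)).mul ((hv k).inv₀ (hv0 k))) (hav i k)
  · exact EvBdd.prod _ fun k _ => evBdd_qPoch hq1 (fun t => v t k)
      (fun _ (l : Fin M → ℕ) => ∑ m, l m) (hv k)
  · exact EvBdd.prod _ fun j _ => evBdd_qPoch_inv hq1 (fun t => a t * q * (u t j)⁻¹)
      (fun _ (l : Fin M → ℕ) => ∑ m, l m) ((ha.mul_const q).mul ((hu j).inv₀ (hu0 j))) (hau j)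

/-- Continuity of the series in its parameters, with additional factors tending to `1`. -/
theorem tendsto_tsum_kajiharaTerm (hq1 : ‖q‖ < 1) (hreg : KajiharaRegular q x' a' u' v')
    (hx : ∀ i, Tendsto (fun t => x t i) 𝓕 (𝓝 (x' i))) (ha : Tendsto a 𝓕 (𝓝 a'))
    (hu : ∀ i, Tendsto (fun t => u t i) 𝓕 (𝓝 (u' i)))
    (hv : ∀ i, Tendsto (fun t => v t i) 𝓕 (𝓝 (v' i))) (hz : Tendsto z 𝓕 (𝓝 z')) (hz1 : ‖z'‖ < 1)
    {e : T → (Fin M → ℕ) → ℂ} (he : EvBdd 𝓕 e) (he1 : ∀ l, Tendsto (fun t => e t l) 𝓕 (𝓝 1)) :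
    Tendsto (fun t => ∑' l, kajiharaTerm q (x t) (a t) (u t) (v t) (z t) l * e t l) 𝓕
      (𝓝 (kajiharaW q x' a' u' v' z')) := by
  obtain ⟨C, hC⟩ := (evBdd_kajiharaTerm hq1 hreg hx ha hu hv).mul he
  obtain ⟨ρ, hρ, hρ1⟩ := exists_between hz1
  have hρ0 : 0 ≤ ρ := (norm_nonneg _).trans hρ.le
  refine tendsto_tsum_of_dominated_convergence ((summable_pow_sum hρ0 hρ1).mul_right C)
    (fun l => ?_) ?_
  · simpa using (tendsto_kajiharaTerm hreg hx ha hu hv hz l).mul (he1 l)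
  · filter_upwards [hC, hz.norm.eventually_lt_const hρ] with t h1 h2 l
    rw [kajiharaTerm_eq_pow_mul, mul_assoc, norm_mul, norm_pow]
    exact mul_le_mul (pow_le_pow_left₀ (norm_nonneg _) h2.le _) (h1 l) (norm_nonneg _)
      (pow_nonneg hρ0 _)

theorem tendsto_kajiharaW (hq1 : ‖q‖ < 1) (hreg : KajiharaRegular q x' a' u' v')
    (hx : ∀ i, Tendsto (fun t => x t i) 𝓕 (𝓝 (x' i))) (ha : Tendsto a 𝓕 (𝓝 a'))
    (hu : ∀ i, Tendsto (fun t => u t i) 𝓕 (𝓝 (u' i)))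
    (hv : ∀ i, Tendsto (fun t => v t i) 𝓕 (𝓝 (v' i))) (hz : Tendsto z 𝓕 (𝓝 z')) (hz1 : ‖z'‖ < 1) :
    Tendsto (fun t => kajiharaW q (x t) (a t) (u t) (v t) (z t)) 𝓕
      (𝓝 (kajiharaW q x' a' u' v' z')) := by
  simpa [kajiharaW] using tendsto_tsum_kajiharaTerm hq1 hreg hx ha hu hv hz hz1
    (e := fun _ _ => 1) (evBdd_const 1) fun _ => tendsto_const_nhds

theorem summable_kajiharaTerm (hq1 : ‖q‖ < 1) (hreg : KajiharaRegular q x' a' u' v')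
    (hz1 : ‖z'‖ < 1) : Summable (kajiharaTerm q x' a' u' v' z') := by
  obtain ⟨C, hC⟩ := evBdd_kajiharaTerm (𝓕 := (⊤ : Filter Unit)) hq1 hreg
    (fun _ => tendsto_const_nhds) tendsto_const_nhds (fun _ => tendsto_const_nhds)
    (fun _ => tendsto_const_nhds)
  have hC' : ∀ l, ‖kajiharaTerm q x' a' u' v' 1 l‖ ≤ C := by
    have := hC.exists
    exact this.choose_spec
  refine Summable.of_norm_bounded ((summable_pow_sum (norm_nonneg z') hz1).mul_right C) fun l => ?_
  rw [kajiharaTerm_eq_pow_mul, norm_mul, norm_pow]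
  exact mul_le_mul_of_nonneg_left (hC' l) (by positivity)

/-- Convergence of the truncated series to the full one. -/
theorem tendsto_tsum_trunc (hq1 : ‖q‖ < 1) (hreg : KajiharaRegular q x' a' u' v')
    (hx : ∀ i, Tendsto (fun t => x t i) 𝓕 (𝓝 (x' i))) (ha : Tendsto a 𝓕 (𝓝 a'))
    (hu : ∀ i, Tendsto (fun t => u t i) 𝓕 (𝓝 (u' i)))
    (hv : ∀ i, Tendsto (fun t => v t i) 𝓕 (𝓝 (v' i))) (hz : Tendsto z 𝓕 (𝓝 z')) (hz1 : ‖z'‖ < 1)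
    {n : T → ℕ} (hn : Tendsto n 𝓕 atTop) :
    Tendsto (fun t => ∑' l, kajiharaTerm q (x t) (a t) (u t) (v t) (z t) l *
      truncFactor q (x t) (a t) (z t) (n t) l) 𝓕 (𝓝 (kajiharaW q x' a' u' v' z')) := by
  have hne : ∀ w : ℂ, ‖w‖ < 1 → ∀ l, qPoch q w l ≠ 0 := fun w hw l =>
    qPoch_ne_zero_of_forall fun s _ hs => by
      have : ‖w * q ^ s‖ < 1 := by
        rw [norm_mul, norm_pow]
        exact mul_lt_one_of_nonneg_of_lt_one_left (norm_nonneg _) hw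
          (pow_le_one₀ (norm_nonneg _) hq1.le)
      rw [hs, norm_one] at this
      exact lt_irrefl _ this
  have hqn : Tendsto (fun t => q ^ n t) 𝓕 (𝓝 0) :=
    (tendsto_pow_atTop_nhds_zero_of_norm_lt_one hq1).comp hn
  have h1 : ∀ i, Tendsto (fun t => x t i * (a t * z t * q ^ n t)) 𝓕 (𝓝 0) := fun i => by
    simpa using (hx i).mul ((ha.mul hz).mul hqn)
  have h2 : ∀ i, Tendsto (fun t => x t i * (a t * q * q ^ n t)) 𝓕 (𝓝 0) := fun i => by
    simpa using (hx i).mul ((ha.mul_const q).mul hqn)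
  have h0 : ‖(0 : ℂ)‖ < 1 := by simp
  refine tendsto_tsum_kajiharaTerm hq1 hreg hx ha hu hv hz hz1 ?_ fun l => ?_
  · have hb : EvBdd 𝓕 fun t (l : Fin M → ℕ) =>
        qPoch q (z t) (n t - ∑ i, l i) * qPoch q q (n t) /
          (qPoch q (z t) (n t) * qPoch q q (n t - ∑ i, l i)) *
        ∏ i, (qPoch q (x t i * (a t * z t * q ^ n t)) (l i) /
          qPoch q (x t i * (a t * q * q ^ n t)) (l i)) := by
      simp only [div_eq_mul_inv, mul_inv]
      refine EvBdd.mul (EvBdd.mul (EvBdd.mul ?_ ?_) (EvBdd.mul ?_ ?_))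
        (EvBdd.prod _ fun i _ => EvBdd.mul ?_ ?_)
      · exact evBdd_qPoch hq1 z (fun t (l : Fin M → ℕ) => n t - ∑ i, l i) hz
      · exact evBdd_of_tendsto (tendsto_qPoch_atTop hq1 tendsto_const_nhds hn)
      · exact evBdd_qPoch_inv hq1 z (fun t _ => n t) hz (hne _ hz1)
      · exact evBdd_qPoch_inv hq1 (fun _ => q) (fun t (l : Fin M → ℕ) => n t - ∑ i, l i)
          tendsto_const_nhds (hne _ hq1)
      · exact evBdd_qPoch hq1 _ (fun _ (l : Fin M → ℕ) => l i) (h1 i)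
      · exact evBdd_qPoch_inv hq1 _ (fun _ (l : Fin M → ℕ) => l i) (h2 i) (hne _ h0)
    obtain ⟨C, hC⟩ := hb
    -- The maximum with 0 covers the indices with |l| > N, where the factor is 0.
    refine ⟨max C 0, ?_⟩
    filter_upwards [hC] with t ht l
    unfold truncFactor
    split_ifs
    · exact (ht l).trans (le_max_left _ _)
    · simp
  · have hsub : Tendsto (fun t => n t - ∑ i, l i) 𝓕 atTop :=
      (tendsto_sub_atTop_nat _).comp hn
    have hz0 := qPochInf_ne_zero hq1 (hne _ hz1)
    have hq0 := qPochInf_ne_zero hq1 (hne _ hq1)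
    have hone : ∀ m, qPoch q 0 m = 1 := fun m => by simp [qPoch]
    have hlim : Tendsto (fun t => qPoch q (z t) (n t - ∑ i, l i) * qPoch q q (n t) /
          (qPoch q (z t) (n t) * qPoch q q (n t - ∑ i, l i)) *
        ∏ i, (qPoch q (x t i * (a t * z t * q ^ n t)) (l i) /
          qPoch q (x t i * (a t * q * q ^ n t)) (l i))) 𝓕 (𝓝 (qPochInf q z' * qPochInf q q /
          (qPochInf q z' * qPochInf q q) * ∏ i, (qPoch q 0 (l i) / qPoch q 0 (l i)))) :=
      (((tendsto_qPoch_atTop hq1 hz hsub).mul (tendsto_qPoch_atTop hq1 tendsto_const_nhds hn)).div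
        ((tendsto_qPoch_atTop hq1 hz hn).mul (tendsto_qPoch_atTop hq1 tendsto_const_nhds hsub))
        (mul_ne_zero hz0 hq0)).mul (tendsto_finsetProd _ fun i _ =>
          (tendsto_qPoch (h1 i) _).div (tendsto_qPoch (h2 i) _) (hne _ h0 _))
    rw [div_self (mul_ne_zero hz0 hq0)] at hlim
    simp only [hone, div_one, prod_const_one, mul_one] at hlim
    refine hlim.congr' ?_
    filter_upwards [hn.eventually_ge_atTop (∑ i, l i)] with t ht
    rw [truncFactor, if_pos ht]

end

end

/-! ### Hidden symmetries of the one-dimensional sum -/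

section

open scoped BigOperators Topology
open Finset Filter

section
variable {q : ℂ} {M : ℕ} {x : Fin M → ℂ} {a : ℂ} {b : Fin (M + 2) → ℂ} {c₁ c₂ d : ℂ}

theorem prod_update_swap {n : ℕ} (F : ℂ → ℂ) (y : Fin n → ℂ) (i : Fin n) (w : ℂ) :
    F (y i) * ∏ j, F (Function.update y i w j) = F w * ∏ j, F (y j) := by
  have h : ∏ j ∈ univ.erase i, F (Function.update y i w j) = ∏ j ∈ univ.erase i, F (y j) :=
    prod_congr rfl fun j hj => by rw [Function.update_of_ne (mem_erase.1 hj).1]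
  rw [← mul_prod_erase univ (fun j => F (Function.update y i w j)) (mem_univ i),
    ← mul_prod_erase univ (fun j => F (y j)) (mem_univ i), h, Function.update_self]
  ring

theorem endWeight_swap_x (q y y' β₀ w : ℂ) {m : ℕ} (β : Fin m → ℂ) (x : Fin M → ℂ) (i : Fin M)
    (k : ℕ) : endWeight q y y' β₀ β (x i) (Function.update x i w) k =
      endWeight q y y' β₀ β w x k := by
  unfold endWeight
  rw [prod_update_swap (fun z => qPoch q (z * y) k)]

theorem endWeight_swap_b (q y y' w x₀ : ℂ) {m : ℕ} (β : Fin m → ℂ) (x : Fin M → ℂ) (i : Fin m)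
    (k : ℕ) : endWeight q y y' (β i) (Function.update β i w) x₀ x k =
      endWeight q y y' w β x₀ x k := by
  unfold endWeight
  rw [prod_update_swap (fun z => qPoch q (y / z) k)]

/-- Reversing the order of summation, k ↦ N - k, exchanges the two ends. -/
theorem twoEndSum_comm (q y y' β₀ x₀ : ℂ) {m : ℕ} (β : Fin m → ℂ) (x : Fin M → ℂ) (N : ℕ) :
    twoEndSum q y y' β₀ β x₀ x N = twoEndSum q y' y β₀ β x₀ x N := by
  unfold twoEndSum
  rw [← sum_range_reflect]
  refine sum_congr rfl fun k hk => ?_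
  have hk' := mem_range.1 hk
  rw [show N + 1 - 1 - k = N - k by omega, show N - (N - k) = k by omega, ← neg_sub y' y,
    ← neg_sub (y' * q ^ k), neg_div_neg_eq]
  ring

theorem KGeneric.prod_ab_ne_zero (h : KGeneric q x a b c₁ c₂ d) (hq0 : q ≠ 0) (N : ℕ)
    (j : Fin (M + 2)) : qPoch q (a * q / b j) N ≠ 0 := by
  have := ((h.ab j).mul_q hq0).qPoch_ne_zero hq0 N
  rwa [show q * (a / b j) = a * q / b j by ring] at this

/-- Exchange of `x_i` with `c₁c₂d/(aq)` in the truncated series. -/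
theorem KGeneric.trunc_swap_x {i : Fin M} {d' : ℂ} (h : KGeneric q x a b c₁ c₂ d)
    (h' : KGeneric q (Function.update x i (c₁ * c₂ * d / (a * q))) a b c₁ c₂ d')
    (hd' : d' = a * q * x i / (c₁ * c₂)) (hq0 : q ≠ 0) (hq1 : ‖q‖ < 1) (N : ℕ) :
    (∑' l, kajiharaTerm q x a b ![c₁, c₂] d l * truncFactor q x a d N l) *
      (qPoch q d N * (qPoch q (c₁ * c₂ * d) N * (qPoch q (a * q * x i / c₁) N *
        qPoch q (a * q * x i / c₂) N))) =
    (qPoch q (c₁ * d) N * (qPoch q (c₂ * d) N * (qPoch q (a * q * x i) N * qPoch q d' N))) *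
      ∑' l, kajiharaTerm q (Function.update x i (c₁ * c₂ * d / (a * q))) a b ![c₁, c₂] d' l *
        truncFactor q (Function.update x i (c₁ * c₂ * d / (a * q))) a d' N l := by
  have ha := h.a_ne
  have hc₁ := h.c₁_ne
  have hc₂ := h.c₂_ne
  have k1 := h.tsum_trunc hq0 hq1 N
  have k2 := h'.tsum_trunc hq0 hq1 N
  -- In the new series the hidden variable c₁c₂d'/(aq) is the old x_i, so both dual sums involve the
  -- same M + 1 variables.
  have e0 : c₁ * c₂ * d' / (a * q) = x i := by rw [hd']; field_simp
  have e1 : c₁ * d' = a * q * x i / c₂ := by rw [hd']; field_simp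
  have e2 : c₂ * d' = a * q * x i / c₁ := by rw [hd']; field_simp
  have e3 := prod_update_swap (fun z => qPoch q (a * q * z) N) x i (c₁ * c₂ * d / (a * q))
  have e4 : a * q * (c₁ * c₂ * d / (a * q)) = c₁ * c₂ * d := by field_simp
  have e5 : twoEndSum q (a * q / c₁) (a * q / c₂) (a * q / (c₁ * c₂)) b (x i)
      (Function.update x i (c₁ * c₂ * d / (a * q))) N =
      twoEndSum q (a * q / c₁) (a * q / c₂) (a * q / (c₁ * c₂)) b (c₁ * c₂ * d / (a * q)) x N := by
    unfold twoEndSum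
    exact sum_congr rfl fun k _ => by rw [endWeight_swap_x, endWeight_swap_x]
  simp only [e4] at e3
  rw [e0, e1, e2, e5] at k2
  have hP : ∏ j, qPoch q (a * q / b j) N ≠ 0 :=
    prod_ne_zero_iff.2 fun j _ => h.prod_ab_ne_zero hq0 N j
  refine mul_right_cancel₀ hP ?_
  linear_combination (qPoch q (c₁ * c₂ * d) N * (qPoch q (a * q * x i / c₁) N *
      qPoch q (a * q * x i / c₂) N)) * k1 -
    (qPoch q (c₁ * d) N * (qPoch q (c₂ * d) N * qPoch q (a * q * x i) N)) * k2 -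
    (qPoch q (c₁ * d) N * qPoch q (c₂ * d) N * qPoch q q N * qPoch q (a * q * x i / c₁) N *
      qPoch q (a * q * x i / c₂) N *
      twoEndSum q (a * q / c₁) (a * q / c₂) (a * q / (c₁ * c₂)) b (c₁ * c₂ * d / (a * q)) x N) * e3

/-- Exchange of `b_j` with `aq/(c₁c₂)` in the truncated series. -/
theorem KGeneric.trunc_swap_b {i : Fin (M + 2)} {a' c₁' c₂' d' : ℂ} (h : KGeneric q x a b c₁ c₂ d)
    (h' : KGeneric q x a' (Function.update b i (a * q / (c₁ * c₂))) c₁' c₂' d')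
    (ha' : a' = a ^ 2 * q / (c₁ * c₂ * b i)) (hc₁' : c₁' = a * q / (c₁ * b i))
    (hc₂' : c₂' = a * q / (c₂ * b i)) (hd' : d' = c₁ * c₂ * b i * d / (a * q))
    (hq0 : q ≠ 0) (hq1 : ‖q‖ < 1) (N : ℕ) :
    (∑' l, kajiharaTerm q x a b ![c₁, c₂] d l * truncFactor q x a d N l) *
      (qPoch q d N * ((∏ j ∈ univ.erase i, qPoch q (a * q / b j) N) *
        ∏ m, qPoch q (a' * q * x m) N)) =
    (qPoch q d' N * ((∏ j ∈ univ.erase i, qPoch q (a' * q / b j) N) *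
        ∏ m, qPoch q (a * q * x m) N)) *
      ∑' l, kajiharaTerm q x a' (Function.update b i (a * q / (c₁ * c₂))) ![c₁', c₂'] d' l *
        truncFactor q x a' d' N l := by
  have ha := h.a_ne
  have hc₁ := h.c₁_ne
  have hc₂ := h.c₂_ne
  have hb := h.b_ne i
  have k1 := h.tsum_trunc hq0 hq1 N
  have k2 := h'.tsum_trunc hq0 hq1 N
  have e1 : c₁' * d' = c₂ * d := by rw [hc₁', hd']; field_simp
  have e2 : c₂' * d' = c₁ * d := by rw [hc₂', hd']; field_simp
  have e3 : a' * q / c₁' = a * q / c₂ := by rw [hc₁', ha']; field_simp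
  have e4 : a' * q / c₂' = a * q / c₁ := by rw [hc₂', ha']; field_simp
  have e5 : a' * q / (c₁' * c₂') = b i := by rw [hc₁', hc₂', ha']; field_simp
  have e6 : c₁' * c₂' * d' / (a' * q) = c₁ * c₂ * d / (a * q) := by
    rw [hc₁', hc₂', ha', hd']; field_simp
  -- The new parameters satisfy a'q/c₁' = aq/c₂ and a'q/c₂' = aq/c₁, so the two ends come out
  -- interchanged.
  have e7 : twoEndSum q (a * q / c₂) (a * q / c₁) (b i)
      (Function.update b i (a * q / (c₁ * c₂))) (c₁ * c₂ * d / (a * q)) x N =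
      twoEndSum q (a * q / c₁) (a * q / c₂) (a * q / (c₁ * c₂)) b (c₁ * c₂ * d / (a * q)) x N := by
    rw [twoEndSum_comm]
    unfold twoEndSum
    exact sum_congr rfl fun k _ => by rw [endWeight_swap_b, endWeight_swap_b]
  have e8 : ∏ j, qPoch q (a * q / b j) N =
      qPoch q (a * q / b i) N * ∏ j ∈ univ.erase i, qPoch q (a * q / b j) N :=
    (mul_prod_erase univ _ (mem_univ i)).symm
  have e9 : ∏ j, qPoch q (a' * q / Function.update b i (a * q / (c₁ * c₂)) j) N =
      qPoch q (a * q / b i) N * ∏ j ∈ univ.erase i, qPoch q (a' * q / b j) N := by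
    rw [← mul_prod_erase univ _ (mem_univ i), Function.update_self,
      show a' * q / (a * q / (c₁ * c₂)) = a * q / b i by rw [ha']; field_simp]
    congr 1
    exact prod_congr rfl fun j hj => by rw [Function.update_of_ne (mem_erase.1 hj).1]
  rw [e1, e2, e3, e4, e5, e6, e7, e9] at k2
  rw [e8] at k1
  refine mul_right_cancel₀ (h.prod_ab_ne_zero hq0 N i) ?_
  linear_combination (∏ m, qPoch q (a' * q * x m) N) * k1 - (∏ m, qPoch q (a * q * x m) N) * k2

theorem KGeneric.regular (h : KGeneric q x a b c₁ c₂ d) (hq0 : q ≠ 0) (hq1 : ‖q‖ < 1) :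
    KajiharaRegular q x a b ![c₁, c₂] := by
  refine ⟨by simpa using h.dist.kajiDelta_ne_zero 0, h.dist.ne_zero, h.b_ne, ?_,
    fun i => sub_ne_zero.2 (h.ax i).ne_one.symm, fun i j l => h.dist.qPoch_ne_zero hq1 i j l, ?_,
    fun j l => h.prod_ab_ne_zero hq0 l j⟩
  · intro k; fin_cases k
    · exact h.c₁_ne
    · exact h.c₂_ne
  · intro i k l
    have e : ∀ c, a * q * x i / c = q * (a * x i / c) := fun c => by ring
    fin_cases k
    · simpa [e] using ((h.axc₁ i).mul_q hq0).qPoch_ne_zero hq0 l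
    · simpa [e] using ((h.axc₂ i).mul_q hq0).qPoch_ne_zero hq0 l

end

/-! ### Generic limits along monomials -/

/-- Neighbourhoods of `1`, up to countable sets. -/
noncomputable def genericFilter : Filter ℂ := 𝓝 1 ⊓ cocountable

/-- Cocountable subsets of ℂ are dense, so they meet every neighbourhood of 1. This is what makes
limits along the filter unique. -/
instance genericFilter_neBot : NeBot genericFilter := by
  rw [genericFilter, inf_neBot_iff]
  intro U hU V hV
  have hd : Dense V := by simpa using Set.Countable.dense_compl ℂ (mem_cocountable.1 hV)
  obtain ⟨O, hOU, hO, h1⟩ := mem_nhds_iff.1 hU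
  obtain ⟨z, hz⟩ := hd.inter_open_nonempty O hO ⟨1, h1⟩
  exact ⟨z, hOU hz.1, hz.2⟩

/-- On nonzero arguments `f` is a monomial of degree `e` with nonzero coefficient. -/
def IsMono (f : ℂ → ℂ) (e : ℤ) : Prop := ∃ κ : ℂ, κ ≠ 0 ∧ ∀ s, s ≠ 0 → f s = κ * s ^ e

section
variable {f g : ℂ → ℂ} {e e' : ℤ}

theorem IsMono.mul (hf : IsMono f e) (hg : IsMono g e') : IsMono (fun s => f s * g s) (e + e') := by
  obtain ⟨κ, hκ, h⟩ := hf
  obtain ⟨κ', hκ', h'⟩ := hg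
  refine ⟨κ * κ', mul_ne_zero hκ hκ', fun s hs => ?_⟩
  beta_reduce
  rw [h s hs, h' s hs, zpow_add₀ hs]; ring

theorem IsMono.inv (hf : IsMono f e) : IsMono (fun s => (f s)⁻¹) (-e) := by
  obtain ⟨κ, hκ, h⟩ := hf
  refine ⟨κ⁻¹, inv_ne_zero hκ, fun s hs => ?_⟩
  beta_reduce
  rw [h s hs, zpow_neg, mul_inv]

theorem IsMono.div (hf : IsMono f e) (hg : IsMono g e') : IsMono (fun s => f s / g s) (e - e') := by
  simpa [div_eq_mul_inv, sub_eq_add_neg] using hf.mul hg.inv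

theorem isMono_const {c : ℂ} (hc : c ≠ 0) : IsMono (fun _ => c) 0 := ⟨c, hc, by simp⟩

theorem isMono_mul_pow {c : ℂ} (hc : c ≠ 0) (n : ℕ) : IsMono (fun s => c * s ^ n) n :=
  ⟨c, hc, fun s _ => by simp⟩

theorem eventually_ne_zero_genericFilter : ∀ᶠ s in genericFilter, s ≠ 0 :=
  (eventually_ne_nhds one_ne_zero).filter_mono inf_le_left

theorem IsMono.tendsto (hf : IsMono f e) : Tendsto f genericFilter (𝓝 (f 1)) := by
  obtain ⟨κ, hκ, h⟩ := hf
  have h1 : f 1 = κ * (1 : ℂ) ^ e := h 1 one_ne_zero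
  rw [h1]
  have hc : Tendsto (fun s : ℂ => κ * s ^ e) (𝓝 1) (𝓝 (κ * 1 ^ e)) :=
    (continuousAt_zpow₀ (1 : ℂ) e (Or.inl one_ne_zero)).tendsto.const_mul κ
  refine (hc.mono_left inf_le_left).congr' ?_
  filter_upwards [eventually_ne_zero_genericFilter] with s hs
  exact (h s hs).symm

theorem IsMono.eventually_ne_zero (hf : IsMono f e) : ∀ᶠ s in genericFilter, f s ≠ 0 := by
  obtain ⟨κ, hκ, h⟩ := hf
  filter_upwards [eventually_ne_zero_genericFilter] with s hs
  rw [h s hs]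
  exact mul_ne_zero hκ (zpow_ne_zero _ hs)

theorem countable_zpow_eq {e : ℤ} (he : e ≠ 0) (w : ℂ) : {s : ℂ | s ^ e = w}.Countable := by
  have key : ∀ (n : ℕ) (w : ℂ), n ≠ 0 → {s : ℂ | s ^ n = w}.Countable := by
    intro n w hn
    refine (Set.Finite.subset (Polynomial.nthRoots n w).toFinset.finite_toSet ?_).countable
    intro s hs
    simpa [Polynomial.mem_nthRoots (Nat.pos_of_ne_zero hn)] using hs
  obtain ⟨n, rfl | rfl⟩ := e.eq_nat_or_neg
  · simpa using key n w (by simpa using he)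
  · refine (key n w⁻¹ (by simpa using he)).mono fun s hs => ?_
    simp only [Set.mem_ofPred_eq, zpow_neg, zpow_natCast] at hs ⊢
    rw [← hs, inv_inv]

/-- For each n the equation κ s^e = q^n has only countably many solutions since e ≠ 0, and n ranges
over the countable set ℤ. -/
theorem IsMono.eventually_offPowers (hf : IsMono f e) (he : e ≠ 0) (q : ℂ) :
    ∀ᶠ s in genericFilter, OffPowers q (f s) := by
  obtain ⟨κ, hκ, h⟩ := hf
  have hc : (⋃ n : ℤ, {s : ℂ | s ^ e = q ^ n / κ}).Countable :=
    Set.countable_iUnion fun n => countable_zpow_eq he _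
  have hc' : ∀ᶠ s in genericFilter, s ∉ ⋃ n : ℤ, {s : ℂ | s ^ e = q ^ n / κ} :=
    Eventually.filter_mono inf_le_right (by
      change (⋃ n : ℤ, {s : ℂ | s ^ e = q ^ n / κ})ᶜ ∈ cocountable
      rwa [mem_cocountable, compl_compl])
  filter_upwards [hc', eventually_ne_zero_genericFilter] with s hs hs0 n hn
  refine hs (Set.mem_iUnion.2 ⟨n, ?_⟩)
  rw [h s hs0] at hn
  simp only [Set.mem_ofPred_eq]
  rw [← hn]; field_simp

end

end

/-! ### Deforming the parameters into general position -/

section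

open scoped BigOperators Topology
open Finset Filter

section
variable {q : ℂ} {M : ℕ}

/-- Nonvanishing of all (q x_i/x_j)_l rules out x_j = x_i q^{n+1}, and Δ(x) ≠ 0 rules out equality.
Hence x itself needs no deformation. -/
theorem KajiharaRegular.qDistinct {N : ℕ} {x : Fin M → ℂ} {a : ℂ} {u : Fin (M + N) → ℂ}
    {v : Fin N → ℂ} (h : KajiharaRegular q x a u v) (hq0 : q ≠ 0) : QDistinct q x := by
  have key : ∀ i j (n : ℕ), x i * q ^ (n + 1) ≠ x j := by
    intro i j n hn
    have h1 := h.2.2.2.2.2.1 i j (n + 1)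
    rw [qPoch_succ] at h1
    refine right_ne_zero_of_mul h1 ?_
    rw [show q * x i / x j * q ^ n = x i * q ^ (n + 1) / x j by ring, hn, div_self (h.2.1 j),
      sub_self]
  have hinj : ∀ i j, i ≠ j → x i ≠ x j := by
    have h1 := h.1
    unfold kajiDelta at h1
    intro i j hij
    rcases lt_or_gt_of_ne hij with h2 | h2
    · exact sub_ne_zero.1 (prod_ne_zero_iff.1 (prod_ne_zero_iff.1 h1 i (mem_univ i)) j (mem_Ioi.2 h2))
    · exact (sub_ne_zero.1
        (prod_ne_zero_iff.1 (prod_ne_zero_iff.1 h1 j (mem_univ j)) i (mem_Ioi.2 h2))).symm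
  refine ⟨h.2.1, fun i j hij m n hmn => ?_⟩
  rcases lt_trichotomy m n with hlt | rfl | hlt
  · obtain ⟨k, rfl⟩ := Nat.exists_eq_add_of_lt hlt
    refine key j i k (mul_right_cancel₀ (pow_ne_zero m hq0) ?_)
    rw [hmn]; ring
  · exact hinj i j hij (mul_right_cancel₀ (pow_ne_zero m hq0) hmn)
  · obtain ⟨k, rfl⟩ := Nat.exists_eq_add_of_lt hlt
    refine key i j k (mul_right_cancel₀ (pow_ne_zero n hq0) ?_)
    rw [← hmn]; ring

theorem eventually_qDistinct_update {x : Fin M → ℂ} (hx : QDistinct q x) {i : Fin M}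
    {w : ℂ → ℂ} {e : ℤ} (hw : IsMono w e) (he : e ≠ 0) (hq0 : q ≠ 0) :
    ∀ᶠ s in genericFilter, QDistinct q (Function.update x i (w s)) := by
  have h1 : ∀ j, ∀ᶠ s in genericFilter, OffPowers q (w s / x j) := fun j =>
    (hw.div (isMono_const (hx.ne_zero j))).eventually_offPowers (by simpa) q
  filter_upwards [eventually_all.2 h1, hw.eventually_ne_zero] with s hs hs0
  have hoff : ∀ j (m n : ℕ), w s * q ^ m ≠ x j * q ^ n := by
    intro j m n hmn
    refine hs j (n - m) ?_
    rw [zpow_sub₀ hq0, zpow_natCast, zpow_natCast,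
      div_eq_div_iff (hx.ne_zero j) (pow_ne_zero m hq0), hmn, mul_comm]
  refine ⟨fun j => ?_, fun j k hjk m n => ?_⟩
  · rcases eq_or_ne j i with rfl | hj
    · simpa using hs0
    · simpa [hj] using hx.ne_zero j
  · rcases eq_or_ne j i with rfl | hj
    · simpa [hjk.symm] using hoff k m n
    · rcases eq_or_ne k i with rfl | hk
      · simpa [hj] using (hoff j n m).symm
      · simpa [hj, hk] using hx.ne j k hjk m n

/-- Along monomial parameters, each condition of avoiding powers of q concerns a monomial in s, so
it suffices that its exponent be nonzero. -/
theorem eventually_kGeneric {x : ℂ → Fin M → ℂ} {a : ℂ → ℂ} {b : ℂ → Fin (M + 2) → ℂ}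
    {c₁ c₂ d : ℂ → ℂ} {α γ₁ γ₂ δ : ℤ} {ξ : Fin M → ℤ} {β : Fin (M + 2) → ℤ}
    (hx : ∀ i, IsMono (fun s => x s i) (ξ i)) (ha : IsMono a α)
    (hb : ∀ j, IsMono (fun s => b s j) (β j)) (hc₁ : IsMono c₁ γ₁) (hc₂ : IsMono c₂ γ₂)
    (hd : IsMono d δ) (hdist : ∀ᶠ s in genericFilter, QDistinct q (x s))
    (hbal : ∀ᶠ s in genericFilter,
      d s * (c₁ s * c₂ s * (∏ j, b s j) * ∏ i, x s i) = a s ^ 2 * q ^ 2)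
    (hξ : ∀ i, α + ξ i ≠ 0 ∧ α + ξ i - γ₁ ≠ 0 ∧ α + ξ i - γ₂ ≠ 0) (hβ : ∀ j, α - β j ≠ 0)
    (h : γ₁ ≠ 0 ∧ γ₂ ≠ 0 ∧ γ₁ - γ₂ ≠ 0 ∧ δ ≠ 0 ∧ γ₁ + δ ≠ 0 ∧ γ₂ + δ ≠ 0) :
    ∀ᶠ s in genericFilter, KGeneric q (x s) (a s) (b s) (c₁ s) (c₂ s) (d s) := by
  have k1 := eventually_all.2 fun i => ((ha.mul (hx i)).eventually_offPowers (hξ i).1 q)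
  have k2 := eventually_all.2 fun i => (((ha.mul (hx i)).div hc₁).eventually_offPowers (hξ i).2.1 q)
  have k3 := eventually_all.2 fun i => (((ha.mul (hx i)).div hc₂).eventually_offPowers (hξ i).2.2 q)
  have k4 := eventually_all.2 fun j => ((ha.div (hb j)).eventually_offPowers (hβ j) q)
  have k5 := eventually_all.2 fun j => (hb j).eventually_ne_zero
  obtain ⟨h1, h2, h3, h4, h5, h6⟩ := h
  filter_upwards [k1, k2, k3, k4, k5, hdist, hbal, ha.eventually_ne_zero, hc₁.eventually_ne_zero,
    hc₂.eventually_ne_zero, hd.eventually_ne_zero, hc₁.eventually_offPowers h1 q,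
    hc₂.eventually_offPowers h2 q, (hc₁.div hc₂).eventually_offPowers h3 q,
    hd.eventually_offPowers h4 q, (hc₁.mul hd).eventually_offPowers h5 q,
    (hc₂.mul hd).eventually_offPowers h6 q] with s s1 s2 s3 s4 s5 s6 s7 s8 s9 s10 s11 s12 s13 s14 s15
    s16 s17
  exact ⟨s6, s8, s5, s9, s10, s11, s7, s1, s4, s12, s13, s14, s2, s3, s15, s16, s17⟩

end

/-- A one-parameter deformation in general position of `(a, c₁, c₂)` for fixed `x` and `b`. -/
structure IsDeformation (q : ℂ) {M : ℕ} (x : Fin M → ℂ) (b : Fin (M + 2) → ℂ)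
    (a c₁ c₂ d : ℂ → ℂ) : Prop where
  dist : QDistinct q x
  b_ne : ∀ j, b j ≠ 0
  a_mono : IsMono a 1
  c₁_mono : IsMono c₁ 3
  c₂_mono : IsMono c₂ 4
  d_mono : IsMono d (-5)
  bal : ∀ᶠ s in genericFilter, d s * (c₁ s * c₂ s * (∏ j, b j) * ∏ i, x i) = a s ^ 2 * q ^ 2

section
variable {q : ℂ} {M : ℕ} {x : Fin M → ℂ} {b : Fin (M + 2) → ℂ} {a c₁ c₂ d : ℂ → ℂ}

theorem exists_isDeformation {a₀ c₁₀ c₂₀ d₀ : ℂ} (hx : QDistinct q x) (hb : ∀ j, b j ≠ 0)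
    (ha : a₀ ≠ 0) (hc₁ : c₁₀ ≠ 0) (hc₂ : c₂₀ ≠ 0) (hq0 : q ≠ 0)
    (hd : d₀ = a₀ ^ 2 * q ^ 2 / (c₁₀ * c₂₀ * (∏ j, b j) * ∏ i, x i)) :
    ∃ a c₁ c₂ d : ℂ → ℂ, IsDeformation q x b a c₁ c₂ d ∧ a 1 = a₀ ∧ c₁ 1 = c₁₀ ∧ c₂ 1 = c₂₀ ∧
      d 1 = d₀ := by
  have hB : ∏ j, b j ≠ 0 := prod_ne_zero_iff.2 fun j _ => hb j
  have hX : ∏ i, x i ≠ 0 := prod_ne_zero_iff.2 fun i _ => hx.ne_zero i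
  have hd0 : d₀ ≠ 0 := by
    rw [hd]; exact div_ne_zero (by positivity) (by positivity)
  -- The exponent -5 = 2·1 - 3 - 4 of d is forced by balancing. With 1, 3, 4 for a, c₁, c₂, every
  -- exponent that must be nonzero is so, for the original parameters and for the transformed ones
  -- of all three parts.
  refine ⟨fun s => a₀ * s ^ 1, fun s => c₁₀ * s ^ 3, fun s => c₂₀ * s ^ 4,
    fun s => d₀ * s ^ (-5 : ℤ), ⟨hx, hb, isMono_mul_pow ha 1, isMono_mul_pow hc₁ 3,
      isMono_mul_pow hc₂ 4, ⟨d₀, hd0, fun s _ => rfl⟩, ?_⟩, by simp, by simp, by simp, by simp⟩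
  filter_upwards [eventually_ne_zero_genericFilter] with s hs
  have : d₀ * (c₁₀ * c₂₀ * (∏ j, b j) * ∏ i, x i) = a₀ ^ 2 * q ^ 2 := by
    rw [hd, div_mul_cancel₀]; positivity
  have h5 : s ^ (-5 : ℤ) * (s ^ 3 * s ^ 4) = s ^ 2 := by
    rw [zpow_neg]; norm_cast; field_simp
  linear_combination (s ^ 2) * this + d₀ * (c₁₀ * c₂₀ * (∏ j, b j) * ∏ i, x i) * h5

theorem IsDeformation.kGeneric (h : IsDeformation q x b a c₁ c₂ d) :
    ∀ᶠ s in genericFilter, KGeneric q x (a s) b (c₁ s) (c₂ s) (d s) :=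
  eventually_kGeneric (fun i => isMono_const (h.dist.ne_zero i)) h.a_mono (fun j => isMono_const (h.b_ne j))
    h.c₁_mono h.c₂_mono h.d_mono (.of_forall fun _ => h.dist) h.bal (by norm_num) (by norm_num) (by norm_num)

theorem IsDeformation.kGeneric_swap_x (h : IsDeformation q x b a c₁ c₂ d) (hq0 : q ≠ 0)
    (i : Fin M) : ∀ᶠ s in genericFilter,
      KGeneric q (Function.update x i (c₁ s * c₂ s * d s / (a s * q))) (a s) b (c₁ s) (c₂ s)
        (a s * q * x i / (c₁ s * c₂ s)) := by
  have hq := isMono_const hq0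
  have hw := ((h.c₁_mono.mul h.c₂_mono).mul h.d_mono).div (h.a_mono.mul hq)
  refine eventually_kGeneric (ξ := Function.update 0 i 1) (fun j => ?_) h.a_mono
    (fun j => isMono_const (h.b_ne j)) h.c₁_mono h.c₂_mono
    (((h.a_mono.mul hq).mul (isMono_const (h.dist.ne_zero i))).div (h.c₁_mono.mul h.c₂_mono))
    (eventually_qDistinct_update h.dist hw (by norm_num) hq0) ?_ (fun j => ?_) (by norm_num)
    (by norm_num)
  · rcases eq_or_ne j i with rfl | hj
    · simpa using hw
    · simpa [hj] using isMono_const (h.dist.ne_zero j)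
  · filter_upwards [h.bal, h.a_mono.eventually_ne_zero, h.c₁_mono.eventually_ne_zero,
      h.c₂_mono.eventually_ne_zero] with s hs h1 h2 h3
    have e := prod_update_swap id x i (c₁ s * c₂ s * d s / (a s * q))
    simp only [id] at e
    have e' : a s * q * x i / (c₁ s * c₂ s) * (c₁ s * c₂ s) = a s * q * x i :=
      div_mul_cancel₀ _ (mul_ne_zero h2 h3)
    have e'' : a s * q * (c₁ s * c₂ s * d s / (a s * q)) = c₁ s * c₂ s * d s :=
      mul_div_cancel₀ _ (mul_ne_zero h1 hq0)
    linear_combination hs + (∏ j, b j) * (∏ i, x i) * e'' + a s * q * (∏ j, b j) * e +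
      (∏ j, b j) * (∏ j, Function.update x i (c₁ s * c₂ s * d s / (a s * q)) j) * e'
  · rcases eq_or_ne j i with rfl | hj
    · simp
    · simp [hj]

theorem IsDeformation.kGeneric_swap_b (h : IsDeformation q x b a c₁ c₂ d) (hq0 : q ≠ 0)
    (i : Fin (M + 2)) : ∀ᶠ s in genericFilter,
      KGeneric q x (a s ^ 2 * q / (c₁ s * c₂ s * b i))
        (Function.update b i (a s * q / (c₁ s * c₂ s)))
        (a s * q / (c₁ s * b i)) (a s * q / (c₂ s * b i)) (c₁ s * c₂ s * b i * d s / (a s * q)) := by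
  have hq := isMono_const hq0
  have hb := isMono_const (h.b_ne i)
  have hw := (h.a_mono.mul hq).div (h.c₁_mono.mul h.c₂_mono)
  have ha2 : IsMono (fun s => a s ^ 2) (1 + 1) := by simpa only [pow_two] using h.a_mono.mul h.a_mono
  refine eventually_kGeneric (ξ := 0) (β := Function.update 0 i (-6)) 
    (fun j => isMono_const (h.dist.ne_zero j))
    ((ha2.mul hq).div ((h.c₁_mono.mul h.c₂_mono).mul hb))
    (fun j => ?_) ((h.a_mono.mul hq).div (h.c₁_mono.mul hb)) ((h.a_mono.mul hq).div (h.c₂_mono.mul hb))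
    ((((h.c₁_mono.mul h.c₂_mono).mul hb).mul h.d_mono).div (h.a_mono.mul hq))
    (.of_forall fun _ => h.dist) ?_ (by norm_num) (fun j => ?_) (by norm_num)
  · rcases eq_or_ne j i with rfl | hj
    · simpa using hw
    · simpa [hj] using isMono_const (h.b_ne j)
  · filter_upwards [h.bal, h.a_mono.eventually_ne_zero, h.c₁_mono.eventually_ne_zero,
      h.c₂_mono.eventually_ne_zero] with s hs h1 h2 h3
    have e := prod_update_swap id b i (a s * q / (c₁ s * c₂ s))
    simp only [id] at e
    have hbi := h.b_ne i
    have e2 : ∏ j, Function.update b i (a s * q / (c₁ s * c₂ s)) j =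
      a s * q / (c₁ s * c₂ s) * (∏ j, b j) / b i := by
      rw [← e]; field_simp
    rw [e2]
    field_simp
    linear_combination hs
  · rcases eq_or_ne j i with rfl | hj
    · simp
    · simp [hj]

theorem IsDeformation.kGeneric₁₃ (h : IsDeformation q x b a c₁ c₂ d) (hq0 : q ≠ 0) :
    ∀ᶠ s in genericFilter,
      KGeneric q x (a s * q / (c₁ s * d s)) b (c₂ s) (q / d s) (q / c₁ s) := by
  have hq := isMono_const hq0
  refine eventually_kGeneric (fun i => isMono_const (h.dist.ne_zero i))
    ((h.a_mono.mul hq).div (h.c₁_mono.mul h.d_mono)) (fun j => isMono_const (h.b_ne j))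
    h.c₂_mono (hq.div h.d_mono) (hq.div h.c₁_mono) (.of_forall fun _ => h.dist) ?_ (by norm_num) (by norm_num)
    (by norm_num)
  filter_upwards [h.bal, h.c₁_mono.eventually_ne_zero, h.d_mono.eventually_ne_zero] with s hs h1 h2
  field_simp
  linear_combination hs

theorem IsDeformation.kGeneric₂₃ (h : IsDeformation q x b a c₁ c₂ d) (hq0 : q ≠ 0) :
    ∀ᶠ s in genericFilter,
      KGeneric q x (a s * q / (c₂ s * d s)) b (c₁ s) (q / d s) (q / c₂ s) := by
  have hq := isMono_const hq0
  refine eventually_kGeneric (fun i => isMono_const (h.dist.ne_zero i))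
    ((h.a_mono.mul hq).div (h.c₂_mono.mul h.d_mono)) (fun j => isMono_const (h.b_ne j))
    h.c₁_mono (hq.div h.d_mono) (hq.div h.c₂_mono) (.of_forall fun _ => h.dist) ?_ (by norm_num) (by norm_num)
    (by norm_num)
  filter_upwards [h.bal, h.c₂_mono.eventually_ne_zero, h.d_mono.eventually_ne_zero] with s hs h1 h2
  field_simp
  linear_combination hs

end

end

/-! ### The two exchange transformations in the limit -/

section

open scoped BigOperators Topology
open Finset Filter

section
variable {T : Type*} {𝓕 : Filter T}

theorem tendsto_vecCons₂ {f g : T → ℂ} {y z : ℂ} (hf : Tendsto f 𝓕 (𝓝 y)) (hg : Tendsto g 𝓕 (𝓝 z))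
    (k : Fin 2) : Tendsto (fun t => ![f t, g t] k) 𝓕 (𝓝 (![y, z] k)) := by
  fin_cases k
  · exact hf
  · exact hg

theorem tendsto_update_apply {n : ℕ} (x : Fin n → ℂ) (i : Fin n) {f : T → ℂ} {y : ℂ}
    (hf : Tendsto f 𝓕 (𝓝 y)) (j : Fin n) :
    Tendsto (fun t => Function.update x i (f t) j) 𝓕 (𝓝 (Function.update x i y j)) := by
  rcases eq_or_ne j i with rfl | hj
  · simpa using hf
  · simpa [hj] using tendsto_const_nhds

end

section
variable {q : ℂ} {M : ℕ} {x : Fin M → ℂ} {a : ℂ} {b : Fin (M + 2) → ℂ} {c₁ c₂ d : ℂ}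

theorem KajiharaRegular.exists_isDeformation (h : KajiharaRegular q x a b ![c₁, c₂]) (hq0 : q ≠ 0)
    (ha : a ≠ 0) (hd : d = a ^ 2 * q ^ 2 / (c₁ * c₂ * (∏ j, b j) * ∏ i, x i)) :
    ∃ a' c₁' c₂' d' : ℂ → ℂ, IsDeformation q x b a' c₁' c₂' d' ∧ a' 1 = a ∧ c₁' 1 = c₁ ∧
      c₂' 1 = c₂ ∧ d' 1 = d :=
  _root_.exists_isDeformation (h.qDistinct hq0) h.2.2.1 ha (h.2.2.2.1 0) (h.2.2.2.1 1) hq0 hd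

/-- The truncated exchange identity, cleared of denominators, holds for generic s and every N; both
sides converge as (N, s) → (∞, 1), and only then is the denominator divided out. -/
theorem kajiharaW_swap_x (i : Fin M) (hq0 : q ≠ 0) (hq1 : ‖q‖ < 1) (ha : a ≠ 0)
    (hd : d = a ^ 2 * q ^ 2 / (c₁ * c₂ * (∏ j, b j) * ∏ i, x i))
    (hW : KajiharaRegular q x a b ![c₁, c₂])
    (hW' : KajiharaRegular q (Function.update x i (c₁ * c₂ * d / (a * q))) a b ![c₁, c₂])
    (hne : qPochInfs q [d, c₁ * c₂ * d, a * q * x i / c₁, a * q * x i / c₂] ≠ 0)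
    (hd1 : ‖d‖ < 1) (hd1' : ‖a * q * x i / (c₁ * c₂)‖ < 1) :
    kajiharaW q x a b ![c₁, c₂] d =
      qPochInfs q [c₁ * d, c₂ * d, a * q * x i, a * q * x i / (c₁ * c₂)] /
        qPochInfs q [d, c₁ * c₂ * d, a * q * x i / c₁, a * q * x i / c₂] *
      kajiharaW q (Function.update x i (c₁ * c₂ * d / (a * q))) a b ![c₁, c₂]
        (a * q * x i / (c₁ * c₂)) := by
  have hc₁ : c₁ ≠ 0 := hW.2.2.2.1 0
  have hc₂ : c₂ ≠ 0 := hW.2.2.2.1 1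
  obtain ⟨A, C₁, C₂, D, h, rfl, rfl, rfl, rfl⟩ := hW.exists_isDeformation hq0 ha hd
  have tn : Tendsto (Prod.fst : ℕ × ℂ → ℕ) (atTop ×ˢ genericFilter) atTop := tendsto_fst
  have ts : Tendsto (Prod.snd : ℕ × ℂ → ℂ) (atTop ×ˢ genericFilter) genericFilter := tendsto_snd
  have tA := h.a_mono.tendsto.comp ts
  have tC₁ := h.c₁_mono.tendsto.comp ts
  have tC₂ := h.c₂_mono.tendsto.comp ts
  have tD := h.d_mono.tendsto.comp ts
  have tq : Tendsto (fun _ : ℕ × ℂ => q) (atTop ×ˢ genericFilter) (𝓝 q) := tendsto_const_nhds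
  have tx : Tendsto (fun _ : ℕ × ℂ => x i) (atTop ×ˢ genericFilter) (𝓝 (x i)) := tendsto_const_nhds
  have tw := ((tC₁.mul tC₂).mul tD).div (tA.mul tq) (mul_ne_zero ha hq0)
  have td' := ((tA.mul tq).mul tx).div (tC₁.mul tC₂) (mul_ne_zero hc₁ hc₂)
  have P {f : ℕ × ℂ → ℂ} {y : ℂ} (hf : Tendsto f (atTop ×ˢ genericFilter) (𝓝 y)) :=
    tendsto_qPoch_atTop hq1 hf tn
  have L1 := (tendsto_tsum_trunc hq1 hW (fun _ => tendsto_const_nhds) tA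
    (fun _ => tendsto_const_nhds) (tendsto_vecCons₂ tC₁ tC₂) tD hd1 tn).mul
    ((P tD).mul ((P ((tC₁.mul tC₂).mul tD)).mul ((P (((tA.mul tq).mul tx).div tC₁ hc₁)).mul
      (P (((tA.mul tq).mul tx).div tC₂ hc₂)))))
  have L2 := ((P (tC₁.mul tD)).mul ((P (tC₂.mul tD)).mul ((P ((tA.mul tq).mul tx)).mul
    (P td')))).mul (tendsto_tsum_trunc hq1 hW' (tendsto_update_apply x i tw) tA
    (fun _ => tendsto_const_nhds) (tendsto_vecCons₂ tC₁ tC₂) td' hd1' tn)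
  have key := tendsto_nhds_unique (L1.congr' ?_) L2
  · simp only [qPochInfs, List.map_cons, List.map_nil, List.prod_cons, List.prod_nil, mul_one] at hne ⊢
    rw [div_mul_eq_mul_div, eq_div_iff hne]
    exact key
  · filter_upwards [ts.eventually h.kGeneric, ts.eventually (h.kGeneric_swap_x hq0 i)] with p h1 h2
    exact h1.trunc_swap_x h2 rfl hq0 hq1 p.1

/-- Same double limit, applied to the exchange of b_i with aq/(c₁c₂). The factor (aq/b_i)_N is
common to both sides and already cancelled, so its limit need not be nonzero. -/
theorem kajiharaW_swap_b (i : Fin (M + 2)) (hq0 : q ≠ 0) (hq1 : ‖q‖ < 1) (ha : a ≠ 0)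
    (hd : d = a ^ 2 * q ^ 2 / (c₁ * c₂ * (∏ j, b j) * ∏ i, x i))
    (hW : KajiharaRegular q x a b ![c₁, c₂])
    (hW' : KajiharaRegular q x (a ^ 2 * q / (c₁ * c₂ * b i))
      (Function.update b i (a * q / (c₁ * c₂))) ![a * q / (c₁ * b i), a * q / (c₂ * b i)])
    (hned : qPochInf q d ≠ 0)
    (hnex : ∀ m, qPochInf q (a ^ 2 * q ^ 2 * x m / (c₁ * c₂ * b i)) ≠ 0)
    (hneb : ∀ j, j ≠ i → qPochInf q (a * q / b j) ≠ 0)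
    (hd1 : ‖d‖ < 1) (hd1' : ‖c₁ * c₂ * b i * d / (a * q)‖ < 1) :
    kajiharaW q x a b ![c₁, c₂] d =
      qPochInf q (c₁ * c₂ * b i * d / (a * q)) / qPochInf q d *
      (∏ m, qPochInf q (a * q * x m) / qPochInf q (a ^ 2 * q ^ 2 * x m / (c₁ * c₂ * b i))) *
      (∏ j ∈ univ.erase i, qPochInf q (a ^ 2 * q ^ 2 / (c₁ * c₂ * b i * b j)) /
        qPochInf q (a * q / b j)) *
      kajiharaW q x (a ^ 2 * q / (c₁ * c₂ * b i)) (Function.update b i (a * q / (c₁ * c₂)))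
        ![a * q / (c₁ * b i), a * q / (c₂ * b i)] (c₁ * c₂ * b i * d / (a * q)) := by
  have hc₁ : c₁ ≠ 0 := hW.2.2.2.1 0
  have hc₂ : c₂ ≠ 0 := hW.2.2.2.1 1
  have hb := hW.2.2.1
  obtain ⟨A, C₁, C₂, D, h, rfl, rfl, rfl, rfl⟩ := hW.exists_isDeformation hq0 ha hd
  have tn : Tendsto (Prod.fst : ℕ × ℂ → ℕ) (atTop ×ˢ genericFilter) atTop := tendsto_fst
  have ts : Tendsto (Prod.snd : ℕ × ℂ → ℂ) (atTop ×ˢ genericFilter) genericFilter := tendsto_snd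
  have tA := h.a_mono.tendsto.comp ts
  have tC₁ := h.c₁_mono.tendsto.comp ts
  have tC₂ := h.c₂_mono.tendsto.comp ts
  have tD := h.d_mono.tendsto.comp ts
  have tK (y : ℂ) : Tendsto (fun _ : ℕ × ℂ => y) (atTop ×ˢ genericFilter) (𝓝 y) :=
    tendsto_const_nhds
  have ta' := ((tA.pow 2).mul (tK q)).div ((tC₁.mul tC₂).mul (tK (b i)))
    (mul_ne_zero (mul_ne_zero hc₁ hc₂) (hb i))
  have tw := (tA.mul (tK q)).div (tC₁.mul tC₂) (mul_ne_zero hc₁ hc₂)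
  have tc₁' := (tA.mul (tK q)).div (tC₁.mul (tK (b i))) (mul_ne_zero hc₁ (hb i))
  have tc₂' := (tA.mul (tK q)).div (tC₂.mul (tK (b i))) (mul_ne_zero hc₂ (hb i))
  have td' := (((tC₁.mul tC₂).mul (tK (b i))).mul tD).div (tA.mul (tK q)) (mul_ne_zero ha hq0)
  have P {f : ℕ × ℂ → ℂ} {y : ℂ} (hf : Tendsto f (atTop ×ˢ genericFilter) (𝓝 y)) :=
    tendsto_qPoch_atTop hq1 hf tn
  have L1 := (tendsto_tsum_trunc hq1 hW (fun _ => tendsto_const_nhds) tA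
    (fun _ => tendsto_const_nhds) (tendsto_vecCons₂ tC₁ tC₂) tD hd1 tn).mul
    ((P tD).mul ((tendsto_finsetProd (univ.erase i) fun j _ =>
      P ((tA.mul (tK q)).div (tK (b j)) (hb j))).mul
      (tendsto_finsetProd univ fun m _ => P ((ta'.mul (tK q)).mul (tK (x m))))))
  have L2 := ((P td').mul ((tendsto_finsetProd (univ.erase i) fun j _ =>
      P ((ta'.mul (tK q)).div (tK (b j)) (hb j))).mul
      (tendsto_finsetProd univ fun m _ => P ((tA.mul (tK q)).mul (tK (x m)))))).mul
    (tendsto_tsum_trunc hq1 hW' (fun _ => tendsto_const_nhds) ta' (tendsto_update_apply b i tw)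
      (tendsto_vecCons₂ tc₁' tc₂') td' hd1' tn)
  have key := tendsto_nhds_unique (L1.congr' ?_) L2
  · have e1 : ∀ m, A 1 ^ 2 * q ^ 2 * x m / (C₁ 1 * C₂ 1 * b i) =
        A 1 ^ 2 * q / (C₁ 1 * C₂ 1 * b i) * q * x m := fun m => by ring
    have e2 : ∀ j, A 1 ^ 2 * q ^ 2 / (C₁ 1 * C₂ 1 * b i * b j) =
        A 1 ^ 2 * q / (C₁ 1 * C₂ 1 * b i) * q / b j := fun j => by
      rw [← div_div]; ring
    simp only [e1, e2] at hnex ⊢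
    have n1 := prod_ne_zero_iff.2 fun m (_ : m ∈ univ) => hnex m
    have n2 := prod_ne_zero_iff.2 fun j (hj : j ∈ univ.erase i) => hneb j (mem_erase.1 hj).1
    rw [prod_div_distrib, prod_div_distrib]
    rw [div_mul_div_comm, div_mul_div_comm, div_mul_eq_mul_div,
      eq_div_iff (mul_ne_zero (mul_ne_zero hned n1) n2)]
    linear_combination key
  · filter_upwards [ts.eventually h.kGeneric, ts.eventually (h.kGeneric_swap_b hq0 i)] with p h1 h2
    exact h1.trunc_swap_b h2 rfl rfl rfl rfl hq0 hq1 p.1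

end

end

/-! ### One-sided series and the splitting of W -/

section

open scoped BigOperators Topology
open Finset Filter

section

/-- A convolution in which one end carries a geometric weight. -/
theorem tendsto_sum_range_pow_mul {q : ℂ} (hq1 : ‖q‖ < 1) {f g : ℕ → ℂ} {F G : ℂ}
    (hf : Tendsto f atTop (𝓝 F)) (hg : Tendsto g atTop (𝓝 G)) :
    Tendsto (fun N => ∑ k ∈ range (N + 1), q ^ k * f k * g (N - k)) atTop
      (𝓝 ((∑' k, q ^ k * f k) * G)) := by
  obtain ⟨C, hC⟩ := (Metric.isBounded_range_of_tendsto f hf).exists_norm_le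
  obtain ⟨C', hC'⟩ := (Metric.isBounded_range_of_tendsto g hg).exists_norm_le
  have hC : ∀ k, ‖f k‖ ≤ C := fun k => hC _ ⟨k, rfl⟩
  have hC' : ∀ k, ‖g k‖ ≤ C' := fun k => hC' _ ⟨k, rfl⟩
  have hC0 : 0 ≤ C := (norm_nonneg _).trans (hC 0)
  have hC0' : 0 ≤ C' := (norm_nonneg _).trans (hC' 0)
  have e : ∀ N, ∑ k ∈ range (N + 1), q ^ k * f k * g (N - k) =
      ∑' k, if k < N + 1 then q ^ k * f k * g (N - k) else 0 := by
    intro N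
    rw [tsum_eq_sum (s := range (N + 1)) fun k hk => if_neg (by simpa using hk)]
    exact sum_congr rfl fun k hk => (if_pos (mem_range.1 hk)).symm
  simp only [e, ← tsum_mul_right]
  refine tendsto_tsum_of_dominated_convergence
    ((summable_geometric_of_lt_one (norm_nonneg q) hq1).mul_right (C * C')) (fun k => ?_)
    (.of_forall fun N k => ?_)
  · refine (((hg.comp (tendsto_sub_atTop_nat k)).const_mul (q ^ k * f k))).congr' ?_
    filter_upwards [eventually_ge_atTop k] with N hN
    rw [if_pos (by omega)]; rfl
  · split_ifs
    · rw [norm_mul, norm_mul, norm_pow, mul_assoc]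
      gcongr
      · exact hC k
      · exact hC' _
    · rw [norm_zero]; positivity

end

theorem qPochInf_self_ne_zero {q : ℂ} (hq1 : ‖q‖ < 1) : qPochInf q q ≠ 0 :=
  qPochInf_ne_zero hq1 fun _ => qPoch_ne_zero_of_forall fun s _ hs =>
    pow_ne_one_of_norm_lt_one hq1 (Nat.succ_ne_zero s) (by rw [pow_succ', hs])

/-- The one-sided series at the end `y`. -/
noncomputable def endSeries (q y y' β₀ : ℂ) {m : ℕ} (β : Fin m → ℂ) (x₀ : ℂ) {M : ℕ}
    (x : Fin M → ℂ) : ℂ := ∑' k, q ^ k * endWeight q y y' β₀ β x₀ x k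

section
variable {q : ℂ} {M m : ℕ} {x : Fin M → ℂ} {β : Fin m → ℂ} {y y' y'' β₀ x₀ x₀' : ℂ}

/-- At a given end y, the series depends on y' and x₀ only through the unordered pair q/y', x₀. This
identifies one-sided series coming from different W. -/
theorem endSeries_congr (h : q * y / y'' = x₀ * y) (h' : x₀' * y = q * y / y') :
    endSeries q y y' β₀ β x₀ x = endSeries q y y'' β₀ β x₀' x := by
  unfold endSeries endWeight
  refine tsum_congr fun k => ?_
  rw [h, h']
  ring

theorem tendsto_endWeight (hq1 : ‖q‖ < 1) (h1 : ∀ l, qPoch q (q * y / y') l ≠ 0)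
    (h2 : ∀ l, qPoch q (x₀ * y) l ≠ 0) (h3 : ∀ i l, qPoch q (x i * y) l ≠ 0) :
    Tendsto (endWeight q y y' β₀ β x₀ x) atTop
      (𝓝 (qPochInf q (y / β₀) * (∏ j, qPochInf q (y / β j)) * (qPochInf q q *
        qPochInf q (q * y / y') * (qPochInf q (x₀ * y) * ∏ i, qPochInf q (x i * y)))⁻¹)) := by
  have P (z : ℂ) : Tendsto (fun k => qPoch q z k) atTop (𝓝 (qPochInf q z)) :=
    tendsto_qPoch_atTop hq1 tendsto_const_nhds tendsto_id
  have h0 : qPochInf q q ≠ 0 := qPochInf_self_ne_zero hq1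
  refine ((P _).mul (tendsto_finsetProd _ fun j _ => P _)).mul (Tendsto.inv₀ (((P _).mul (P _)).mul
    ((P _).mul (tendsto_finsetProd _ fun i _ => P _))) ?_)
  exact mul_ne_zero (mul_ne_zero h0 (qPochInf_ne_zero hq1 h1)) (mul_ne_zero (qPochInf_ne_zero hq1 h2)
    (prod_ne_zero_iff.2 fun i _ => qPochInf_ne_zero hq1 (h3 i)))

/-- The numerator y q^k - y' q^{N-k} splits the sum into two convolutions, each geometrically
weighted at one end; in the limit the opposite weight is replaced by its limit value. -/
theorem tendsto_twoEndSum (hq1 : ‖q‖ < 1) {E E' : ℂ}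
    (h : Tendsto (endWeight q y y' β₀ β x₀ x) atTop (𝓝 E))
    (h' : Tendsto (endWeight q y' y β₀ β x₀ x) atTop (𝓝 E')) :
    Tendsto (twoEndSum q y y' β₀ β x₀ x) atTop
      (𝓝 (y / (y - y') * (endSeries q y y' β₀ β x₀ x * E') -
        y' / (y - y') * (endSeries q y' y β₀ β x₀ x * E))) := by
  have k1 := (tendsto_sum_range_pow_mul hq1 h h').const_mul (y / (y - y'))
  have k2 := (tendsto_sum_range_pow_mul hq1 h' h).const_mul (y' / (y - y'))
  refine (k1.sub k2).congr fun N => ?_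
  rw [← sum_range_reflect (fun k => q ^ k * endWeight q y' y β₀ β x₀ x k *
    endWeight q y y' β₀ β x₀ x (N - k)), mul_sum, mul_sum, ← sum_sub_distrib]
  refine sum_congr rfl fun k hk => ?_
  have hk' := mem_range.1 hk
  rw [show N + 1 - 1 - k = N - k by omega, show N - (N - k) = k by omega]
  ring

end

section
variable {q : ℂ} {M : ℕ} {x : Fin M → ℂ} {a : ℂ} {b : Fin (M + 2) → ℂ} {c₁ c₂ d : ℂ}

theorem OffPowers.qPochInf_ne_zero {z : ℂ} (h : OffPowers q z) (hq0 : q ≠ 0) (hq1 : ‖q‖ < 1) :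
    qPochInf q z ≠ 0 := _root_.qPochInf_ne_zero hq1 (h.qPoch_ne_zero hq0)

theorem qPochInf_eq_one_sub_mul (hq1 : ‖q‖ < 1) (z : ℂ) :
    qPochInf q z = (1 - z) * qPochInf q (q * z) := by
  rw [qPochInf_split hq1 z 1, qPoch_succ, qPoch_zero, pow_zero, pow_one, mul_one, one_mul,
    mul_comm z q]

/-- The series `W` as a combination of two one-sided series. -/
theorem KGeneric.kajiharaW_eq (h : KGeneric q x a b c₁ c₂ d) (hq0 : q ≠ 0) (hq1 : ‖q‖ < 1)
    (hd1 : ‖d‖ < 1) :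
    kajiharaW q x a b ![c₁, c₂] d * (qPochInf q d * ∏ j, qPochInf q (a * q / b j)) =
      (∏ i, qPochInf q (a * q * x i)) *
      (qPochInf q c₁ * qPochInf q (c₂ * d) / qPochInf q (c₁ / c₂) *
        ((∏ j, qPochInf q (a * q / c₂ / b j)) / ∏ i, qPochInf q (x i * (a * q / c₂))) *
        endSeries q (a * q / c₁) (a * q / c₂) (a * q / (c₁ * c₂)) b (c₁ * c₂ * d / (a * q)) x +
      qPochInf q c₂ * qPochInf q (c₁ * d) / qPochInf q (c₂ / c₁) *
        ((∏ j, qPochInf q (a * q / c₁ / b j)) / ∏ i, qPochInf q (x i * (a * q / c₁))) *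
        endSeries q (a * q / c₂) (a * q / c₁) (a * q / (c₁ * c₂)) b (c₁ * c₂ * d / (a * q)) x) := by
  have ha := h.a_ne
  have hc₁ := h.c₁_ne
  have hc₂ := h.c₂_ne
  have P (z : ℂ) : Tendsto (fun k => qPoch q z k) atTop (𝓝 (qPochInf q z)) :=
    tendsto_qPoch_atTop hq1 tendsto_const_nhds tendsto_id
  have f1 : q * (a * q / c₁) / (a * q / c₂) = q * (c₂ / c₁) := by field_simp
  have f2 : q * (a * q / c₂) / (a * q / c₁) = q * (c₁ / c₂) := by field_simp
  have f3 : c₁ * c₂ * d / (a * q) * (a * q / c₁) = c₂ * d := by field_simp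
  have f4 : c₁ * c₂ * d / (a * q) * (a * q / c₂) = c₁ * d := by field_simp
  have f5 : a * q / c₁ / (a * q / (c₁ * c₂)) = c₂ := by field_simp
  have f6 : a * q / c₂ / (a * q / (c₁ * c₂)) = c₁ := by field_simp
  have f7 (c : ℂ) (i : Fin M) : x i * (a * q / c) = q * (a * x i / c) := by ring
  have h21 : OffPowers q (c₂ / c₁) := by simpa using h.c₁₂.inv
  have t1 := tendsto_endWeight (x₀ := c₁ * c₂ * d / (a * q)) (β := b) (x := x)
    (β₀ := a * q / (c₁ * c₂)) (y := a * q / c₁) (y' := a * q / c₂) hq1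
    (by rw [f1]; exact (h21.mul_q hq0).qPoch_ne_zero hq0)
    (by rw [f3]; exact h.c₂d.qPoch_ne_zero hq0)
    (fun i => by rw [f7]; exact ((h.axc₁ i).mul_q hq0).qPoch_ne_zero hq0)
  have t2 := tendsto_endWeight (x₀ := c₁ * c₂ * d / (a * q)) (β := b) (x := x)
    (β₀ := a * q / (c₁ * c₂)) (y := a * q / c₂) (y' := a * q / c₁) hq1
    (by rw [f2]; exact (h.c₁₂.mul_q hq0).qPoch_ne_zero hq0)
    (by rw [f4]; exact h.c₁d.qPoch_ne_zero hq0)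
    (fun i => by rw [f7]; exact ((h.axc₂ i).mul_q hq0).qPoch_ne_zero hq0)
  have L1 := (tendsto_tsum_trunc hq1 (h.regular hq0 hq1) (fun _ => tendsto_const_nhds)
    tendsto_const_nhds (fun _ => tendsto_const_nhds) (fun _ => tendsto_const_nhds)
    tendsto_const_nhds hd1 tendsto_id).mul
    ((P d).mul (tendsto_finsetProd univ fun j _ => P (a * q / b j)))
  have L2 := ((((P (c₁ * d)).mul (P (c₂ * d))).mul (P q)).mul
    (tendsto_finsetProd univ fun i _ => P (a * q * x i))).mul (tendsto_twoEndSum hq1 t1 t2)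
  have key := tendsto_nhds_unique (L1.congr fun N => h.tsum_trunc hq0 hq1 N) L2
  rw [key, f1, f2, f3, f4, f5, f6, qPochInf_eq_one_sub_mul hq1 (c₁ / c₂),
    qPochInf_eq_one_sub_mul hq1 (c₂ / c₁)]
  have n1 := (h.c₁₂.mul_q hq0).qPochInf_ne_zero hq0 hq1
  have n2 := (h21.mul_q hq0).qPochInf_ne_zero hq0 hq1
  have n3 := h.c₁d.qPochInf_ne_zero hq0 hq1
  have n4 := h.c₂d.qPochInf_ne_zero hq0 hq1
  have n5 : ∏ i, qPochInf q (x i * (a * q / c₁)) ≠ 0 := prod_ne_zero_iff.2 fun i _ => by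
    rw [f7]; exact ((h.axc₁ i).mul_q hq0).qPochInf_ne_zero hq0 hq1
  have n6 : ∏ i, qPochInf q (x i * (a * q / c₂)) ≠ 0 := prod_ne_zero_iff.2 fun i _ => by
    rw [f7]; exact ((h.axc₂ i).mul_q hq0).qPochInf_ne_zero hq0 hq1
  have n7 : qPochInf q q ≠ 0 := qPochInf_self_ne_zero hq1
  have n8 : c₂ - c₁ ≠ 0 := fun h0 => h.c₁₂.ne_one (by rw [← sub_eq_zero.1 h0, div_self hc₂])
  have n8' : c₁ - c₂ ≠ 0 := fun h0 => n8 (by rw [← neg_sub, h0, neg_zero])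
  -- This supplies the missing first factor that turns (q c₁/c₂)_∞ into (c₁/c₂)_∞.
  have g1 : a * q / c₁ / (a * q / c₁ - a * q / c₂) = (1 - c₁ / c₂)⁻¹ := by
    rw [show a * q / c₁ - a * q / c₂ = a * q * (c₂ - c₁) / (c₁ * c₂) by field_simp,
      show 1 - c₁ / c₂ = (c₂ - c₁) / c₂ by field_simp]
    field_simp
  have g2 : a * q / c₂ / (a * q / c₁ - a * q / c₂) = -(1 - c₂ / c₁)⁻¹ := by
    rw [show a * q / c₁ - a * q / c₂ = -(a * q * (c₁ - c₂) / (c₁ * c₂)) by field_simp; ring,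
      show 1 - c₂ / c₁ = (c₁ - c₂) / c₁ by field_simp]
    field_simp
  have n9 : 1 - c₁ / c₂ ≠ 0 := sub_ne_zero.2 h.c₁₂.ne_one.symm
  have n10 : 1 - c₂ / c₁ ≠ 0 := sub_ne_zero.2 h21.ne_one.symm
  rw [g1, g2]
  generalize 1 - c₁ / c₂ = r₁ at *
  generalize 1 - c₂ / c₁ = r₂ at *
  generalize ∏ i, qPochInf q (x i * (a * q / c₁)) = X₁ at *
  generalize ∏ i, qPochInf q (x i * (a * q / c₂)) = X₂ at *
  generalize ∏ j, qPochInf q (a * q / c₁ / b j) = Y₁ at *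
  generalize ∏ j, qPochInf q (a * q / c₂ / b j) = Y₂ at *
  generalize ∏ i, qPochInf q (a * q * x i) = X at *
  generalize endSeries q (a * q / c₁) _ _ _ _ _ = S₁ at *
  generalize endSeries q (a * q / c₂) _ _ _ _ _ = S₂ at *
  generalize qPochInf q (q * (c₁ / c₂)) = u at *
  generalize qPochInf q (q * (c₂ / c₁)) = u' at *
  generalize qPochInf q (c₁ * d) = v at *
  generalize qPochInf q (c₂ * d) = v' at *
  generalize qPochInf q q = w at *
  clear key L1 L2 t1 t2 f1 f2 f3 f4 f5 f6
  field_simp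
  ring

end

end

/-! ### Elimination of the third one-sided series -/

section

open scoped BigOperators Topology
open Finset Filter

section
variable {q : ℂ} {M : ℕ} {x : Fin M → ℂ} {a : ℂ} {b : Fin (M + 2) → ℂ} {c₁ c₂ d : ℂ}

/-- Linear elimination with u = c₂d/q and v = c₁d/q. The contributions of S₃ cancel because u/(u -
v) · (1 - 1/u)/(1 - u) = -1/(u - v) is antisymmetric in u and v; S₁ and S₂ then match separately. -/
theorem three_term_aux {W W₁ W₂ S₁ S₂ S₃ u v Q₁ Q₂ R₁ R₂ D D' V₁ V₂ p₁ p₂ T T' X X₁ X₂ B B₁ B₂ N₁ N₂ N₃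
    Z₁ Z₂ Z₃ : ℂ} (hu : u ≠ 0) (hv : v ≠ 0) (hu1 : u - 1 ≠ 0) (hv1 : v - 1 ≠ 0) (huv : u - v ≠ 0)
    (hR₁ : R₁ ≠ 0) (hR₂ : R₂ ≠ 0) (hD : D ≠ 0) (hD' : D' ≠ 0) (hV₁ : V₁ ≠ 0) (hV₂ : V₂ ≠ 0)
    (hp₁ : p₁ ≠ 0) (hp₂ : p₂ ≠ 0) (hT : T ≠ 0) (hT' : T' ≠ 0) (hX₁ : X₁ ≠ 0) (hX₂ : X₂ ≠ 0)
    (hB : B ≠ 0) (hB₁ : B₁ ≠ 0) (hB₂ : B₂ ≠ 0) (hN₃ : N₃ ≠ 0) (hZ₁ : Z₁ ≠ 0) (hZ₂ : Z₂ ≠ 0)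
    (hZ₃ : Z₃ ≠ 0)
    (k : W * (D * B) = X * (Q₁ * V₂ / ((1 - v / u) * T) * (N₂ / Z₂) * S₁ +
      Q₂ * V₁ / ((1 - u / v) * T') * (N₁ / Z₁) * S₂))
    (k₁ : W₁ * (R₁ * B₁) = X₁ * (Q₂ * p₁ / ((1 - u) * V₂) * (N₁ / Z₁) * S₃ +
      D' * T' / ((1 - u⁻¹) * p₂) * (N₃ / Z₃) * S₁))
    (k₂ : W₂ * (R₂ * B₂) = X₂ * (Q₁ * p₂ / ((1 - v) * V₁) * (N₂ / Z₂) * S₃ +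
      D' * T / ((1 - v⁻¹) * p₁) * (N₃ / Z₃) * S₂)) :
    W = Q₁ * (R₁ * (V₂ * ((1 - u⁻¹) * p₂))) * (X * Z₃) * (N₂ * B₁) /
        (D * (D' * ((1 - v / u) * T * T')) * (Z₂ * X₁) * (B * N₃)) * W₁ +
      Q₂ * (R₂ * (V₁ * ((1 - v⁻¹) * p₁))) * (X * Z₃) * (N₁ * B₂) /
        (D * (D' * ((1 - u / v) * T' * T)) * (Z₁ * X₂) * (B * N₃)) * W₂ := by
  have hvu : v - u ≠ 0 := fun h => huv (by rw [← neg_sub, h, neg_zero])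
  have hu1' : 1 - u ≠ 0 := fun h => hu1 (by rw [← neg_sub, h, neg_zero])
  have hv1' : 1 - v ≠ 0 := fun h => hv1 (by rw [← neg_sub, h, neg_zero])
  rw [← eq_div_iff (by positivity)] at k k₁ k₂
  rw [show 1 - v / u = (u - v) / u by field_simp, show 1 - u / v = (v - u) / v by field_simp] at *
  rw [show 1 - u⁻¹ = (u - 1) / u by field_simp, show 1 - v⁻¹ = (v - 1) / v by field_simp] at *
  rw [k, k₁, k₂]
  field_simp
  ring

/-- The three series W have the end pairs {aq/c₁, aq/c₂}, {aq²/(c₁c₂d), aq/c₁} and {aq²/(c₁c₂d),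
aq/c₂}, and at a common end their one-sided series coincide. -/
theorem KGeneric.three_term (h : KGeneric q x a b c₁ c₂ d)
    (h13 : KGeneric q x (a * q / (c₁ * d)) b c₂ (q / d) (q / c₁))
    (h23 : KGeneric q x (a * q / (c₂ * d)) b c₁ (q / d) (q / c₂))
    (hq0 : q ≠ 0) (hq1 : ‖q‖ < 1) (hd1 : ‖d‖ < 1) (hc₁1 : ‖q / c₁‖ < 1) (hc₂1 : ‖q / c₂‖ < 1)
    (hden : threeTermDen q x a b c₁ c₂ d ≠ 0) (hden' : threeTermDen q x a b c₂ c₁ d ≠ 0) :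
    kajiharaW q x a b ![c₁, c₂] d =
      threeTermCoeff q x a b c₁ c₂ d *
        kajiharaW q x (a * q / (c₁ * d)) b ![c₂, q / d] (q / c₁) +
      threeTermCoeff q x a b c₂ c₁ d *
        kajiharaW q x (a * q / (c₂ * d)) b ![c₁, q / d] (q / c₂) := by
  have ha := h.a_ne
  have hc₁ := h.c₁_ne
  have hc₂ := h.c₂_ne
  have hd := h.d_ne
  have k12 := h.kajiharaW_eq hq0 hq1 hd1
  have k13 := h13.kajiharaW_eq hq0 hq1 hc₁1
  have k23 := h23.kajiharaW_eq hq0 hq1 hc₂1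
  have e1 : a * q / (c₁ * d) * q / (q / d) = a * q / c₁ := by field_simp
  have e2 : a * q / (c₂ * d) * q / (q / d) = a * q / c₂ := by field_simp
  have e3 : a * q / (c₁ * d) * q / c₂ = a * q ^ 2 / (c₁ * c₂ * d) := by field_simp
  have e4 : a * q / (c₂ * d) * q / c₁ = a * q ^ 2 / (c₁ * c₂ * d) := by field_simp
  have e5 : a * q / (c₁ * d) * q / (c₂ * (q / d)) = a * q / (c₁ * c₂) := by field_simp
  have e6 : a * q / (c₂ * d) * q / (c₁ * (q / d)) = a * q / (c₁ * c₂) := by field_simp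
  have e7 : c₂ * (q / d) * (q / c₁) / (a * q / (c₁ * d) * q) = c₂ / a := by field_simp
  have e8 : c₁ * (q / d) * (q / c₂) / (a * q / (c₂ * d) * q) = c₁ / a := by field_simp
  have e9 : q / d * (q / c₁) = q * (q / (c₁ * d)) := by field_simp
  have e10 : q / d * (q / c₂) = q * (q / (c₂ * d)) := by field_simp
  have e11 : c₂ / (q / d) = c₂ * d / q := by field_simp
  have e12 : c₁ / (q / d) = c₁ * d / q := by field_simp
  have e13 : q / d / c₂ = q / (c₂ * d) := by field_simp
  have e14 : q / d / c₁ = q / (c₁ * d) := by field_simp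
  have e15 : c₂ * (q / c₁) = q * (c₂ / c₁) := by ring
  have e16 : c₁ * (q / c₂) = q * (c₁ / c₂) := by ring
  have e17 : a * q / (c₁ * d) * q = a * q ^ 2 / (c₁ * d) := by ring
  have e18 : a * q / (c₂ * d) * q = a * q ^ 2 / (c₂ * d) := by ring
  have s1 : endSeries q (a * q / c₁) (a * q ^ 2 / (c₁ * c₂ * d)) (a * q / (c₁ * c₂)) b (c₂ / a) x =
      endSeries q (a * q / c₁) (a * q / c₂) (a * q / (c₁ * c₂)) b (c₁ * c₂ * d / (a * q)) x :=
    endSeries_congr (by field_simp) (by field_simp)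
  have s2 : endSeries q (a * q / c₂) (a * q ^ 2 / (c₁ * c₂ * d)) (a * q / (c₁ * c₂)) b (c₁ / a) x =
      endSeries q (a * q / c₂) (a * q / c₁) (a * q / (c₁ * c₂)) b (c₁ * c₂ * d / (a * q)) x :=
    endSeries_congr (by field_simp) (by field_simp)
  have s3 : endSeries q (a * q ^ 2 / (c₁ * c₂ * d)) (a * q / c₂) (a * q / (c₁ * c₂)) b (c₁ / a) x =
      endSeries q (a * q ^ 2 / (c₁ * c₂ * d)) (a * q / c₁) (a * q / (c₁ * c₂)) b (c₂ / a) x :=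
    endSeries_congr (by field_simp) (by field_simp)
  rw [e1, e3, e5, e7, e9, e11, e13, e15, s1] at k13
  rw [e2, e4, e6, e8, e10, e12, e14, e16, s2, s3] at k23
  rw [e17] at k13
  rw [e18] at k23
  have o21 : OffPowers q (c₂ / c₁) := by simpa using h.c₁₂.inv
  have ov : OffPowers q (c₁ * d / q) := by
    simpa [div_eq_mul_inv] using h.c₁d.mul_zpow hq0 (-1)
  have ou : OffPowers q (c₂ * d / q) := by
    simpa [div_eq_mul_inv] using h.c₂d.mul_zpow hq0 (-1)
  have ov' : OffPowers q (q / (c₁ * d)) := by simpa using ov.inv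
  have ou' : OffPowers q (q / (c₂ * d)) := by simpa using ou.inv
  have I {z : ℂ} (hz : OffPowers q z) := hz.qPochInf_ne_zero hq0 hq1
  have J {z : ℂ} (hz : OffPowers q z) := (hz.mul_q hq0).qPochInf_ne_zero hq0 hq1
  have fq : ∀ z, q * (z / q) = z := fun z => mul_div_cancel₀ z hq0
  have r12 : 1 - c₁ / c₂ = 1 - c₁ * d / q / (c₂ * d / q) := by congr 1; field_simp
  have r21 : 1 - c₂ / c₁ = 1 - c₂ * d / q / (c₁ * d / q) := by congr 1; field_simp
  have ru : 1 - q / (c₂ * d) = 1 - (c₂ * d / q)⁻¹ := by rw [inv_div]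
  have rv : 1 - q / (c₁ * d) = 1 - (c₁ * d / q)⁻¹ := by rw [inv_div]
  rw [qPochInf_eq_one_sub_mul hq1 (c₁ / c₂), qPochInf_eq_one_sub_mul hq1 (c₂ / c₁), r12, r21] at k12
  rw [qPochInf_eq_one_sub_mul hq1 (c₂ * d / q), qPochInf_eq_one_sub_mul hq1 (q / (c₂ * d)), fq,
    ru] at k13
  rw [qPochInf_eq_one_sub_mul hq1 (c₁ * d / q), qPochInf_eq_one_sub_mul hq1 (q / (c₁ * d)), fq,
    rv] at k23
  have w1 (c : ℂ) (i : Fin M) : a * q * x i / c = x i * (a * q / c) := by ring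
  have w2 (c : ℂ) (i : Fin M) : a * q ^ 2 * x i / c = a * q ^ 2 / c * x i := by ring
  have w3 (i : Fin M) : a * q ^ 2 / (c₁ * c₂ * d) * x i = x i * (a * q ^ 2 / (c₁ * c₂ * d)) :=
    mul_comm _ _
  have w4 (z c : ℂ) (j : Fin (M + 2)) : z / (c * b j) = z / c / b j := (div_div _ _ _).symm
  unfold threeTermDen at hden hden'
  unfold threeTermCoeff threeTermDen
  simp only [qPochInfs, List.map_cons, List.map_nil, List.prod_cons, List.prod_nil, mul_one,
    prod_mul_distrib, mul_comm c₂ c₁, w1, w2, w3, w4, mul_div_assoc q c₁ c₂, mul_div_assoc q c₂ c₁,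
    mul_ne_zero_iff] at hden hden' ⊢
  rw [qPochInf_eq_one_sub_mul hq1 (c₁ / c₂), qPochInf_eq_one_sub_mul hq1 (c₂ / c₁),
    qPochInf_eq_one_sub_mul hq1 (q / (c₁ * d)), qPochInf_eq_one_sub_mul hq1 (q / (c₂ * d)),
    r12, r21, ru, rv]
  obtain ⟨⟨⟨hD, hD', -, hT'⟩, hZ₂, hX₁⟩, hB, hN₃⟩ := hden
  obtain ⟨⟨⟨-, -, -, hT⟩, hZ₁, hX₂⟩, -, -⟩ := hden'
  refine three_term_aux (div_ne_zero (mul_ne_zero hc₂ hd) hq0)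
    (div_ne_zero (mul_ne_zero hc₁ hd) hq0) ?_ ?_ ?_ ?_ ?_ hD hD' (I h.c₁d) (I h.c₂d) (J ov') (J ou')
    hT hT' hX₁ hX₂ hB ?_ ?_ hN₃ hZ₁ hZ₂ ?_ k12 k13 k23
  · exact sub_ne_zero.2 ou.ne_one
  · exact sub_ne_zero.2 ov.ne_one
  · intro h0
    refine h.c₁₂.ne_one ?_
    rw [div_eq_one_iff_eq hc₂]
    have h1 := sub_eq_zero.1 h0
    field_simp at h1
    exact h1.symm
  · exact I (by simpa [div_eq_mul_inv, mul_comm] using (h.c₁_off.inv.mul_q hq0))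
  · exact I (by simpa [div_eq_mul_inv, mul_comm] using (h.c₂_off.inv.mul_q hq0))
  · exact prod_ne_zero_iff.2 fun j _ => I (by
      rw [show a * q ^ 2 / (c₁ * d) / b j = q * (a * q / (c₁ * d) / b j) by ring]
      exact (h13.ab j).mul_q hq0)
  · exact prod_ne_zero_iff.2 fun j _ => I (by
      rw [show a * q ^ 2 / (c₂ * d) / b j = q * (a * q / (c₂ * d) / b j) by ring]
      exact (h23.ab j).mul_q hq0)
  · refine prod_ne_zero_iff.2 fun i _ => I ?_
    rw [show x i * (a * q ^ 2 / (c₁ * c₂ * d)) = q * (a * q / (c₁ * d) * x i / c₂) by field_simp]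
    exact (h13.axc₁ i).mul_q hq0

end

end

/-! ### The three-term relation for arbitrary admissible parameters -/

section

open scoped BigOperators Topology
open Finset Filter

section
variable {T : Type*} {𝓕 : Filter T} {q : ℂ} {M : ℕ} {x : Fin M → ℂ} {b : Fin (M + 2) → ℂ}
  {a₀ c₁₀ c₂₀ d₀ : ℂ}

theorem tendsto_qPochInfs_four (hq1 : ‖q‖ < 1) {f g h k : T → ℂ} {y₁ y₂ y₃ y₄ : ℂ}
    (hf : Tendsto f 𝓕 (𝓝 y₁)) (hg : Tendsto g 𝓕 (𝓝 y₂)) (hh : Tendsto h 𝓕 (𝓝 y₃))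
    (hk : Tendsto k 𝓕 (𝓝 y₄)) :
    Tendsto (fun t => qPochInfs q [f t, g t, h t, k t]) 𝓕 (𝓝 (qPochInfs q [y₁, y₂, y₃, y₄])) := by
  simp only [qPochInfs, List.map_cons, List.map_nil, List.prod_cons, List.prod_nil, mul_one]
  exact (tendsto_qPochInf hq1 hf).mul ((tendsto_qPochInf hq1 hg).mul
    ((tendsto_qPochInf hq1 hh).mul (tendsto_qPochInf hq1 hk)))

theorem tendsto_qPochInfs_two (hq1 : ‖q‖ < 1) {f g : T → ℂ} {y₁ y₂ : ℂ}
    (hf : Tendsto f 𝓕 (𝓝 y₁)) (hg : Tendsto g 𝓕 (𝓝 y₂)) :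
    Tendsto (fun t => qPochInfs q [f t, g t]) 𝓕 (𝓝 (qPochInfs q [y₁, y₂])) := by
  simp only [qPochInfs, List.map_cons, List.map_nil, List.prod_cons, List.prod_nil, mul_one]
  exact (tendsto_qPochInf hq1 hf).mul (tendsto_qPochInf hq1 hg)

variable {a c₁ c₂ d : T → ℂ}

theorem tendsto_threeTermDen (hq1 : ‖q‖ < 1) (ha : Tendsto a 𝓕 (𝓝 a₀)) (hc₁ : Tendsto c₁ 𝓕 (𝓝 c₁₀))
    (hc₂ : Tendsto c₂ 𝓕 (𝓝 c₂₀)) (hd : Tendsto d 𝓕 (𝓝 d₀)) (hc₁0 : c₁₀ ≠ 0) (hc₂0 : c₂₀ ≠ 0)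
    (hd0 : d₀ ≠ 0) (hb : ∀ j, b j ≠ 0) :
    Tendsto (fun t => threeTermDen q x (a t) b (c₁ t) (c₂ t) (d t)) 𝓕
      (𝓝 (threeTermDen q x a₀ b c₁₀ c₂₀ d₀)) := by
  have K (y : ℂ) : Tendsto (fun _ : T => y) 𝓕 (𝓝 y) := tendsto_const_nhds
  refine ((tendsto_qPochInfs_four hq1 hd ((K q).div hd hd0) (hc₁.div hc₂ hc₂0)
    (((K q).mul hc₂).div hc₁ hc₁0)).mul (tendsto_finsetProd _ fun i _ =>
    tendsto_qPochInfs_two hq1 (((ha.mul (K q)).mul (K (x i))).div hc₂ hc₂0)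
      (((ha.mul (K (q ^ 2))).mul (K (x i))).div (hc₁.mul hd) (mul_ne_zero hc₁0 hd0)))).mul
    (tendsto_finsetProd _ fun j _ => tendsto_qPochInfs_two hq1 ((ha.mul (K q)).div (K (b j)) (hb j))
      ((ha.mul (K (q ^ 2))).div (((hc₁.mul hc₂).mul hd).mul (K (b j))) ?_))
  exact mul_ne_zero (mul_ne_zero (mul_ne_zero hc₁0 hc₂0) hd0) (hb j)

theorem tendsto_threeTermCoeff (hq1 : ‖q‖ < 1) (ha : Tendsto a 𝓕 (𝓝 a₀))
    (hc₁ : Tendsto c₁ 𝓕 (𝓝 c₁₀)) (hc₂ : Tendsto c₂ 𝓕 (𝓝 c₂₀)) (hd : Tendsto d 𝓕 (𝓝 d₀))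
    (hc₁0 : c₁₀ ≠ 0) (hc₂0 : c₂₀ ≠ 0) (hd0 : d₀ ≠ 0) (hb : ∀ j, b j ≠ 0)
    (hden : threeTermDen q x a₀ b c₁₀ c₂₀ d₀ ≠ 0) :
    Tendsto (fun t => threeTermCoeff q x (a t) b (c₁ t) (c₂ t) (d t)) 𝓕
      (𝓝 (threeTermCoeff q x a₀ b c₁₀ c₂₀ d₀)) := by
  have K (y : ℂ) : Tendsto (fun _ : T => y) 𝓕 (𝓝 y) := tendsto_const_nhds
  refine (((tendsto_qPochInfs_four hq1 hc₁ ((K q).div hc₁ hc₁0) (hc₂.mul hd)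
    ((K q).div (hc₂.mul hd) (mul_ne_zero hc₂0 hd0))).mul (tendsto_finsetProd _ fun i _ =>
    tendsto_qPochInfs_two hq1 ((ha.mul (K q)).mul (K (x i)))
      (((ha.mul (K (q ^ 2))).mul (K (x i))).div ((hc₁.mul hc₂).mul hd)
        (mul_ne_zero (mul_ne_zero hc₁0 hc₂0) hd0)))).mul
    (tendsto_finsetProd _ fun j _ => tendsto_qPochInfs_two hq1
      ((ha.mul (K q)).div (hc₂.mul (K (b j))) (mul_ne_zero hc₂0 (hb j)))
      ((ha.mul (K (q ^ 2))).div ((hc₁.mul hd).mul (K (b j)))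
        (mul_ne_zero (mul_ne_zero hc₁0 hd0) (hb j))))).div
    (tendsto_threeTermDen hq1 ha hc₁ hc₂ hd hc₁0 hc₂0 hd0 hb) hden

end

theorem kajiharaW_three_term {q : ℂ} {M : ℕ} {x : Fin M → ℂ} {a : ℂ} {b : Fin (M + 2) → ℂ}
    {c₁ c₂ d : ℂ} (hq0 : q ≠ 0) (hq1 : ‖q‖ < 1) (ha : a ≠ 0)
    (hd : d = a ^ 2 * q ^ 2 / (c₁ * c₂ * (∏ j, b j) * ∏ i, x i))
    (hW : KajiharaRegular q x a b ![c₁, c₂])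
    (hW₁ : KajiharaRegular q x (a * q / (c₁ * d)) b ![c₂, q / d])
    (hW₂ : KajiharaRegular q x (a * q / (c₂ * d)) b ![c₁, q / d])
    (hden : threeTermDen q x a b c₁ c₂ d ≠ 0) (hden' : threeTermDen q x a b c₂ c₁ d ≠ 0)
    (hd1 : ‖d‖ < 1) (hc₁1 : ‖q / c₁‖ < 1) (hc₂1 : ‖q / c₂‖ < 1) :
    kajiharaW q x a b ![c₁, c₂] d =
      threeTermCoeff q x a b c₁ c₂ d *
        kajiharaW q x (a * q / (c₁ * d)) b ![c₂, q / d] (q / c₁) +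
      threeTermCoeff q x a b c₂ c₁ d *
        kajiharaW q x (a * q / (c₂ * d)) b ![c₁, q / d] (q / c₂) := by
  have hc₁ : c₁ ≠ 0 := hW.2.2.2.1 0
  have hc₂ : c₂ ≠ 0 := hW.2.2.2.1 1
  have hd0 : d ≠ 0 := fun h => hW₁.2.2.2.1 1 (by simp [h])
  have hb := hW.2.2.1
  obtain ⟨A, C₁, C₂, D, h, rfl, rfl, rfl, rfl⟩ := hW.exists_isDeformation hq0 ha hd
  have tA := h.a_mono.tendsto
  have tC₁ := h.c₁_mono.tendsto
  have tC₂ := h.c₂_mono.tendsto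
  have tD := h.d_mono.tendsto
  have tq : Tendsto (fun _ : ℂ => q) genericFilter (𝓝 q) := tendsto_const_nhds
  have tw := tq.div tD hd0
  have tz₁ := tq.div tC₁ hc₁
  have tz₂ := tq.div tC₂ hc₂
  have L1 := tendsto_kajiharaW hq1 hW (fun _ => tendsto_const_nhds) tA
    (fun _ => tendsto_const_nhds) (tendsto_vecCons₂ tC₁ tC₂) tD hd1
  have L2 := ((tendsto_threeTermCoeff hq1 tA tC₁ tC₂ tD hc₁ hc₂ hd0 hb hden).mul
    (tendsto_kajiharaW hq1 hW₁ (fun _ => tendsto_const_nhds)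
      ((tA.mul tq).div (tC₁.mul tD) (mul_ne_zero hc₁ hd0)) (fun _ => tendsto_const_nhds)
      (tendsto_vecCons₂ tC₂ tw) tz₁ hc₁1)).add
    ((tendsto_threeTermCoeff hq1 tA tC₂ tC₁ tD hc₂ hc₁ hd0 hb hden').mul
    (tendsto_kajiharaW hq1 hW₂ (fun _ => tendsto_const_nhds)
      ((tA.mul tq).div (tC₂.mul tD) (mul_ne_zero hc₂ hd0)) (fun _ => tendsto_const_nhds)
      (tendsto_vecCons₂ tC₁ tw) tz₂ hc₂1))
  refine tendsto_nhds_unique (L1.congr' ?_) L2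
  -- The strict bounds on the arguments and the nonvanishing of both denominators are open
  -- conditions, so they persist near s = 1; N has already been sent to infinity here.
  filter_upwards [h.kGeneric, h.kGeneric₁₃ hq0, h.kGeneric₂₃ hq0, tD.norm.eventually_lt_const hd1,
    tz₁.norm.eventually_lt_const hc₁1, tz₂.norm.eventually_lt_const hc₂1,
    (tendsto_threeTermDen hq1 tA tC₁ tC₂ tD hc₁ hc₂ hd0 hb).eventually_ne hden,
    (tendsto_threeTermDen hq1 tA tC₂ tC₁ tD hc₂ hc₁ hd0 hb).eventually_ne hden']
    with s g g₁ g₂ m m₁ m₂ n n'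
  exact g.three_term g₁ g₂ hq0 hq1 m m₁ m₂ n n'

end

theorem mainTheorem4 (q : ℂ) (hq0 : q ≠ 0) (hq1 : ‖q‖ < 1) (M : ℕ) [NeZero M]
    (x : Fin M → ℂ) (a : ℂ) (b : Fin (M + 2) → ℂ) (c₁ c₂ d : ℂ) (ha : a ≠ 0)
    (hd : d = a ^ 2 * q ^ 2 / (c₁ * c₂ * (∏ j, b j) * ∏ i, x i))
    (hW : KajiharaRegular q x a b ![c₁, c₂]) :
    -- (1)
    (KajiharaRegular q (Function.update x 0 (c₁ * c₂ * d / (a * q))) a b ![c₁, c₂] →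
      qPochInfs q [d, c₁ * c₂ * d, a * q * x 0 / c₁, a * q * x 0 / c₂] ≠ 0 →
      ‖d‖ < 1 → ‖a * q * x 0 / (c₁ * c₂)‖ < 1 →
      Summable (kajiharaTerm q x a b ![c₁, c₂] d) ∧
      Summable (kajiharaTerm q (Function.update x 0 (c₁ * c₂ * d / (a * q))) a b ![c₁, c₂]
        (a * q * x 0 / (c₁ * c₂))) ∧
      kajiharaW q x a b ![c₁, c₂] d =
        qPochInfs q [c₁ * d, c₂ * d, a * q * x 0, a * q * x 0 / (c₁ * c₂)] /
          qPochInfs q [d, c₁ * c₂ * d, a * q * x 0 / c₁, a * q * x 0 / c₂] *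
        kajiharaW q (Function.update x 0 (c₁ * c₂ * d / (a * q))) a b ![c₁, c₂]
          (a * q * x 0 / (c₁ * c₂))) ∧
    -- (2)
    (KajiharaRegular q x (a ^ 2 * q / (c₁ * c₂ * b 0))
        (Function.update b 0 (a * q / (c₁ * c₂)))
        ![a * q / (c₁ * b 0), a * q / (c₂ * b 0)] →
      qPochInf q d ≠ 0 →
      (∀ i, qPochInf q (a ^ 2 * q ^ 2 * x i / (c₁ * c₂ * b 0)) ≠ 0) →
      (∀ j, j ≠ 0 → qPochInf q (a * q / b j) ≠ 0) →
      ‖d‖ < 1 → ‖c₁ * c₂ * b 0 * d / (a * q)‖ < 1 →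
      Summable (kajiharaTerm q x a b ![c₁, c₂] d) ∧
      Summable (kajiharaTerm q x (a ^ 2 * q / (c₁ * c₂ * b 0))
        (Function.update b 0 (a * q / (c₁ * c₂)))
        ![a * q / (c₁ * b 0), a * q / (c₂ * b 0)] (c₁ * c₂ * b 0 * d / (a * q))) ∧
      kajiharaW q x a b ![c₁, c₂] d =
        qPochInf q (c₁ * c₂ * b 0 * d / (a * q)) / qPochInf q d *
        (∏ i, qPochInf q (a * q * x i) /
          qPochInf q (a ^ 2 * q ^ 2 * x i / (c₁ * c₂ * b 0))) *
        (∏ j ∈ Finset.univ.erase 0, qPochInf q (a ^ 2 * q ^ 2 / (c₁ * c₂ * b 0 * b j)) /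
          qPochInf q (a * q / b j)) *
        kajiharaW q x (a ^ 2 * q / (c₁ * c₂ * b 0))
          (Function.update b 0 (a * q / (c₁ * c₂)))
          ![a * q / (c₁ * b 0), a * q / (c₂ * b 0)] (c₁ * c₂ * b 0 * d / (a * q))) ∧
    -- (3)
    (KajiharaRegular q x (a * q / (c₁ * d)) b ![c₂, q / d] →
      KajiharaRegular q x (a * q / (c₂ * d)) b ![c₁, q / d] →
      threeTermDen q x a b c₁ c₂ d ≠ 0 → threeTermDen q x a b c₂ c₁ d ≠ 0 →
      ‖d‖ < 1 → ‖q / c₁‖ < 1 → ‖q / c₂‖ < 1 →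
      Summable (kajiharaTerm q x a b ![c₁, c₂] d) ∧
      Summable (kajiharaTerm q x (a * q / (c₁ * d)) b ![c₂, q / d] (q / c₁)) ∧
      Summable (kajiharaTerm q x (a * q / (c₂ * d)) b ![c₁, q / d] (q / c₂)) ∧
      kajiharaW q x a b ![c₁, c₂] d =
        threeTermCoeff q x a b c₁ c₂ d *
          kajiharaW q x (a * q / (c₁ * d)) b ![c₂, q / d] (q / c₁) +
        threeTermCoeff q x a b c₂ c₁ d *
          kajiharaW q x (a * q / (c₂ * d)) b ![c₁, q / d] (q / c₂)) := by
  refine ⟨fun h h0 h1 h2 => ⟨summable_kajiharaTerm hq1 hW h1, summable_kajiharaTerm hq1 h h2,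
      kajiharaW_swap_x 0 hq0 hq1 ha hd hW h h0 h1 h2⟩,
    fun h h0 hx hb h1 h2 => ⟨summable_kajiharaTerm hq1 hW h1, summable_kajiharaTerm hq1 h h2,
      kajiharaW_swap_b 0 hq0 hq1 ha hd hW h h0 hx hb h1 h2⟩,
    fun h h' h0 h0' h1 h2 h3 => ⟨summable_kajiharaTerm hq1 hW h1, summable_kajiharaTerm hq1 h h2,
      summable_kajiharaTerm hq1 h' h3,
      kajiharaW_three_term hq0 hq1 ha hd hW h h' h0 h0' h1 h2 h3⟩⟩
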